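/- For $\tau$ in the upper half-plane $\mathbb H$ put $q=e^{2\pi i\tau}$, $q^{1/4}=e^{2\pi i\tau/4}$, $$X(\tau)=q^{1/4}\prod_{m\ge 1}\frac{(1-q^{6m-1})(1-q^{6m-5})}{(1-q^{6m-2})(1-q^{6m-4})},\qquad w(\tau)=X(\tau)X(3\tau).$$ For a function $f$ that is holomorphic on $\mathbb H$, invariant under $\Gamma_0(N)$ and meromorphic at all cusps (a modular function on $\Gamma_0(N)$ without poles on $\mathbb H$), let the total degree of its poles on $\Gamma_0(N)$ be $-\sum_r \mathrm{ord}_r f$, where $r$ runs over the inequivalent cusps of $\Gamma_0(N)$ at which $f$ has a pole; here $\mathrm{ord}_r f$ is the order at $0$ of the expansion of $f(\gamma\tau)$ in powers of $e^{2\pi i\tau/h}$, with $\gamma\in \mathrm{SL}_2(\mathbb Z)$, $\gamma\infty=r$, and $h$ the width of the cusp $r$. There is an algorithm (a computable function) which, given a positive integer $n$, outputs the finite list of exponents and rational coefficients of a polynomial $F_n(X,Y)\in\mathbb Q[X,Y]$ such that for every $n\geq 1$: 1. $F_n$ is irreducible in $\mathbb C[X,Y]$ (and so also in $\mathbb Q[X,Y]$),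 and $F_n(w(\tau),w(n\tau))=0$ for all $\tau\in\mathbb H$; that is, $F_n(X,Y)=0$ is a modular equation for $w$ of level $n$; 2. $w(\tau)$ and $w(n\tau)$ are modular functions on $\Gamma_0(18n)$ without poles on $\mathbb H$; the degree of $F_n$ in $X$ equals the total degree of the poles of $w(n\tau)$ on $\Gamma_0(18n)$, and the degree of $F_n$ in $Y$ equals the total degree of the poles of $w(\tau)$ on $\Gamma_0(18n)$. -/

import Mathlib

open UpperHalfPlane
open scoped MatrixGroups

noncomputable section

/-- The continued fraction of order six, in its product form
`X(τ) = q^{1/4} ∏_{n ≥ 1} (1 - q^{6n-1})(1 - q^{6n-5}) / ((1 - q^{6n-2})(1 - q^{6n-4}))`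
with `q = exp (2πiτ)` and `q^{1/4} = exp (2πiτ/4)`. The index of the product below is `n - 1`.
It is meant for `0 < Im τ`. -/
def contFracX (τ : ℂ) : ℂ :=
  let q : ℂ := Complex.exp (2 * Real.pi * Complex.I * τ)
  Complex.exp (2 * Real.pi * Complex.I * τ / 4) *
    ∏' n : ℕ, ((1 - q ^ (6 * n + 5)) * (1 - q ^ (6 * n + 1))) /
      ((1 - q ^ (6 * n + 4)) * (1 - q ^ (6 * n + 2)))

/-- `w(τ) = X(τ) X(3τ)`. -/
def w (τ : ℂ) : ℂ := contFracX τ * contFracX (3 * τ)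

/-- The function `τ ↦ w(nτ)` on the upper half-plane. -/
def wLevel (n : ℕ) (τ : ℍ) : ℂ := w (n * (τ : ℂ))

/-- The set of cusps of `Γ₀(N)`: the orbits of `Γ₀(N)` on `ℚ ∪ {∞}`. -/
abbrev Gamma0Cusps (N : ℕ) : Type :=
  MulAction.orbitRel.Quotient
    ((CongruenceSubgroup.Gamma0 N).map (Matrix.SpecialLinearGroup.mapGL ℚ)) (OnePoint ℚ)

/-- The width of the cusp `γ∞` of `Γ₀(N)`: the least `h > 0` with `γ T^h γ⁻¹ ∈ Γ₀(N)`
(recall that `-1 ∈ Γ₀(N)`). -/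
def cuspWidth (N : ℕ) (γ : SL(2, ℤ)) : ℕ :=
  sInf {h : ℕ | 0 < h ∧ γ * ModularGroup.T ^ h * γ⁻¹ ∈ CongruenceSubgroup.Gamma0 N}

/-- The function `g` on the punctured unit disc with `f(γτ) = g(exp (2πiτ/h))`, where `h` is the
width of the cusp `γ∞` of `Γ₀(N)`. Its Laurent expansion at `0` is the `q`-expansion of `f` at
that cusp. -/
def expansionAt (N : ℕ) (f : ℍ → ℂ) (γ : SL(2, ℤ)) : ℂ → ℂ :=
  UpperHalfPlane.cuspFunction (cuspWidth N γ) (fun τ : ℍ => f (γ • τ))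

/-- `f` is a modular function on `Γ₀(N)` without poles on the upper half-plane: it is holomorphic
there, invariant under `Γ₀(N)`, and meromorphic at all cusps. -/
structure IsModularFunctionHolo (N : ℕ) (f : ℍ → ℂ) : Prop where
  holo : DifferentiableOn ℂ (fun z : ℂ => f (ofComplex z)) {z : ℂ | 0 < z.im}
  invariant : ∀ γ ∈ CongruenceSubgroup.Gamma0 N, ∀ τ : ℍ, f (γ • τ) = f τ
  meromorphic_cusps : ∀ γ : SL(2, ℤ), MeromorphicAt (expansionAt N f γ) 0

/-- The order of `f` at the point `r` of `ℚ ∪ {∞}`, with respect to `Γ₀(N)`: choose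
`γ ∈ SL(2, ℤ)` with `γ∞ = r` and take the order of the `q`-expansion of `f ∘ γ`. -/
def orderAtCusp (N : ℕ) (f : ℍ → ℂ) (r : OnePoint ℚ) : WithTop ℤ :=
  meromorphicOrderAt (expansionAt N f (OnePoint.exists_mem_SL2 ℤ r).choose) 0

/-- The total degree of the poles of `f` on `X₀(N)`, for a modular function `f` on `Γ₀(N)` without
poles on the upper half-plane: the sum of `-ord_r f` over those inequivalent cusps `r` at which
`ord_r f` is negative. -/
def totalPoleDegree (N : ℕ) (f : ℍ → ℂ) : ℕ :=
  ∑ᶠ c : Gamma0Cusps N, (-(orderAtCusp N f (Quotient.out c)).untop₀).toNat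

/-- The polynomial in `ℚ[X, Y]` (with `X`, `Y` the variables `0`, `1`) given by a finite list of
terms: the entry `(i, j, a, b)` stands for `(a / b) X^i Y^j` (which is `0` if `b = 0`). -/
def polyOfTerms (L : List (ℕ × ℕ × ℤ × ℕ)) : MvPolynomial (Fin 2) ℚ :=
  (L.map fun t => MvPolynomial.C ((t.2.2.1 : ℚ) / (t.2.2.2 : ℚ)) *
    MvPolynomial.X 0 ^ t.1 * MvPolynomial.X 1 ^ t.2.1).sum

/-- `F ∈ ℚ[X, Y]` is a modular equation for `w` of level `n`: it is irreducible in `ℂ[X, Y]`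
and `F(w(τ), w(nτ)) = 0` for all `τ` in the upper half-plane. -/
def IsModularEquation (n : ℕ) (F : MvPolynomial (Fin 2) ℚ) : Prop :=
  Irreducible (MvPolynomial.map (algebraMap ℚ ℂ) F) ∧
    ∀ τ : ℍ, MvPolynomial.aeval ![w (τ : ℂ), w (n * (τ : ℂ))] F = 0

end

section TripleProduct

open Filter Topology

/-- The finite `q`-Pochhammer product `∏_{k < n} (1 - p ^ (k + 1))`. -/
noncomputable def qFactorial (p : ℂ) (n : ℕ) : ℂ := ∏ k ∈ Finset.range n, (1 - p ^ (k + 1))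

/-- The Euler product `∏_{k ≥ 1} (1 - p ^ k)`. -/
noncomputable def eulerProd (p : ℂ) : ℂ := ∏' k : ℕ, (1 - p ^ (k + 1))

/-- The product `∏_{k ≥ 1} (1 + p ^ k)`. -/
noncomputable def eulerProdPlus (p : ℂ) : ℂ := ∏' k : ℕ, (1 + p ^ (k + 1))

/-- The Gaussian binomial coefficient. -/
noncomputable def gaussBinom (p : ℂ) (M j : ℕ) : ℂ :=
  qFactorial p M / (qFactorial p j * qFactorial p (M - j))

lemma one_sub_pow_succ_ne_zero {p : ℂ} (hp : ‖p‖ < 1) (k : ℕ) : 1 - p ^ (k + 1) ≠ 0 := by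
  intro h
  have h1 : ‖p ^ (k + 1)‖ = 1 := by rw [← sub_eq_zero.mp h]; simp
  rw [norm_pow] at h1
  exact absurd h1 (pow_lt_one₀ (norm_nonneg _) hp (Nat.succ_ne_zero _)).ne

lemma qFactorial_ne_zero {p : ℂ} (hp : ‖p‖ < 1) (n : ℕ) : qFactorial p n ≠ 0 :=
  Finset.prod_ne_zero_iff.mpr fun k _ => one_sub_pow_succ_ne_zero hp k

lemma qFactorial_succ (p : ℂ) (n : ℕ) :
    qFactorial p (n + 1) = qFactorial p n * (1 - p ^ (n + 1)) :=
  Finset.prod_range_succ _ _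

lemma gaussBinom_zero_right {p : ℂ} (hp : ‖p‖ < 1) (M : ℕ) : gaussBinom p M 0 = 1 := by
  have := qFactorial_ne_zero hp M
  have h0 : qFactorial p 0 = 1 := by simp [qFactorial]
  simp [gaussBinom, h0, this]

lemma gaussBinom_self {p : ℂ} (hp : ‖p‖ < 1) (M : ℕ) : gaussBinom p M M = 1 := by
  have := qFactorial_ne_zero hp M
  have h0 : qFactorial p 0 = 1 := by simp [qFactorial]
  simp [gaussBinom, h0, this]

lemma gaussBinom_succ_succ {p : ℂ} (hp : ‖p‖ < 1) {M j : ℕ} (h : j < M) :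
    gaussBinom p (M + 1) (j + 1) = gaussBinom p M (j + 1) + p ^ (M - j) * gaussBinom p M j := by
  obtain ⟨r, rfl⟩ := Nat.exists_eq_add_of_lt h
  have e1 : j + r + 1 + 1 - (j + 1) = r + 1 := by omega
  have e2 : j + r + 1 - (j + 1) = r := by omega
  have e3 : j + r + 1 - j = r + 1 := by omega
  simp only [gaussBinom, e1, e2, e3, qFactorial_succ]
  have h1 := qFactorial_ne_zero hp j
  have h2 := qFactorial_ne_zero hp r
  have h3 := one_sub_pow_succ_ne_zero hp j
  have h4 := one_sub_pow_succ_ne_zero hp r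
  field_simp
  ring

lemma succ_mul_self_div_two (j : ℕ) : (j + 1) * (j + 1 - 1) / 2 = j * (j - 1) / 2 + j := by
  rcases j with _ | j
  · rfl
  · have : (j + 1 + 1) * (j + 1 + 1 - 1) = (j + 1) * (j + 1 - 1) + 2 * (j + 1) := by
      simp; ring
    rw [this]; omega

/-- The `q`-binomial theorem. -/
theorem prod_one_add_mul_pow {p : ℂ} (hp : ‖p‖ < 1) (t : ℂ) (M : ℕ) :
    ∏ k ∈ Finset.range M, (1 + t * p ^ k) =
      ∑ j ∈ Finset.range (M + 1), gaussBinom p M j * p ^ (j * (j - 1) / 2) * t ^ j := by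
  induction M with
  | zero => simp [gaussBinom, qFactorial]
  | succ M ih =>
    rw [Finset.prod_range_succ, ih, mul_add, mul_one, Finset.sum_range_succ' _ (M + 1),
      Finset.sum_range_succ (n := M) (f := fun k => gaussBinom p (M + 1) (k + 1) *
        p ^ ((k + 1) * (k + 1 - 1) / 2) * t ^ (k + 1))]
    have h1 : ∀ j ∈ Finset.range M, gaussBinom p (M + 1) (j + 1) * p ^ ((j + 1) * (j + 1 - 1) / 2) *
        t ^ (j + 1) = gaussBinom p M (j + 1) * p ^ ((j + 1) * (j + 1 - 1) / 2) * t ^ (j + 1) +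
        gaussBinom p M j * p ^ (j * (j - 1) / 2) * t ^ j * (t * p ^ M) := by
      intro j hj
      have hj' := Finset.mem_range.mp hj
      rw [gaussBinom_succ_succ hp hj']
      have e : p ^ (M - j) * p ^ ((j + 1) * (j + 1 - 1) / 2) = p ^ (j * (j - 1) / 2) * p ^ M := by
        rw [← pow_add, ← pow_add, succ_mul_self_div_two]
        congr 1
        omega
      linear_combination gaussBinom p M j * t ^ (j + 1) * e
    rw [Finset.sum_congr rfl h1, Finset.sum_add_distrib, ← Finset.sum_mul]
    have e : p ^ ((M + 1) * (M + 1 - 1) / 2) = p ^ (M * (M - 1) / 2) * p ^ M := by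
      rw [← pow_add, succ_mul_self_div_two]
    have hA := Finset.sum_range_succ' (fun j => gaussBinom p M j * p ^ (j * (j - 1) / 2) * t ^ j) M
    have hB := Finset.sum_range_succ (fun j => gaussBinom p M j * p ^ (j * (j - 1) / 2) * t ^ j) M
    simp only [gaussBinom_self hp, gaussBinom_zero_right hp] at hA hB ⊢
    rw [e]
    linear_combination hA + t * p ^ M * hB

/-- The finite form of the Jacobi triple product. -/
theorem finite_triple_product {p z : ℂ} (hp : ‖p‖ < 1) (hp0 : p ≠ 0) (hz : z ≠ 0) (N : ℕ) :
    (∏ k ∈ Finset.range N, (1 + z * p ^ (k + 1))) * ∏ k ∈ Finset.range N, (1 + z⁻¹ * p ^ k) =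
      ∑ i ∈ Finset.range (N + 1), gaussBinom p (2 * N) (N - i) * (p ^ (i * (i + 1) / 2) * z ^ i) +
      ∑ i ∈ Finset.range N, gaussBinom p (2 * N) (N + 1 + i) *
        (p ^ (i * (i + 1) / 2) * z⁻¹ ^ (i + 1)) := by
  set t : ℂ := z⁻¹ * (p ^ N)⁻¹ with ht
  have hpN : p ^ N ≠ 0 := pow_ne_zero _ hp0
  have h1 : ∏ k ∈ Finset.range (2 * N), (1 + t * p ^ k) =
      (∏ k ∈ Finset.range N, (1 + t * p ^ k)) * ∏ k ∈ Finset.range N, (1 + z⁻¹ * p ^ k) := by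
    rw [two_mul, Finset.prod_range_add]
    congr 1
    refine Finset.prod_congr rfl fun k _ => ?_
    rw [ht, pow_add]; field_simp
  have h2 : ∀ n, ∏ k ∈ Finset.range n, (1 + z * p ^ (k + 1)) =
      z ^ n * p ^ (n * (n + 1) / 2) * ∏ k ∈ Finset.range n, (1 + z⁻¹ * (p ^ (k + 1))⁻¹) := by
    intro n
    induction n with
    | zero => simp
    | succ n ih =>
      rw [Finset.prod_range_succ, ih, Finset.prod_range_succ]
      have : (n + 1) * (n + 1 + 1) / 2 = n * (n + 1) / 2 + (n + 1) := by
        have : (n + 1) * (n + 1 + 1) = n * (n + 1) + 2 * (n + 1) := by ring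
        rw [this]; omega
      rw [this, pow_add, pow_succ z n]
      have := pow_ne_zero (n + 1) hp0
      field_simp
      ring
  have h3 : ∏ k ∈ Finset.range N, (1 + z⁻¹ * (p ^ (k + 1))⁻¹) =
      ∏ k ∈ Finset.range N, (1 + t * p ^ k) := by
    rw [← Finset.prod_range_reflect]
    refine Finset.prod_congr rfl fun k hk => ?_
    have hk := Finset.mem_range.mp hk
    have e : p ^ N = p ^ (N - 1 - k + 1) * p ^ k := by rw [← pow_add]; congr 1; omega
    have := pow_ne_zero k hp0
    have := pow_ne_zero (N - 1 - k + 1) hp0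
    rw [ht, e]
    field_simp
  rw [h2, h3, mul_assoc, ← h1, prod_one_add_mul_pow hp, show 2 * N + 1 = (N + 1) + N by ring,
    Finset.sum_range_add, mul_add]
  congr 1
  · rw [Finset.mul_sum, ← Finset.sum_range_reflect]
    refine Finset.sum_congr rfl fun i hi => ?_
    have hi := Finset.mem_range.mp hi
    obtain ⟨j, rfl⟩ : ∃ j, N = i + j := ⟨N - i, by omega⟩
    have e1 : i + j + 1 - 1 - i = j := by omega
    have e2 : i + j - i = j := by omega
    rw [e1, e2, ht]
    have e3 : p ^ ((i + j) * (i + j + 1) / 2) * p ^ (j * (j - 1) / 2) =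
        p ^ (i * (i + 1) / 2) * (p ^ (i + j)) ^ j := by
      rw [← pow_add, ← pow_mul, ← pow_add]
      congr 1
      have h1 : 2 ∣ (i + j) * (i + j + 1) := (Nat.even_mul_succ_self _).two_dvd
      have h2 : 2 ∣ j * (j - 1) := (Nat.even_mul_pred_self _).two_dvd
      have h3 : 2 ∣ i * (i + 1) := (Nat.even_mul_succ_self _).two_dvd
      have h4 : (i + j) * (i + j + 1) + j * (j - 1) = i * (i + 1) + 2 * ((i + j) * j) := by
        rcases j with _ | j
        · simp
        · simp; ring
      omega
    rw [mul_pow, inv_pow, inv_pow, pow_add z i j]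
    have := pow_ne_zero j hz
    have := pow_ne_zero j (pow_ne_zero (i + j) hp0)
    field_simp
    linear_combination gaussBinom p (2 * (i + j)) j * e3
  · rw [Finset.mul_sum]
    refine Finset.sum_congr rfl fun i hi => ?_
    rw [ht]
    have e3 : p ^ (N * (N + 1) / 2) * p ^ ((N + 1 + i) * (N + 1 + i - 1) / 2) =
        p ^ (i * (i + 1) / 2) * (p ^ N) ^ (N + 1 + i) := by
      rw [← pow_add, ← pow_mul, ← pow_add]
      congr 1
      have h1 : 2 ∣ N * (N + 1) := (Nat.even_mul_succ_self _).two_dvd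
      have h2 : 2 ∣ (N + 1 + i) * (N + 1 + i - 1) := (Nat.even_mul_pred_self _).two_dvd
      have h3 : 2 ∣ i * (i + 1) := (Nat.even_mul_succ_self _).two_dvd
      have h4 : N * (N + 1) + (N + 1 + i) * (N + 1 + i - 1) =
          i * (i + 1) + 2 * (N * (N + 1 + i)) := by
        rw [show N + 1 + i - 1 = N + i by omega]
        ring
      omega
    rw [mul_pow, inv_pow, inv_pow, inv_pow, show z ^ (N + 1 + i) = z ^ N * z ^ (i + 1) by ring]
    have := pow_ne_zero N hz
    have := pow_ne_zero (i + 1) hz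
    have := pow_ne_zero (N + 1 + i) (pow_ne_zero N hp0)
    field_simp
    linear_combination gaussBinom p (2 * N) (N + 1 + i) * e3

lemma summable_norm_pow_add {p : ℂ} (hp : ‖p‖ < 1) (c : ℂ) (d : ℕ) (hd : 0 < d) (r : ℕ) :
    Summable fun k : ℕ => ‖c * p ^ (d * k + r)‖ := by
  have h1 : ‖p‖ ^ d < 1 := pow_lt_one₀ (norm_nonneg _) hp hd.ne'
  have := (summable_geometric_of_lt_one (by positivity) h1).mul_left (‖c‖ * ‖p‖ ^ r)
  refine this.congr fun k => ?_
  rw [norm_mul, norm_pow, pow_add, pow_mul]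
  ring

lemma tendsto_prod_one_add {p : ℂ} (hp : ‖p‖ < 1) (c : ℂ) (d : ℕ) (hd : 0 < d) (r : ℕ) :
    Tendsto (fun N => ∏ k ∈ Finset.range N, (1 + c * p ^ (d * k + r))) atTop
      (𝓝 (∏' k : ℕ, (1 + c * p ^ (d * k + r)))) :=
  (multipliable_one_add_of_summable (summable_norm_pow_add hp c d hd r)).hasProd.tendsto_prod_nat

lemma tendsto_prod_one_add_of_eq {p : ℂ} (hp : ‖p‖ < 1) {c : ℂ} {d : ℕ} (hd : 0 < d) {r : ℕ}
    {f : ℕ → ℂ} (hf : ∀ k, f k = 1 + c * p ^ (d * k + r)) :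
    Tendsto (fun N => ∏ k ∈ Finset.range N, f k) atTop (𝓝 (∏' k : ℕ, f k)) := by
  obtain rfl : f = fun k => 1 + c * p ^ (d * k + r) := funext hf
  exact tendsto_prod_one_add hp c d hd r

lemma tendsto_qFactorial {p : ℂ} (hp : ‖p‖ < 1) :
    Tendsto (qFactorial p) atTop (𝓝 (eulerProd p)) :=
  tendsto_prod_one_add_of_eq hp (c := -1) (d := 1) (r := 1) one_pos fun k => by ring_nf

lemma eulerProd_ne_zero {p : ℂ} (hp : ‖p‖ < 1) : eulerProd p ≠ 0 := by
  have := tprod_one_add_ne_zero_of_summable (f := fun k : ℕ => -p ^ (k + 1))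
    (fun k => by simpa [sub_eq_add_neg] using one_sub_pow_succ_ne_zero hp k)
    (by simpa [add_comm] using summable_norm_pow_add hp (-1) 1 one_pos 1)
  simpa [eulerProd, sub_eq_add_neg] using this

lemma exists_norm_gaussBinom_le {p : ℂ} (hp : ‖p‖ < 1) :
    ∃ K : ℝ, ∀ M j, ‖gaussBinom p M j‖ ≤ K := by
  obtain ⟨A, hA⟩ := (tendsto_qFactorial hp).norm.bddAbove_range
  obtain ⟨B, hB⟩ := ((tendsto_qFactorial hp).inv₀ (eulerProd_ne_zero hp)).norm.bddAbove_range
  have hA' : ∀ n, ‖qFactorial p n‖ ≤ A := fun n => hA ⟨n, rfl⟩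
  have hB' : ∀ n, ‖(qFactorial p n)⁻¹‖ ≤ B := fun n => hB ⟨n, rfl⟩
  refine ⟨A * (B * B), fun M j => ?_⟩
  rw [gaussBinom, div_eq_mul_inv, mul_inv, norm_mul, norm_mul]
  have := (norm_nonneg _).trans (hA' 0)
  have := (norm_nonneg _).trans (hB' 0)
  gcongr <;> first | exact hA' _ | exact hB' _

lemma tendsto_gaussBinom {p : ℂ} (hp : ‖p‖ < 1) {f : ℕ → ℕ} (hf : Tendsto f atTop atTop)
    (hf' : Tendsto (fun N => 2 * N - f N) atTop atTop) :
    Tendsto (fun N => gaussBinom p (2 * N) (f N)) atTop (𝓝 (eulerProd p)⁻¹) := by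
  have h := tendsto_qFactorial hp
  have h0 := eulerProd_ne_zero hp
  have h2 : Tendsto (fun N : ℕ => 2 * N) atTop atTop := tendsto_id.const_mul_atTop' two_pos
  have := (h.comp h2).div ((h.comp hf).mul (h.comp hf')) (mul_ne_zero h0 h0)
  rwa [show eulerProd p / (eulerProd p * eulerProd p) = (eulerProd p)⁻¹ by field_simp] at this

lemma summable_pow_triangular {p : ℂ} (hp : ‖p‖ < 1) (hp0 : p ≠ 0) {x : ℂ} (hx : x ≠ 0) :
    Summable fun i : ℕ => ‖p ^ (i * (i + 1) / 2) * x ^ i‖ := by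
  refine summable_of_ratio_test_tendsto_lt_one (l := 0) one_pos (Eventually.of_forall fun i => ?_) ?_
  · simp [hp0, hx]
  · have h := ((tendsto_pow_atTop_nhds_zero_of_lt_one (norm_nonneg _) hp).comp
      (tendsto_add_atTop_nat 1)).mul_const ‖x‖
    rw [zero_mul] at h
    refine h.congr fun i => ?_
    have e : (i + 1) * (i + 1 + 1) / 2 = i * (i + 1) / 2 + (i + 1) := by
      have := succ_mul_self_div_two (i + 1)
      simpa [mul_comm] using this
    have h1 : ‖p‖ ^ (i * (i + 1) / 2) ≠ 0 := pow_ne_zero _ (norm_ne_zero_iff.mpr hp0)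
    have h2 : ‖x‖ ^ i ≠ 0 := pow_ne_zero _ (norm_ne_zero_iff.mpr hx)
    simp only [norm_norm, norm_mul, norm_pow, e, Function.comp_apply]
    rw [pow_add _ (i * (i + 1) / 2), pow_succ ‖x‖ i]
    field_simp

/-- The Jacobi triple product identity. -/
theorem jacobi_triple_product {p z : ℂ} (hp : ‖p‖ < 1) (hp0 : p ≠ 0) (hz : z ≠ 0) :
    ∑' i : ℕ, p ^ (i * (i + 1) / 2) * (z ^ i + z⁻¹ ^ (i + 1)) =
      eulerProd p * ((∏' k : ℕ, (1 + z * p ^ (k + 1))) * ∏' k : ℕ, (1 + z⁻¹ * p ^ k)) := by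
  obtain ⟨K, hK⟩ := exists_norm_gaussBinom_le hp
  have hK0 : 0 ≤ K := (norm_nonneg _).trans (hK 0 0)
  have s1 := summable_pow_triangular hp hp0 hz
  have s2 : Summable fun i : ℕ => ‖p ^ (i * (i + 1) / 2) * z⁻¹ ^ (i + 1)‖ := by
    refine ((summable_pow_triangular hp hp0 (inv_ne_zero hz)).mul_right ‖z⁻¹‖).congr fun i => ?_
    rw [pow_succ, ← mul_assoc, norm_mul _ z⁻¹]
  have key : ∀ (g : ℕ → ℂ) (b : ℕ → ℕ → ℂ) (n : ℕ → ℕ), Summable (fun i => ‖g i‖) →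
      (∀ N i, ‖b N i‖ ≤ K) → (∀ i, Tendsto (fun N => b N i) atTop (𝓝 (eulerProd p)⁻¹)) →
      Tendsto n atTop atTop →
      Tendsto (fun N => ∑ i ∈ Finset.range (n N), b N i * g i) atTop
        (𝓝 ((eulerProd p)⁻¹ * ∑' i, g i)) := by
    intro g b n hg hb hlim hn
    have := tendsto_tsum_of_dominated_convergence (𝓕 := atTop)
      (f := fun N i => if i ∈ Finset.range (n N) then b N i * g i else 0)
      (g := fun i => (eulerProd p)⁻¹ * g i) (bound := fun i => K * ‖g i‖)
      (hg.mul_left K) ?_ ?_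
    · rw [tsum_mul_left] at this
      refine this.congr fun N => ?_
      rw [tsum_eq_sum (s := Finset.range (n N)) (fun i hi => if_neg hi)]
      exact Finset.sum_congr rfl fun i hi => if_pos hi
    · intro i
      refine ((hlim i).mul_const (g i)).congr' ?_
      filter_upwards [hn.eventually_gt_atTop i] with N hN
      rw [if_pos (Finset.mem_range.mpr hN)]
    · refine Eventually.of_forall fun N i => ?_
      split_ifs
      · rw [norm_mul]; gcongr; exact hb N i
      · simpa using by positivity
  have l1 := key (fun i => p ^ (i * (i + 1) / 2) * z ^ i) (fun N i => gaussBinom p (2 * N) (N - i))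
    (fun N => N + 1) s1 (fun N i => hK _ _) (fun i => tendsto_gaussBinom hp
      (tendsto_sub_atTop_nat i)
      (tendsto_atTop_mono (fun N => by omega : ∀ N, N ≤ 2 * N - (N - i)) tendsto_id))
    (tendsto_add_atTop_nat 1)
  have l2 := key (fun i => p ^ (i * (i + 1) / 2) * z⁻¹ ^ (i + 1))
    (fun N i => gaussBinom p (2 * N) (N + 1 + i))
    (fun N => N) s2 (fun N i => hK _ _) (fun i => tendsto_gaussBinom hp
      (tendsto_atTop_mono (fun N => by omega : ∀ N, N ≤ N + 1 + i) tendsto_id)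
      (tendsto_atTop_mono (fun N => by omega : ∀ N, N - (1 + i) ≤ 2 * N - (N + 1 + i))
        (tendsto_sub_atTop_nat (1 + i))))
    tendsto_id
  have r1 := tendsto_prod_one_add_of_eq hp (c := z) (d := 1) (r := 1) one_pos
    (f := fun k => 1 + z * p ^ (k + 1)) fun k => by ring_nf
  have r2 := tendsto_prod_one_add_of_eq hp (c := z⁻¹) (d := 1) (r := 0) one_pos
    (f := fun k => 1 + z⁻¹ * p ^ k) fun k => by ring_nf
  have := tendsto_nhds_unique ((r1.mul r2).congr fun N => finite_triple_product hp hp0 hz N)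
    (l1.add l2)
  rw [this, ← mul_add, mul_inv_cancel_left₀ (eulerProd_ne_zero hp),
    ← s1.of_norm.tsum_add s2.of_norm]
  exact tsum_congr fun i => by ring

end TripleProduct

section EtaQuotients

open Filter Topology

/-- Ramanujan's `ψ(p) = ∑_{k ≥ 0} p ^ (k (k + 1) / 2)`. -/
noncomputable def psiSeries (p : ℂ) : ℂ := ∑' k : ℕ, p ^ (k * (k + 1) / 2)

/-- The theta series `∑_{j ∈ ℤ} p ^ (j (3 j + 1) / 2)`, with the terms of `j = i` and `j = -(i + 1)`
grouped together. -/
noncomputable def pentagonalSeries (p : ℂ) : ℂ :=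
  ∑' i : ℕ, (p ^ (i * (3 * i + 1) / 2) + p ^ ((i + 1) * (3 * i + 2) / 2))

lemma norm_pow_lt_one {p : ℂ} (hp : ‖p‖ < 1) {d : ℕ} (hd : d ≠ 0) : ‖p ^ d‖ < 1 := by
  rw [norm_pow]; exact pow_lt_one₀ (norm_nonneg _) hp hd

lemma tendsto_eulerProdPlus {p : ℂ} (hp : ‖p‖ < 1) :
    Tendsto (fun N => ∏ k ∈ Finset.range N, (1 + p ^ (k + 1))) atTop (𝓝 (eulerProdPlus p)) :=
  tendsto_prod_one_add_of_eq hp (c := 1) (d := 1) (r := 1) one_pos fun k => by ring_nf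

lemma eulerProd_mul_eulerProdPlus {p : ℂ} (hp : ‖p‖ < 1) :
    eulerProd p * eulerProdPlus p = eulerProd (p ^ 2) := by
  refine tendsto_nhds_unique ((tendsto_qFactorial hp).mul (tendsto_eulerProdPlus hp))
    ((tendsto_qFactorial (norm_pow_lt_one hp two_ne_zero)).congr fun N => ?_)
  rw [qFactorial, qFactorial, ← Finset.prod_mul_distrib]
  exact Finset.prod_congr rfl fun k _ => by ring

theorem psiSeries_mul_eulerProd {p : ℂ} (hp : ‖p‖ < 1) (hp0 : p ≠ 0) :
    psiSeries p * eulerProd p = eulerProd (p ^ 2) ^ 2 := by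
  have h := jacobi_triple_product hp hp0 one_ne_zero
  have h1 : ∏' k : ℕ, (1 + (1 : ℂ)⁻¹ * p ^ k) = 2 * eulerProdPlus p := by
    refine tendsto_nhds_unique ((tendsto_add_atTop_iff_nat 1).mpr (tendsto_prod_one_add_of_eq hp
      (c := 1) (d := 1) (r := 0) one_pos fun k => by simp))
      (((tendsto_eulerProdPlus hp).const_mul 2).congr fun N => ?_)
    rw [Finset.prod_range_succ' _ N, mul_comm]
    norm_num
  rw [h1] at h
  have h2 : ∑' i : ℕ, p ^ (i * (i + 1) / 2) * ((1 : ℂ) ^ i + 1⁻¹ ^ (i + 1)) = 2 * psiSeries p := by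
    rw [psiSeries, ← tsum_mul_left]
    exact tsum_congr fun i => by norm_num; ring
  rw [h2] at h
  simp only [one_mul] at h
  change _ = _ * (eulerProdPlus p * _) at h
  rw [← eulerProd_mul_eulerProdPlus hp]
  linear_combination eulerProd p / 2 * h

theorem pentagonalSeries_mul_eulerProd {p : ℂ} (hp : ‖p‖ < 1) (hp0 : p ≠ 0) :
    pentagonalSeries p * (eulerProd p * eulerProd (p ^ 6)) =
      eulerProd (p ^ 2) * eulerProd (p ^ 3) ^ 2 := by
  have hp3 := norm_pow_lt_one hp three_ne_zero
  have h := jacobi_triple_product hp3 (pow_ne_zero 3 hp0) (inv_ne_zero hp0)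
  have h1 : ∑' i : ℕ, (p ^ 3) ^ (i * (i + 1) / 2) * (p⁻¹ ^ i + p⁻¹⁻¹ ^ (i + 1)) =
      pentagonalSeries p := by
    refine tsum_congr fun i => ?_
    have a1 : 2 ∣ i * (i + 1) := (Nat.even_mul_succ_self _).two_dvd
    have e1 : 3 * (i * (i + 1) / 2) = i * (3 * i + 1) / 2 + i := by
      have : i * (3 * i + 1) + 2 * i = 3 * (i * (i + 1)) := by ring
      omega
    have e2 : (i + 1) * (3 * i + 2) / 2 = i * (3 * i + 1) / 2 + i + (i + 1) := by
      have : (i + 1) * (3 * i + 2) = i * (3 * i + 1) + 2 * i + 2 * (i + 1) := by ring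
      omega
    rw [← pow_mul, e1, e2, inv_inv, pow_add _ _ (i + 1), pow_add, inv_pow]
    have := pow_ne_zero i hp0
    field_simp
  have h2 : (∏' k : ℕ, (1 + p⁻¹ * (p ^ 3) ^ (k + 1))) * (∏' k : ℕ, (1 + p⁻¹⁻¹ * (p ^ 3) ^ k)) *
      eulerProdPlus (p ^ 3) = eulerProdPlus p := by
    refine tendsto_nhds_unique (((tendsto_prod_one_add_of_eq hp (c := 1) (d := 3) (r := 2)
      three_pos fun k => ?_).mul (tendsto_prod_one_add_of_eq hp (c := 1) (d := 3) (r := 1)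
      three_pos fun k => ?_)).mul (tendsto_eulerProdPlus hp3))
      (((tendsto_eulerProdPlus hp).comp (tendsto_id.const_mul_atTop' three_pos)).congr fun N => ?_)
    · rw [← pow_mul, show 3 * (k + 1) = 3 * k + 2 + 1 by ring, pow_succ]
      field_simp
    · rw [← pow_mul, pow_succ, inv_inv]
      ring
    · simp only [Function.comp_apply, id]
      induction N with
      | zero => simp
      | succ N ih =>
        rw [show 3 * (N + 1) = 3 * N + 1 + 1 + 1 by ring, Finset.prod_range_succ,
          Finset.prod_range_succ, Finset.prod_range_succ, ih]
        simp only [Finset.prod_range_succ]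
        have : p⁻¹ * (p ^ 3) ^ (N + 1) = p ^ (3 * N + 1 + 1) := by
          rw [← pow_mul, show 3 * (N + 1) = 3 * N + 1 + 1 + 1 by ring, pow_succ]
          field_simp
        rw [this, inv_inv]
        ring
  have h3 := eulerProd_mul_eulerProdPlus hp
  have h4 := eulerProd_mul_eulerProdPlus hp3
  rw [← pow_mul] at h4
  rw [h1] at h
  rw [h, ← h3, ← h2, show 6 = 3 * 2 by rfl, ← h4]
  ring

lemma summable_psiSeries {p : ℂ} (hp : ‖p‖ < 1) (hp0 : p ≠ 0) :
    Summable fun k : ℕ => p ^ (k * (k + 1) / 2) := by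
  simpa using (summable_pow_triangular hp hp0 one_ne_zero).of_norm

theorem psiSeries_dissection {p : ℂ} (hp : ‖p‖ < 1) (hp0 : p ≠ 0) :
    psiSeries p = pentagonalSeries (p ^ 3) + p * psiSeries (p ^ 9) := by
  have hs := summable_psiSeries hp hp0
  have hi (j : ℕ) : Summable fun i : ℕ => p ^ ((3 * i + j) * (3 * i + j + 1) / 2) :=
    hs.comp_injective (i := fun i => 3 * i + j) fun a b h => by simpa using h
  have h1 (i : ℕ) : p ^ ((3 * i + 1) * (3 * i + 1 + 1) / 2) = p * (p ^ 9) ^ (i * (i + 1) / 2) := by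
    rw [← pow_mul, ← pow_succ']
    congr 1
    have a1 : 2 ∣ i * (i + 1) := (Nat.even_mul_succ_self _).two_dvd
    have : (3 * i + 1) * (3 * i + 1 + 1) = 9 * (i * (i + 1)) + 2 := by ring
    omega
  have h0 (i : ℕ) : p ^ ((3 * i + 0) * (3 * i + 0 + 1) / 2) = (p ^ 3) ^ (i * (3 * i + 1) / 2) := by
    rw [← pow_mul]
    congr 1
    have a1 : 2 ∣ i * (3 * i + 1) := by
      rw [show i * (3 * i + 1) = i * (i + 1) + 2 * (i * i) by ring]
      exact (Nat.even_mul_succ_self _).two_dvd.add (Dvd.intro _ rfl)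
    have : (3 * i + 0) * (3 * i + 0 + 1) = 3 * (i * (3 * i + 1)) := by ring
    omega
  have h2 (i : ℕ) : p ^ ((3 * i + 2) * (3 * i + 2 + 1) / 2) =
      (p ^ 3) ^ ((i + 1) * (3 * i + 2) / 2) := by
    rw [← pow_mul]
    congr 1
    have a1 : 2 ∣ (i + 1) * (3 * i + 2) := by
      rw [show (i + 1) * (3 * i + 2) = i * (i + 1) + 2 * ((i + 1) * (i + 1)) by ring]
      exact (Nat.even_mul_succ_self _).two_dvd.add (Dvd.intro _ rfl)
    have : (3 * i + 2) * (3 * i + 2 + 1) = 3 * ((i + 1) * (3 * i + 2)) := by ring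
    omega
  have l := (((hi 0).hasSum.add (hi 2).hasSum).add (hi 1).hasSum).tendsto_sum_nat
  have r := hs.hasSum.tendsto_sum_nat.comp (tendsto_id.const_mul_atTop' three_pos)
  have := tendsto_nhds_unique r (l.congr fun N => ?_)
  · rw [psiSeries, this, psiSeries, pentagonalSeries, ← tsum_mul_left, ← (hi 0).tsum_add (hi 2)]
    simp only [h0, h1, h2]
  · simp only [Function.comp_apply, id]
    induction N with
    | zero => simp
    | succ N ih =>
      rw [show 3 * (N + 1) = 3 * N + 1 + 1 + 1 by ring]
      simp only [Finset.sum_range_succ]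
      rw [ih]
      ring_nf

theorem contFracX_eq (τ : ℂ) (hτ : 0 < τ.im) {q : ℂ}
    (hq : q = Complex.exp (2 * Real.pi * Complex.I * τ)) :
    contFracX τ * (eulerProd (q ^ 2) ^ 2 * eulerProd (q ^ 3)) =
      Complex.exp (2 * Real.pi * Complex.I * τ / 4) * (eulerProd q * eulerProd (q ^ 6) ^ 2) := by
  have hq1 : ‖q‖ < 1 := by rw [hq]; exact norm_exp_two_pi_I_lt_one ⟨τ, hτ⟩
  have hs (r : ℕ) : Tendsto (fun N => ∏ k ∈ Finset.range N, (1 - q ^ (6 * k + r))) atTop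
      (𝓝 (∏' k : ℕ, (1 - q ^ (6 * k + r)))) :=
    tendsto_prod_one_add_of_eq hq1 (c := -1) (d := 6) (r := r) (by norm_num) fun k => by ring
  have hm (r : ℕ) : Multipliable fun k : ℕ => 1 - q ^ (6 * k + r) := by
    simpa [sub_eq_add_neg] using
      multipliable_one_add_of_summable (summable_norm_pow_add hq1 (-1) 6 (by norm_num) r)
  have hne (r : ℕ) : ∏' k : ℕ, (1 - q ^ (6 * k + (r + 1))) ≠ 0 := by
    have := tprod_one_add_ne_zero_of_summable (f := fun k : ℕ => -q ^ (6 * k + (r + 1)))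
      (fun k => by
        simpa [sub_eq_add_neg, add_assoc] using one_sub_pow_succ_ne_zero hq1 (6 * k + r))
      (by simpa using summable_norm_pow_add hq1 (-1) 6 (by norm_num) (r + 1))
    simpa [sub_eq_add_neg] using this
  set Q : ℕ → ℂ := fun r => ∏' k : ℕ, (1 - q ^ (6 * k + r)) with hQ
  have h6 : Tendsto (fun N : ℕ => 6 * N) atTop atTop := tendsto_id.const_mul_atTop' (by norm_num)
  have h3 : Tendsto (fun N : ℕ => 3 * N) atTop atTop := tendsto_id.const_mul_atTop' (by norm_num)
  have h2 : Tendsto (fun N : ℕ => 2 * N) atTop atTop := tendsto_id.const_mul_atTop' (by norm_num)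
  have E1 : eulerProd q = Q 1 * Q 2 * Q 3 * Q 4 * Q 5 * Q 6 := by
    refine tendsto_nhds_unique ((tendsto_qFactorial hq1).comp h6)
      ((((((hs 1).mul (hs 2)).mul (hs 3)).mul (hs 4)).mul (hs 5)).mul (hs 6) |>.congr fun N => ?_)
    simp only [Function.comp_apply]
    induction N with
    | zero => simp [qFactorial]
    | succ N ih =>
      rw [show 6 * (N + 1) = 6 * N + 1 + 1 + 1 + 1 + 1 + 1 by ring]
      simp only [qFactorial_succ, Finset.prod_range_succ, ← ih]
      ring
  have E2 : eulerProd (q ^ 2) = Q 2 * Q 4 * Q 6 := by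
    refine tendsto_nhds_unique ((tendsto_qFactorial (norm_pow_lt_one hq1 two_ne_zero)).comp h3)
      (((hs 2).mul (hs 4)).mul (hs 6) |>.congr fun N => ?_)
    simp only [Function.comp_apply]
    induction N with
    | zero => simp [qFactorial]
    | succ N ih =>
      rw [show 3 * (N + 1) = 3 * N + 1 + 1 + 1 by ring]
      simp only [qFactorial_succ, Finset.prod_range_succ, ← ih]
      ring
  have E3 : eulerProd (q ^ 3) = Q 3 * Q 6 := by
    refine tendsto_nhds_unique ((tendsto_qFactorial (norm_pow_lt_one hq1 three_ne_zero)).comp h2)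
      ((hs 3).mul (hs 6) |>.congr fun N => ?_)
    simp only [Function.comp_apply]
    induction N with
    | zero => simp [qFactorial]
    | succ N ih =>
      rw [show 2 * (N + 1) = 2 * N + 1 + 1 by ring]
      simp only [qFactorial_succ, Finset.prod_range_succ, ← ih]
      ring
  have E6 : eulerProd (q ^ 6) = Q 6 := by
    exact tprod_congr fun k => by rw [← pow_mul, mul_add]
  have hX : contFracX τ = Complex.exp (2 * Real.pi * Complex.I * τ / 4) *
      (Q 5 * Q 1 / (Q 4 * Q 2)) := by
    rw [contFracX]
    simp only [← hq, hQ]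
    rw [← (hm 5).tprod_mul (hm 1), ← (hm 4).tprod_mul (hm 2)]
    congr 1
    have hd := (hm 4).mul (hm 2)
    have hd0 : ∏' k : ℕ, (1 - q ^ (6 * k + 4)) * (1 - q ^ (6 * k + 2)) ≠ 0 := by
      rw [(hm 4).tprod_mul (hm 2)]
      exact mul_ne_zero (hne 3) (hne 1)
    have a := ((hm 5).mul (hm 1)).hasProd.div₀ hd.hasProd hd0
    exact a.tprod_eq
  have n1 := hne 1
  have n3 := hne 3
  change Q 2 ≠ 0 at n1
  change Q 4 ≠ 0 at n3
  rw [hX, E1, E2, E3, E6]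
  field_simp

end EtaQuotients

section WEta

open Filter Topology ModularForm

/-- `e(τ) = exp (2πiτ)`. -/
noncomputable def expTwoPi (τ : ℂ) : ℂ := Complex.exp (2 * Real.pi * Complex.I * τ)

lemma expTwoPi_ne_zero (τ : ℂ) : expTwoPi τ ≠ 0 := Complex.exp_ne_zero _

lemma norm_expTwoPi (τ : ℂ) : ‖expTwoPi τ‖ = Real.exp (-2 * Real.pi * τ.im) := by
  simp [expTwoPi, Complex.norm_exp]

lemma norm_expTwoPi_lt_one {τ : ℂ} (hτ : 0 < τ.im) : ‖expTwoPi τ‖ < 1 :=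
  norm_exp_two_pi_I_lt_one ⟨τ, hτ⟩

lemma expTwoPi_natCast_mul (n : ℕ) (τ : ℂ) : expTwoPi (n * τ) = expTwoPi τ ^ n := by
  rw [expTwoPi, expTwoPi, ← Complex.exp_nat_mul]; congr 1; ring

lemma expTwoPi_ofNat_mul (n : ℕ) [n.AtLeastTwo] (τ : ℂ) :
    expTwoPi ((ofNat(n) : ℂ) * τ) = expTwoPi τ ^ (ofNat(n) : ℕ) :=
  expTwoPi_natCast_mul (OfNat.ofNat n) τ

lemma eta_eq_mul_eulerProd (τ : ℂ) : eta τ = Function.Periodic.qParam 24 τ * eulerProd (expTwoPi τ) := by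
  simp [eta, eulerProd, expTwoPi, eta_q, Function.Periodic.qParam]

lemma w_mul_eulerProd {τ : ℂ} (hτ : 0 < τ.im) {q : ℂ} (hq : q = expTwoPi τ) :
    w τ * (eulerProd (q ^ 2) ^ 2 * eulerProd (q ^ 9)) =
      q * (eulerProd q * eulerProd (q ^ 18) ^ 2) := by
  have hq1 : ‖q‖ < 1 := hq ▸ norm_expTwoPi_lt_one hτ
  have h1 := contFracX_eq τ hτ (q := q) hq
  have h3 := contFracX_eq (3 * τ) (by simpa using hτ) (q := q ^ 3)
    (by rw [hq, ← expTwoPi_ofNat_mul]; rfl)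
  have e : Complex.exp (2 * Real.pi * Complex.I * τ / 4) *
      Complex.exp (2 * Real.pi * Complex.I * (3 * τ) / 4) = q := by
    rw [← Complex.exp_add, hq, expTwoPi]; congr 1; ring
  simp only [← pow_mul] at h3
  norm_num at h3
  have n3 := eulerProd_ne_zero (norm_pow_lt_one hq1 three_ne_zero)
  have n6 := eulerProd_ne_zero (norm_pow_lt_one hq1 (d := 6) (by norm_num))
  rw [w]
  have key : (eulerProd (q ^ 3) * eulerProd (q ^ 6) ^ 2) *
      (contFracX τ * contFracX (3 * τ) * (eulerProd (q ^ 2) ^ 2 * eulerProd (q ^ 9))) =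
      (eulerProd (q ^ 3) * eulerProd (q ^ 6) ^ 2) * (q * (eulerProd q * eulerProd (q ^ 18) ^ 2)) := by
    calc _ = (contFracX τ * (eulerProd (q ^ 2) ^ 2 * eulerProd (q ^ 3))) *
          (contFracX (3 * τ) * (eulerProd (q ^ 6) ^ 2 * eulerProd (q ^ 9))) := by ring
      _ = _ := by rw [h1, h3]; linear_combination (eulerProd q * eulerProd (q ^ 6) ^ 2 *
          eulerProd (q ^ 3) * eulerProd (q ^ 18) ^ 2) * e
  exact mul_left_cancel₀ (mul_ne_zero n3 (pow_ne_zero 2 n6)) key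

lemma psiSeries_ne_zero {p : ℂ} (hp : ‖p‖ < 1) (hp0 : p ≠ 0) : psiSeries p ≠ 0 := by
  intro h
  have := psiSeries_mul_eulerProd hp hp0
  rw [h, zero_mul] at this
  exact pow_ne_zero 2 (eulerProd_ne_zero (norm_pow_lt_one hp two_ne_zero)) this.symm

theorem w_mul_psiSeries {τ : ℂ} (hτ : 0 < τ.im) :
    w τ * psiSeries (expTwoPi τ) = expTwoPi τ * psiSeries (expTwoPi τ ^ 9) := by
  set q := expTwoPi τ with hq
  have hq1 : ‖q‖ < 1 := hq ▸ norm_expTwoPi_lt_one hτ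
  have hq0 : q ≠ 0 := expTwoPi_ne_zero τ
  have h := w_mul_eulerProd hτ hq
  have h1 := psiSeries_mul_eulerProd hq1 hq0
  have h9 := psiSeries_mul_eulerProd (norm_pow_lt_one hq1 (d := 9) (by norm_num)) (pow_ne_zero 9 hq0)
  simp only [← pow_mul] at h9
  norm_num at h9
  have n1 := eulerProd_ne_zero hq1
  have n9 := eulerProd_ne_zero (norm_pow_lt_one hq1 (d := 9) (by norm_num))
  rw [← h1, ← h9] at h
  refine mul_left_cancel₀ (mul_ne_zero n1 n9) ?_
  linear_combination h

lemma w_ne_zero {τ : ℂ} (hτ : 0 < τ.im) : w τ ≠ 0 := by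
  intro h
  have := w_mul_psiSeries hτ
  rw [h, zero_mul] at this
  exact mul_ne_zero (expTwoPi_ne_zero τ) (psiSeries_ne_zero
    (norm_pow_lt_one (norm_expTwoPi_lt_one hτ) (by norm_num))
    (pow_ne_zero _ (expTwoPi_ne_zero τ))) this.symm

lemma qParam_24_mul_pow (a b : ℕ) (τ : ℂ) : Function.Periodic.qParam 24 (a * τ) ^ b =
    Function.Periodic.qParam 24 τ ^ (a * b) := by
  simp only [Function.Periodic.qParam, ← Complex.exp_nat_mul]
  congr 1
  push_cast
  ring

lemma expTwoPi_eq_qParam_pow (τ : ℂ) : expTwoPi τ = Function.Periodic.qParam 24 τ ^ 24 := by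
  simp only [Function.Periodic.qParam, ← Complex.exp_nat_mul, expTwoPi]
  congr 1
  push_cast
  ring

theorem w_mul_eta {τ : ℂ} (hτ : 0 < τ.im) :
    w τ * (eta (2 * τ) ^ 2 * eta (9 * τ)) = eta τ * eta (18 * τ) ^ 2 := by
  have h := w_mul_eulerProd hτ rfl
  simp only [eta_eq_mul_eulerProd, expTwoPi_ofNat_mul, mul_pow]
  have h2 := qParam_24_mul_pow 2 2 τ
  have h9 := qParam_24_mul_pow 9 1 τ
  have h18 := qParam_24_mul_pow 18 2 τ
  push_cast at h2 h9 h18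
  rw [pow_one] at h9
  rw [h2, h9, h18]
  have e := expTwoPi_eq_qParam_pow τ
  set Q := Function.Periodic.qParam 24 τ
  linear_combination Q ^ 13 * h + Q ^ 13 * eulerProd (expTwoPi τ) * eulerProd (expTwoPi τ ^ 18) ^ 2 * e

theorem one_sub_w_mul_eta {τ : ℂ} (hτ : 0 < τ.im) :
    (1 - w τ) * (eta (3 * τ) * eta (18 * τ) ^ 3) = w τ * (eta (6 * τ) * eta (9 * τ) ^ 3) := by
  have hq1 := norm_expTwoPi_lt_one hτ
  have hq0 := expTwoPi_ne_zero τ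
  simp only [eta_eq_mul_eulerProd, expTwoPi_ofNat_mul, mul_pow]
  have h3 := qParam_24_mul_pow 3 1 τ
  have h6 := qParam_24_mul_pow 6 1 τ
  have h9 := qParam_24_mul_pow 9 3 τ
  have h18 := qParam_24_mul_pow 18 3 τ
  push_cast at h3 h6 h9 h18
  rw [pow_one] at h3 h6
  rw [h3, h6, h9, h18]
  have e := expTwoPi_eq_qParam_pow τ
  have hw := w_mul_psiSeries hτ
  have hd := psiSeries_dissection hq1 hq0
  have hp := pentagonalSeries_mul_eulerProd (norm_pow_lt_one hq1 three_ne_zero) (pow_ne_zero 3 hq0)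
  have h9' := psiSeries_mul_eulerProd (norm_pow_lt_one hq1 (d := 9) (by norm_num))
    (pow_ne_zero 9 hq0)
  simp only [← pow_mul] at hp h9'
  norm_num at hp h9'
  set q := expTwoPi τ
  set Q := Function.Periodic.qParam 24 τ
  have hw' : (1 - w τ) * psiSeries q = pentagonalSeries (q ^ 3) := by
    linear_combination hd - hw
  have hmain : (1 - w τ) * (q * psiSeries (q ^ 9)) = w τ * pentagonalSeries (q ^ 3) := by
    rw [← hw', ← hw]; ring
  have key : (1 - w τ) * (q * eulerProd (q ^ 18) ^ 3 * eulerProd (q ^ 3)) =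
      w τ * (eulerProd (q ^ 6) * eulerProd (q ^ 9) ^ 3) := by
    linear_combination (eulerProd (q ^ 9) * eulerProd (q ^ 3) * eulerProd (q ^ 18)) * hmain -
      ((1 - w τ) * q * eulerProd (q ^ 3) * eulerProd (q ^ 18)) * h9' + (w τ * eulerProd (q ^ 9)) * hp
  linear_combination Q ^ 33 * key -
    ((1 - w τ) * Q ^ 33 * (eulerProd (q ^ 18) ^ 3 * eulerProd (q ^ 3))) * e

end WEta

section WModular

open Filter Topology ModularForm

lemma coe_SL_smul (γ : SL(2, ℤ)) (τ : ℍ) :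
    ((γ • τ : ℍ) : ℂ) = (γ 0 0 * τ + γ 0 1) / (γ 1 0 * τ + γ 1 1) := by
  rw [coe_specialLinearGroup_apply]
  simp

lemma SL_denom_ne_zero (γ : SL(2, ℤ)) (τ : ℍ) : (γ 1 0 * τ + γ 1 1 : ℂ) ≠ 0 := by
  have := denom_ne_zero (γ : GL (Fin 2) ℝ) τ
  simpa [denom] using this

lemma SL_det_eq (γ : SL(2, ℤ)) : γ 0 0 * γ 1 1 - γ 0 1 * γ 1 0 = 1 := by
  have := γ.det_coe
  rwa [Matrix.det_fin_two] at this

lemma eta_pow_24_smul (γ : SL(2, ℤ)) (τ : ℍ) :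
    eta (γ • τ : ℍ) ^ 24 = (γ 1 0 * τ + γ 1 1 : ℂ) ^ 12 * eta τ ^ 24 := by
  have h := congrFun (SlashInvariantForm.slash_action_generators_SL2Z discriminant_S_invariant
    discriminant_T_invariant γ) τ
  rw [SL_slash_apply] at h
  have hd := SL_denom_ne_zero γ τ
  have e : denom γ τ = (γ 1 0 * τ + γ 1 1 : ℂ) := by simp [denom]
  rw [e, zpow_neg, ← div_eq_mul_inv, div_eq_iff (zpow_ne_zero _ hd)] at h
  simp only [discriminant] at h
  rw [h, mul_comm]
  norm_cast

/-- The point `(e τ + f) / g` of the upper half-plane. -/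
noncomputable def affinePt (e g : ℕ) (f : ℤ) (he : 0 < e) (hg : 0 < g) (τ : ℍ) : ℍ :=
  ⟨(e * τ + f) / g, by
    have := τ.im_pos
    have he' : (0 : ℝ) < e := by exact_mod_cast he
    have hg' : (0 : ℝ) < g := by exact_mod_cast hg
    rw [Complex.div_natCast_im]
    simp only [Complex.add_im, Complex.mul_im, Complex.natCast_re, Complex.natCast_im,
      Complex.intCast_im, zero_mul, add_zero, coe_im]
    positivity⟩

lemma coe_affinePt {e g : ℕ} {f : ℤ} (he : 0 < e) (hg : 0 < g) (τ : ℍ) :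
    (affinePt e g f he hg τ : ℂ) = (e * τ + f) / g := rfl

lemma im_affinePt {e g : ℕ} {f : ℤ} (he : 0 < e) (hg : 0 < g) (τ : ℍ) :
    (affinePt e g f he hg τ).im = (e / g : ℝ) * τ.im := by
  rw [← coe_im, coe_affinePt, Complex.div_natCast_im]
  simp only [Complex.add_im, Complex.mul_im, Complex.natCast_re, Complex.natCast_im,
      Complex.intCast_im, zero_mul, add_zero, coe_im]
  ring

/-- The matrix identity `diag(k, 1) γ = γ' (e, f; 0, g)`. -/
structure IsHermiteFactor (k : ℕ) (γ γ' : SL(2, ℤ)) (e g : ℕ) (f : ℤ) : Prop where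
  e_pos : 0 < e
  g_pos : 0 < g
  mul_eq : e * g = k
  h00 : k * γ 0 0 = γ' 0 0 * e
  h01 : k * γ 0 1 = γ' 0 0 * f + γ' 0 1 * g
  h10 : γ 1 0 = γ' 1 0 * e
  h11 : γ 1 1 = γ' 1 0 * f + γ' 1 1 * g

lemma IsHermiteFactor.smul_eq {k : ℕ} {γ γ' : SL(2, ℤ)} {e g : ℕ} {f : ℤ}
    (H : IsHermiteFactor k γ γ' e g f) (τ : ℍ) :
    (k * ((γ • τ : ℍ) : ℂ)) = ((γ' • affinePt e g f H.e_pos H.g_pos τ : ℍ) : ℂ) := by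
  have hg : (g : ℂ) ≠ 0 := by exact_mod_cast H.g_pos.ne'
  have h1 := SL_denom_ne_zero γ τ
  have h2 := SL_denom_ne_zero γ' (affinePt e g f H.e_pos H.g_pos τ)
  rw [coe_SL_smul, coe_SL_smul]
  rw [coe_affinePt] at h2 ⊢
  rw [← mul_div_assoc, div_eq_div_iff h1 h2]
  have a00 : (k : ℂ) * γ 0 0 = γ' 0 0 * e := by exact_mod_cast H.h00
  have a01 : (k : ℂ) * γ 0 1 = γ' 0 0 * f + γ' 0 1 * g := by exact_mod_cast H.h01
  have a10 : (γ 1 0 : ℂ) = γ' 1 0 * e := by exact_mod_cast H.h10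
  have a11 : (γ 1 1 : ℂ) = γ' 1 0 * f + γ' 1 1 * g := by exact_mod_cast H.h11
  have a : (k : ℂ) * (γ 0 0 * τ + γ 0 1) = γ' 0 0 * (e * τ + f) + γ' 0 1 * g := by
    linear_combination (τ : ℂ) * a00 + a01
  rw [a, a10, a11]
  field_simp
  ring

lemma IsHermiteFactor.eta_eq {k : ℕ} {γ γ' : SL(2, ℤ)} {e g : ℕ} {f : ℤ}
    (H : IsHermiteFactor k γ γ' e g f) (τ : ℍ) :
    eta (k * ((γ • τ : ℍ) : ℂ)) ^ 24 =
      ((γ 1 0 * τ + γ 1 1 : ℂ) / g) ^ 12 * eta (affinePt e g f H.e_pos H.g_pos τ) ^ 24 := by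
  have hg : (g : ℂ) ≠ 0 := by exact_mod_cast H.g_pos.ne'
  rw [H.smul_eq, eta_pow_24_smul]
  congr 2
  rw [coe_affinePt]
  have a10 : (γ 1 0 : ℂ) = γ' 1 0 * e := by exact_mod_cast H.h10
  have a11 : (γ 1 1 : ℂ) = γ' 1 0 * f + γ' 1 1 * g := by exact_mod_cast H.h11
  rw [a10, a11]
  field_simp
  ring

lemma exists_isHermiteFactor {k : ℕ} (hk : 0 < k) (γ : SL(2, ℤ)) :
    ∃ (γ' : SL(2, ℤ)) (g : ℕ) (f : ℤ), IsHermiteFactor k γ γ' (Int.gcd (γ 1 0) k) g f := by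
  have hk' : (k : ℤ) ≠ 0 := by exact_mod_cast hk.ne'
  set e := Int.gcd (γ 1 0) k with he
  have he0 : 0 < e := Int.gcd_pos_of_ne_zero_right _ hk'
  have he' : (e : ℤ) ≠ 0 := by exact_mod_cast he0.ne'
  obtain ⟨c, hc⟩ : (e : ℤ) ∣ γ 1 0 := Int.gcd_dvd_left ..
  obtain ⟨g, hg⟩ : (e : ℤ) ∣ k := Int.gcd_dvd_right ..
  have hdet := SL_det_eq γ
  have hg0 : 0 < g := by
    have : (0 : ℤ) < e * g := by rw [← hg]; exact_mod_cast hk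
    exact pos_of_mul_pos_right this (by positivity)
  lift g to ℕ using hg0.le
  have hcg : IsCoprime c (g : ℤ) := by
    have h := Int.gcd_eq_gcd_ab (γ 1 0) k
    rw [← he] at h
    refine ⟨Int.gcdA (γ 1 0) k, Int.gcdB (γ 1 0) k, mul_left_cancel₀ he' ?_⟩
    rw [hc, hg] at h
    rw [hc, hg]
    linear_combination -h
  have hca : IsCoprime c (γ 0 0) := ⟨-e * γ 0 1, γ 1 1, by rw [hc] at hdet; linear_combination hdet⟩
  obtain ⟨x, y, hxy⟩ := hcg.mul_right hca
  refine ⟨⟨!![g * γ 0 0, -x; c, y], by rw [Matrix.det_fin_two_of]; linear_combination hxy⟩, g,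
    k * y * γ 0 1 + x * γ 1 1, he0, by exact_mod_cast hg0, by exact_mod_cast hg.symm, ?_, ?_, ?_, ?_⟩
  · simp; rw [hg]; ring
  · simp only [Matrix.of_apply, Matrix.cons_val', Matrix.cons_val_zero, Matrix.cons_val_one,
      Matrix.cons_val_fin_one]
    rw [hc] at hdet
    rw [hg]
    linear_combination (-(g : ℤ) * x) * hdet - (e * g * γ 0 1) * hxy
  · simp; rw [hc]; ring
  · simp only [Matrix.of_apply, Matrix.cons_val', Matrix.cons_val_zero, Matrix.cons_val_one,
      Matrix.cons_val_fin_one]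
    rw [hc] at hdet
    rw [hg]
    linear_combination ((g : ℤ) * y) * hdet - γ 1 1 * hxy

lemma differentiableOn_w : DifferentiableOn ℂ w {z : ℂ | 0 < z.im} := by
  have hd (k : ℕ) (hk : 0 < k) :
      DifferentiableOn ℂ (fun z => eta (k * z)) {z : ℂ | 0 < z.im} := by
    intro z hz
    have : 0 < ((k : ℂ) * z).im := by
      have : (0 : ℝ) < k := by exact_mod_cast hk
      simpa using mul_pos this hz
    exact ((differentiableAt_eta_of_mem_upperHalfPlaneSet this).comp z
      (by fun_prop)).differentiableWithinAt
  have hn (k : ℕ) (hk : 0 < k) {z : ℂ} (hz : 0 < z.im) : eta (k * z) ≠ 0 := by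
    have : 0 < ((k : ℂ) * z).im := by
      have : (0 : ℝ) < k := by exact_mod_cast hk
      simpa using mul_pos this hz
    exact eta_ne_zero this
  have h := ((hd 1 one_pos).mul ((hd 18 (by norm_num)).pow 2)).div
    (((hd 2 two_pos).pow 2).mul (hd 9 (by norm_num)))
    (fun z hz => mul_ne_zero (pow_ne_zero 2 (hn 2 two_pos hz)) (hn 9 (by norm_num) hz))
  refine h.congr fun z hz => ?_
  have n := mul_ne_zero (pow_ne_zero 2 (hn 2 two_pos hz)) (hn 9 (by norm_num) hz)
  simp only [Pi.mul_apply, Pi.div_apply, Pi.pow_apply]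
  rw [eq_div_iff n]
  simpa using w_mul_eta hz

end WModular

section WInvariance

open Filter Topology ModularForm CongruenceSubgroup

lemma continuous_w : Continuous fun τ : ℍ => w τ :=
  continuous_iff_continuousAt.mpr fun τ =>
    ((differentiableOn_w.continuousOn.continuousAt
      ((isOpen_lt continuous_const Complex.continuous_im).mem_nhds τ.im_pos)).comp
      continuous_coe.continuousAt : ContinuousAt (w ∘ UpperHalfPlane.coe) τ)

lemma natCast_mul_im_pos {k : ℕ} (hk : 0 < k) {z : ℂ} (hz : 0 < z.im) : 0 < ((k : ℂ) * z).im := by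
  have : (0 : ℝ) < k := by exact_mod_cast hk
  simpa using mul_pos this hz

lemma eta_natCast_mul_ne_zero {k : ℕ} (hk : 0 < k) (τ : ℍ) : eta (k * τ) ≠ 0 :=
  eta_ne_zero (natCast_mul_im_pos hk τ.im_pos)

lemma one_sub_w_ne_zero (τ : ℍ) : 1 - w τ ≠ 0 := by
  intro h
  have := one_sub_w_mul_eta τ.im_pos
  rw [h, zero_mul] at this
  refine mul_ne_zero (w_ne_zero τ.im_pos) (mul_ne_zero ?_ (pow_ne_zero 3 ?_)) this.symm
  · exact_mod_cast eta_natCast_mul_ne_zero (k := 6) (by norm_num) τ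
  · exact_mod_cast eta_natCast_mul_ne_zero (k := 9) (by norm_num) τ

lemma eta_natCast_mul_smul {k : ℕ} (hk : 0 < k) (h18 : k ∣ 18) {γ : SL(2, ℤ)}
    (hγ : γ ∈ Gamma0 18) (τ : ℍ) :
    eta (k * ((γ • τ : ℍ) : ℂ)) ^ 24 = (γ 1 0 * τ + γ 1 1 : ℂ) ^ 12 * eta (k * τ) ^ 24 := by
  have h : (18 : ℤ) ∣ γ 1 0 := by
    rw [Gamma0_mem] at hγ; exact (ZMod.intCast_zmod_eq_zero_iff_dvd _ 18).mp hγ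
  obtain ⟨c, hc⟩ : (k : ℤ) ∣ γ 1 0 := (by exact_mod_cast h18 : (k : ℤ) ∣ 18).trans h
  have hdet := SL_det_eq γ
  have H : IsHermiteFactor k γ ⟨!![γ 0 0, k * γ 0 1; c, γ 1 1], by
      rw [Matrix.det_fin_two_of]; rw [hc] at hdet; linear_combination hdet⟩ k 1 0 := by
    refine ⟨hk, one_pos, mul_one _, ?_, ?_, ?_, ?_⟩
    · simp [mul_comm]
    · simp
    · simp [hc, mul_comm]
    · simp
  rw [H.eta_eq, coe_affinePt]
  simp

lemma exists_eq_mul_of_pow_eq {F G : ℍ → ℂ} (hF : Continuous F) (hG : Continuous G)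
    (hG0 : ∀ τ, G τ ≠ 0) (h : ∀ τ, F τ ^ 24 = G τ ^ 24) : ∃ c : ℂ, ∀ τ, F τ = c * G τ := by
  have hfin : ({z : ℂ | z ^ 24 = 1} : Set ℂ).Finite := by
    refine ((Polynomial.nthRoots 24 (1 : ℂ)).toFinset.finite_toSet).subset fun z hz => ?_
    simpa [Polynomial.mem_nthRoots] using hz
  have hc : Continuous fun τ => F τ / G τ := hF.div hG hG0
  have hm : Set.MapsTo (fun τ => F τ / G τ) Set.univ {z : ℂ | z ^ 24 = 1} := fun τ _ => by
    simp only [Set.mem_ofPred_eq, div_pow, h]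
    exact div_self (pow_ne_zero _ (hG0 τ))
  have := fun τ => isPreconnected_univ.constant_of_mapsTo hfin.isDiscrete
    hc.continuousOn hm (Set.mem_univ τ) (Set.mem_univ UpperHalfPlane.I)
  exact ⟨F I / G I, fun τ => by rw [← this τ, div_mul_cancel₀ _ (hG0 τ)]⟩

lemma norm_psiSeries_sub_le (B : ℕ) {p : ℂ} (hp : ‖p‖ ≤ 1 / 2) :
    ‖psiSeries p - ∑ k ∈ Finset.range B, p ^ (k * (k + 1) / 2)‖ ≤ 2 * ‖p‖ ^ B := by
  have hp1 : ‖p‖ < 1 := hp.trans_lt (by norm_num)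
  have hle (k : ℕ) : ‖p ^ (k * (k + 1) / 2)‖ ≤ ‖p‖ ^ k := by
    rw [norm_pow]
    refine pow_le_pow_of_le_one (norm_nonneg _) hp1.le ?_
    rw [Nat.le_div_iff_mul_le two_pos]
    rcases k with _ | k
    · simp
    · gcongr; omega
  have hg := summable_geometric_of_lt_one (norm_nonneg p) hp1
  have hs : Summable fun k : ℕ => p ^ (k * (k + 1) / 2) := Summable.of_norm_bounded hg hle
  have : psiSeries p - ∑ k ∈ Finset.range B, p ^ (k * (k + 1) / 2) =
      ∑' k : ℕ, p ^ ((k + B) * (k + B + 1) / 2) := by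
    rw [psiSeries, ← hs.sum_add_tsum_nat_add B]; ring
  rw [this]
  have hg' := hg.mul_right (‖p‖ ^ B)
  refine (tsum_of_norm_bounded hg'.hasSum fun k => ?_).trans ?_
  · rw [← pow_add]; exact hle _
  · rw [tsum_mul_right, tsum_geometric_of_lt_one (norm_nonneg p) hp1]
    gcongr
    rw [inv_le_comm₀ (by linarith) two_pos]
    linarith

lemma tendsto_psiSeries : Tendsto psiSeries (𝓝 0) (𝓝 1) := by
  have h : Tendsto (fun p : ℂ => 2 * ‖p‖ ^ 1) (𝓝 0) (𝓝 0) := by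
    have : Continuous fun p : ℂ => 2 * ‖p‖ ^ 1 := by fun_prop
    simpa using this.tendsto 0
  rw [tendsto_iff_norm_sub_tendsto_zero]
  refine squeeze_zero' (Eventually.of_forall fun _ => norm_nonneg _) ?_ h
  filter_upwards [Metric.closedBall_mem_nhds (0 : ℂ) (by norm_num : (0 : ℝ) < 1 / 2)] with p hp
  simpa using norm_psiSeries_sub_le 1 (by simpa using hp)

lemma tendsto_expTwoPi_atImInfty : Tendsto (fun τ : ℍ => expTwoPi τ) atImInfty (𝓝 0) := by
  have := qParam_tendsto_atImInfty one_pos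
  simpa [Function.Periodic.qParam, expTwoPi] using this

lemma tendsto_w_div_expTwoPi :
    Tendsto (fun τ : ℍ => w τ / expTwoPi τ) atImInfty (𝓝 1) := by
  have h1 := tendsto_psiSeries.comp tendsto_expTwoPi_atImInfty
  have h9 : Tendsto (fun τ : ℍ => expTwoPi τ ^ 9) atImInfty (𝓝 0) := by
    simpa using tendsto_expTwoPi_atImInfty.pow 9
  have := (tendsto_psiSeries.comp h9).div h1 one_ne_zero
  rw [div_one] at this
  refine this.congr fun τ => ?_
  have hn := psiSeries_ne_zero (norm_expTwoPi_lt_one τ.im_pos) (expTwoPi_ne_zero τ)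
  simp only [Function.comp_apply, Pi.div_apply]
  rw [div_eq_div_iff hn (expTwoPi_ne_zero _), w_mul_psiSeries τ.im_pos, mul_comm]

lemma tendsto_w_atImInfty : Tendsto (fun τ : ℍ => w τ) atImInfty (𝓝 0) := by
  have := tendsto_w_div_expTwoPi.mul tendsto_expTwoPi_atImInfty
  rw [mul_zero] at this
  exact this.congr fun τ => div_mul_cancel₀ _ (expTwoPi_ne_zero τ)

lemma w_not_const : ∃ τ₁ τ₂ : ℍ, w τ₁ ≠ w τ₂ := by
  by_contra! h
  have : Tendsto (fun τ : ℍ => w τ) atImInfty (𝓝 (w I)) :=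
    tendsto_const_nhds.congr fun τ => h I τ
  exact w_ne_zero I.im_pos (tendsto_nhds_unique this tendsto_w_atImInfty)

/-- `w` is invariant under `Γ₀(18)`. -/
theorem w_smul {γ : SL(2, ℤ)} (hγ : γ ∈ Gamma0 18) (τ : ℍ) : w (γ • τ : ℍ) = w τ := by
  have hcont : Continuous fun τ : ℍ => (γ • τ : ℍ) :=
    continuous_const_smul (γ : GL (Fin 2) ℝ)
  have e (k : ℕ) (hk : 0 < k) (h18 : k ∣ 18) (τ : ℍ) := eta_natCast_mul_smul hk h18 hγ τ
  have n (k : ℕ) (hk : 0 < k) (τ : ℍ) := eta_natCast_mul_ne_zero hk τ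
  have nj := SL_denom_ne_zero γ
  have h1 : ∀ τ : ℍ, w (γ • τ : ℍ) ^ 24 = w τ ^ 24 := by
    intro τ
    have a := congrArg (· ^ 24) (w_mul_eta τ.im_pos)
    have b := congrArg (· ^ 24) (w_mul_eta (γ • τ).im_pos)
    have e1 := e 1 one_pos (by norm_num) τ
    have e2 := e 2 two_pos (by norm_num) τ
    have e9 := e 9 (by norm_num) (by norm_num) τ
    have e18 := e 18 (by norm_num) (by norm_num) τ
    have n2 := n 2 two_pos τ
    have n9 := n 9 (by norm_num) τ
    push_cast at e1 e2 e9 e18 n2 n9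
    simp only [one_mul] at e1
    simp only [mul_pow, ← pow_mul, mul_comm 2 24] at a b
    simp only [pow_mul _ 24 2] at a b
    rw [e1, e2, e9, e18] at b
    set j := (γ 1 0 * τ + γ 1 1 : ℂ)
    have hne : j ^ 36 * ((eta (2 * τ) ^ 24) ^ 2 * eta (9 * τ) ^ 24) ≠ 0 :=
      mul_ne_zero (pow_ne_zero _ (nj τ)) (mul_ne_zero (pow_ne_zero _ (pow_ne_zero _ n2))
        (pow_ne_zero _ n9))
    refine mul_right_cancel₀ hne ?_
    linear_combination b - j ^ 36 * a
  have h2 : ∀ τ : ℍ, ((1 - w (γ • τ : ℍ)) / w (γ • τ : ℍ)) ^ 24 = ((1 - w τ) / w τ) ^ 24 := by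
    intro τ
    have a := congrArg (· ^ 24) (one_sub_w_mul_eta τ.im_pos)
    have b := congrArg (· ^ 24) (one_sub_w_mul_eta (γ • τ).im_pos)
    have e3 := e 3 (by norm_num) (by norm_num) τ
    have e6 := e 6 (by norm_num) (by norm_num) τ
    have e9 := e 9 (by norm_num) (by norm_num) τ
    have e18 := e 18 (by norm_num) (by norm_num) τ
    have n3 := n 3 (by norm_num) τ
    have n18 := n 18 (by norm_num) τ
    push_cast at e3 e6 e9 e18 n3 n18
    simp only [mul_pow, ← pow_mul, mul_comm 3 24] at a b
    simp only [pow_mul _ 24 3] at a b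
    rw [e3, e6, e9, e18] at b
    set j := (γ 1 0 * τ + γ 1 1 : ℂ)
    have hne : j ^ 48 * (eta (3 * τ) ^ 24 * (eta (18 * τ) ^ 24) ^ 3) ≠ 0 :=
      mul_ne_zero (pow_ne_zero _ (nj τ)) (mul_ne_zero (pow_ne_zero _ n3)
        (pow_ne_zero _ (pow_ne_zero _ n18)))
    rw [div_pow, div_pow, div_eq_div_iff (pow_ne_zero _ (w_ne_zero (γ • τ).im_pos))
      (pow_ne_zero _ (w_ne_zero τ.im_pos))]
    refine mul_right_cancel₀ hne ?_
    generalize 1 - w τ = x at a ⊢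
    generalize 1 - w (γ • τ : ℍ) = y at b ⊢
    linear_combination w τ ^ 24 * b - w (γ • τ : ℍ) ^ 24 * j ^ 48 * a
  have hw0 : ∀ τ : ℍ, w τ ≠ 0 := fun τ => w_ne_zero τ.im_pos
  obtain ⟨c, hc⟩ := exists_eq_mul_of_pow_eq (continuous_w.comp hcont) continuous_w hw0 h1
  have hV : Continuous fun τ : ℍ => (1 - w τ) / w τ :=
    (continuous_const.sub continuous_w).div continuous_w hw0
  obtain ⟨d, hd⟩ := exists_eq_mul_of_pow_eq (hV.comp hcont) hV
    (fun τ => div_ne_zero (one_sub_w_ne_zero τ) (hw0 τ)) h2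
  have key : ∀ τ : ℍ, 1 - c * w τ = d * c * (1 - w τ) := by
    intro τ
    have := hd τ
    simp only [Function.comp_apply] at this
    have hcτ := hc τ
    simp only [Function.comp_apply] at hcτ
    have hc0 : c ≠ 0 := by
      rintro rfl; exact hw0 (γ • τ) (by rw [hcτ, zero_mul])
    rw [hcτ] at this
    have := hw0 τ
    field_simp at *
    linear_combination this
  obtain ⟨τ₁, τ₂, hne⟩ := w_not_const
  have k1 := key τ₁
  have k2 := key τ₂
  have hcd : d * c = c := by
    have : (d * c - c) * (w τ₁ - w τ₂) = 0 := by linear_combination k1 - k2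
    rcases mul_eq_zero.mp this with h | h
    · exact sub_eq_zero.mp h
    · exact absurd (sub_eq_zero.mp h) hne
  have hc1 : c = 1 := by
    rw [hcd] at k1; linear_combination -k1
  simpa [hc1] using hc τ

end WInvariance

section CuspOrder

open Filter Topology ModularForm CongruenceSubgroup

/-- `F` behaves in absolute value like a nonzero multiple of `exp (2πiωτ)` as `Im τ → ∞`. -/
def HasCuspOrder (F : ℍ → ℂ) (ω : ℝ) : Prop :=
  ∃ C : ℝ, 0 < C ∧ Tendsto (fun τ : ℍ => ‖F τ‖ * Real.exp (2 * Real.pi * ω * τ.im)) atImInfty (𝓝 C)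

lemma HasCuspOrder.congr {F G : ℍ → ℂ} {ω : ℝ} (hF : HasCuspOrder F ω) (h : ∀ τ, G τ = F τ) :
    HasCuspOrder G ω := by
  rwa [show G = F from funext h]

lemma HasCuspOrder.mul {F G : ℍ → ℂ} {ω ω' : ℝ} (hF : HasCuspOrder F ω) (hG : HasCuspOrder G ω') :
    HasCuspOrder (fun τ => F τ * G τ) (ω + ω') := by
  obtain ⟨C, hC, h⟩ := hF
  obtain ⟨C', hC', h'⟩ := hG
  refine ⟨C * C', mul_pos hC hC', (h.mul h').congr fun τ => ?_⟩
  rw [norm_mul, mul_add, add_mul, Real.exp_add]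
  ring

lemma HasCuspOrder.inv {F : ℍ → ℂ} {ω : ℝ} (hF : HasCuspOrder F ω) :
    HasCuspOrder (fun τ => (F τ)⁻¹) (-ω) := by
  obtain ⟨C, hC, h⟩ := hF
  refine ⟨C⁻¹, inv_pos.mpr hC, (h.inv₀ hC.ne').congr fun τ => ?_⟩
  rw [norm_inv, mul_neg, neg_mul, Real.exp_neg, mul_inv]

lemma hasCuspOrder_const {c : ℂ} (hc : c ≠ 0) : HasCuspOrder (fun _ => c) 0 :=
  ⟨‖c‖, norm_pos_iff.mpr hc, by simp⟩

lemma HasCuspOrder.of_pow {F : ℍ → ℂ} {ω : ℝ} {m : ℕ} (hm : m ≠ 0)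
    (hF : HasCuspOrder (fun τ => F τ ^ m) (m * ω)) : HasCuspOrder F ω := by
  obtain ⟨C, hC, h⟩ := hF
  refine ⟨C ^ ((m : ℝ)⁻¹), Real.rpow_pos_of_pos hC _,
    (h.rpow_const (p := (m : ℝ)⁻¹) (Or.inl hC.ne')).congr fun τ => ?_⟩
  have e : Real.exp (2 * Real.pi * (m * ω) * τ.im) = Real.exp (2 * Real.pi * ω * τ.im) ^ m := by
    rw [← Real.exp_nat_mul]; congr 1; ring
  rw [norm_pow, e, ← mul_pow, Real.pow_rpow_inv_natCast (by positivity) hm]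

lemma tendsto_affinePt {e g : ℕ} {f : ℤ} (he : 0 < e) (hg : 0 < g) :
    Tendsto (affinePt e g f he hg) atImInfty atImInfty := by
  rw [atImInfty, tendsto_comap_iff]
  have : (UpperHalfPlane.im ∘ affinePt e g f he hg) = fun τ => (e / g : ℝ) * τ.im :=
    funext fun τ => im_affinePt he hg τ
  rw [this]
  have : (0 : ℝ) < e / g := by positivity
  exact tendsto_comap.const_mul_atTop this

lemma HasCuspOrder.comp_affinePt {F : ℍ → ℂ} {ω : ℝ} (hF : HasCuspOrder F ω) {e g : ℕ} {f : ℤ}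
    (he : 0 < e) (hg : 0 < g) :
    HasCuspOrder (fun τ => F (affinePt e g f he hg τ)) (ω * (e / g)) := by
  obtain ⟨C, hC, h⟩ := hF
  refine ⟨C, hC, (h.comp (tendsto_affinePt (f := f) he hg)).congr fun τ => ?_⟩
  simp only [Function.comp_apply, im_affinePt]
  congr 2
  ring

lemma HasCuspOrder.unique {F : ℍ → ℂ} {ω ω' : ℝ} (h : HasCuspOrder F ω) (h' : HasCuspOrder F ω') :
    ω = ω' := by
  wlog hlt : ω < ω' generalizing ω ω'
  · rcases lt_trichotomy ω ω' with h1 | h1 | h1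
    · exact this h h' h1
    · exact h1
    · exact (this h' h h1).symm
  obtain ⟨C, hC, h⟩ := h
  obtain ⟨C', hC', h'⟩ := h'
  exfalso
  have h1 : Tendsto (fun τ : ℍ => Real.exp (2 * Real.pi * (ω' - ω) * τ.im)) atImInfty atTop := by
    refine Real.tendsto_exp_atTop.comp ?_
    have : 0 < 2 * Real.pi * (ω' - ω) := by have := sub_pos.mpr hlt; positivity
    exact tendsto_comap.const_mul_atTop this
  have h2 := h.pos_mul_atTop hC h1
  refine not_tendsto_nhds_of_tendsto_atTop h2 C' (h'.congr fun τ => ?_)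
  rw [mul_assoc ‖F τ‖, ← Real.exp_add]
  congr 2
  ring

lemma hasCuspOrder_eta_pow : HasCuspOrder (fun τ => eta τ ^ 24) 1 := by
  refine ⟨1, one_pos, ?_⟩
  have := tendsto_atImInfty_tprod_one_sub_eta_q_pow.norm
  rw [norm_one] at this
  refine this.congr fun τ => ?_
  have h := discriminant_eq_q_prod τ
  rw [discriminant] at h
  beta_reduce
  rw [h, norm_mul]
  have hq : ‖Function.Periodic.qParam 1 (τ : ℂ)‖ = Real.exp (-2 * Real.pi * τ.im) := by
    simp [Function.Periodic.qParam, Complex.norm_exp]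
  rw [hq, mul_right_comm, ← Real.exp_add, mul_one]
  simp

/-- The order of `w` at a cusp with denominator `c`, in terms of `exp (2πiτ)`. -/
noncomputable def wOrder (c : ℤ) : ℝ :=
  (1 - (Int.gcd c 2 : ℝ) ^ 2) * (1 - (Int.gcd c 9 : ℝ) ^ 2 / 9) / 24

lemma gcd_two_cases (c : ℤ) : (Int.gcd c 2 = 2 ∧ 2 ∣ c) ∨ (Int.gcd c 2 = 1 ∧ ¬ 2 ∣ c) := by
  by_cases h : 2 ∣ c
  · exact Or.inl ⟨by exact_mod_cast (Int.gcd_eq_right_iff_dvd (by norm_num)).mpr h, h⟩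
  · refine Or.inr ⟨?_, h⟩
    have h1 : Int.gcd c 2 ∣ 2 := by exact_mod_cast Int.gcd_dvd_right c 2
    rcases (Nat.dvd_prime Nat.prime_two).mp h1 with h2 | h2
    · exact h2
    · exact absurd (by simpa [h2] using Int.gcd_dvd_left c 2) h

lemma gcd_nine_cases (c : ℤ) : (Int.gcd c 9 = 9 ∧ 9 ∣ c) ∨ (Int.gcd c 9 = 3 ∧ 3 ∣ c ∧ ¬ 9 ∣ c) ∨
    (Int.gcd c 9 = 1 ∧ ¬ 3 ∣ c) := by
  have h1 : Int.gcd c 9 ∣ 3 ^ 2 := by exact_mod_cast Int.gcd_dvd_right c 9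
  have h0 : (Int.gcd c 9 : ℤ) ∣ c := Int.gcd_dvd_left c 9
  obtain ⟨i, hi, h2⟩ := (Nat.dvd_prime_pow Nat.prime_three).mp h1
  interval_cases i
  · refine Or.inr (Or.inr ⟨h2, fun h => ?_⟩)
    have : (3 : ℤ) ∣ (Int.gcd c 9 : ℤ) := Int.dvd_coe_gcd h (by norm_num)
    rw [h2] at this
    norm_num at this
  · refine Or.inr (Or.inl ⟨h2, by rw [h2] at h0; exact_mod_cast h0, fun h => ?_⟩)
    have : (9 : ℤ) ∣ (Int.gcd c 9 : ℤ) := Int.dvd_coe_gcd h (by norm_num)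
    rw [h2] at this
    norm_num at this
  · exact Or.inl ⟨h2, by rw [h2] at h0; exact_mod_cast h0⟩

lemma wOrder_of_pole {c : ℤ} (h2 : 2 ∣ c) (h3 : ¬ 3 ∣ c) : wOrder c = -1 / 9 := by
  have a := gcd_two_cases c
  have b := gcd_nine_cases c
  have h9 : ¬ 9 ∣ c := fun h => h3 ((by norm_num : (3 : ℤ) ∣ 9).trans h)
  simp only [h2, h3, h9, not_true, and_true, and_false, false_or, or_false, not_false_iff] at a b
  rw [wOrder, a, b]
  norm_num

lemma wOrder_nonneg {c : ℤ} (h : ¬ (2 ∣ c ∧ ¬ 3 ∣ c)) : 0 ≤ wOrder c := by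
  rcases gcd_two_cases c with ⟨a, a'⟩ | ⟨a, a'⟩ <;>
  rcases gcd_nine_cases c with ⟨b, b'⟩ | ⟨b, b'⟩ | ⟨b, b'⟩ <;>
  first
  | (rw [wOrder, a, b]; norm_num; done)
  | exact absurd ⟨a', b'⟩ h

lemma dvd_of_wOrder_pos {c : ℤ} (h : 0 < wOrder c) : 18 ∣ c := by
  rcases gcd_two_cases c with ⟨a, a'⟩ | ⟨a, a'⟩ <;>
  rcases gcd_nine_cases c with ⟨b, b'⟩ | ⟨b, b'⟩ | ⟨b, b'⟩ <;>
  first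
  | (rw [wOrder, a, b] at h; norm_num at h; done)
  | omega

lemma wOrder_of_dvd {c : ℤ} (h : 18 ∣ c) : wOrder c = 1 := by
  have a := gcd_two_cases c
  have b := gcd_nine_cases c
  have h2 : 2 ∣ c := (by norm_num : (2 : ℤ) ∣ 18).trans h
  have h3 : 3 ∣ c := (by norm_num : (3 : ℤ) ∣ 18).trans h
  have h9 : 9 ∣ c := (by norm_num : (9 : ℤ) ∣ 18).trans h
  simp only [h2, h3, h9, not_true, and_true, and_false, or_false] at a b
  rw [wOrder, a, b]
  norm_num

lemma gcd_eighteen (c : ℤ) : Int.gcd c 18 = Int.gcd c 2 * Int.gcd c 9 :=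
  Nat.Coprime.gcd_mul c.natAbs (by norm_num : Nat.Coprime 2 9)

theorem hasCuspOrder_w_smul (γ : SL(2, ℤ)) :
    HasCuspOrder (fun τ => w (γ • τ : ℍ)) (wOrder (γ 1 0)) := by
  obtain ⟨γ2, g2, f2, H2⟩ := exists_isHermiteFactor (k := 2) two_pos γ
  obtain ⟨γ9, g9, f9, H9⟩ := exists_isHermiteFactor (k := 9) (by norm_num) γ
  obtain ⟨γ18, g18, f18, H18⟩ := exists_isHermiteFactor (k := 18) (by norm_num) γ
  have o2 := hasCuspOrder_eta_pow.comp_affinePt (f := f2) H2.e_pos H2.g_pos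
  have o9 := hasCuspOrder_eta_pow.comp_affinePt (f := f9) H9.e_pos H9.g_pos
  have o18 := hasCuspOrder_eta_pow.comp_affinePt (f := f18) H18.e_pos H18.g_pos
  have G2 : (g2 : ℂ) ≠ 0 := by exact_mod_cast H2.g_pos.ne'
  have G9 : (g9 : ℂ) ≠ 0 := by exact_mod_cast H9.g_pos.ne'
  have G18 : (g18 : ℂ) ≠ 0 := by exact_mod_cast H18.g_pos.ne'
  have hK : ((g2 : ℂ) ^ 2 * g9 / g18 ^ 2) ^ 12 ≠ 0 := by positivity
  have key := ((hasCuspOrder_const hK).mul ((hasCuspOrder_eta_pow.mul (o18.mul o18)))).mul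
    ((o2.mul o2).mul o9).inv
  refine HasCuspOrder.of_pow (m := 24) (by norm_num) ?_
  convert key.congr fun τ => ?_ using 1
  · rw [wOrder]
    have r2 : (Int.gcd (γ 1 0) 2 : ℝ) * g2 = 2 := by exact_mod_cast H2.mul_eq
    have r9 : (Int.gcd (γ 1 0) 9 : ℝ) * g9 = 9 := by exact_mod_cast H9.mul_eq
    have r18 : (Int.gcd (γ 1 0) 18 : ℝ) * g18 = 18 := by exact_mod_cast H18.mul_eq
    have p2 : (0 : ℝ) < g2 := by exact_mod_cast H2.g_pos
    have p9 : (0 : ℝ) < g9 := by exact_mod_cast H9.g_pos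
    have p18 : (0 : ℝ) < g18 := by exact_mod_cast H18.g_pos
    have q2 : (Int.gcd (γ 1 0) 2 : ℝ) / g2 = (Int.gcd (γ 1 0) 2 : ℝ) ^ 2 / 2 := by
      rw [div_eq_div_iff p2.ne' two_ne_zero]; linear_combination -(Int.gcd (γ 1 0) 2 : ℝ) * r2
    have q9 : (Int.gcd (γ 1 0) 9 : ℝ) / g9 = (Int.gcd (γ 1 0) 9 : ℝ) ^ 2 / 9 := by
      rw [div_eq_div_iff p9.ne' (by norm_num)]; linear_combination -(Int.gcd (γ 1 0) 9 : ℝ) * r9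
    have q18 : (Int.gcd (γ 1 0) 18 : ℝ) / g18 = (Int.gcd (γ 1 0) 18 : ℝ) ^ 2 / 18 := by
      rw [div_eq_div_iff p18.ne' (by norm_num)]; linear_combination -(Int.gcd (γ 1 0) 18 : ℝ) * r18
    have e18 : (Int.gcd (γ 1 0) 18 : ℝ) = Int.gcd (γ 1 0) 2 * Int.gcd (γ 1 0) 9 := by
      exact_mod_cast gcd_eighteen _
    push_cast
    rw [q2, q9, q18, e18]
    ring
  · have a := congrArg (· ^ 24) (w_mul_eta (γ • τ).im_pos)
    have e1 := eta_pow_24_smul γ τ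
    have e2 := H2.eta_eq τ
    have e9 := H9.eta_eq τ
    have e18 := H18.eta_eq τ
    have n2 := eta_ne_zero (affinePt _ _ f2 H2.e_pos H2.g_pos τ).im_pos
    have n9 := eta_ne_zero (affinePt _ _ f9 H9.e_pos H9.g_pos τ).im_pos
    have nj := SL_denom_ne_zero γ τ
    push_cast at e2 e9 e18
    simp only [mul_pow, ← pow_mul, mul_comm 2 24] at a
    simp only [pow_mul _ 24 2] at a
    rw [e1, e2, e9, e18] at a
    generalize eta (affinePt _ _ f2 H2.e_pos H2.g_pos τ) = x2 at *
    generalize eta (affinePt _ _ f9 H9.e_pos H9.g_pos τ) = x9 at *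
    generalize eta (affinePt _ _ f18 H18.e_pos H18.g_pos τ) = x18 at *
    generalize (γ 1 0 * τ + γ 1 1 : ℂ) = j at *
    have hne : ((j / g2) ^ 12 * x2 ^ 24) ^ 2 * ((j / g9) ^ 12 * x9 ^ 24) ≠ 0 := by
      positivity
    rw [eq_div_of_mul_eq hne a]
    field_simp

theorem hasCuspOrder_w : HasCuspOrder (fun τ => w τ) 1 := by
  have := hasCuspOrder_w_smul 1
  simpa [wOrder_of_dvd] using this

/-- The behaviour of `w(kτ)` at the cusp `γ∞`. -/
theorem IsHermiteFactor.hasCuspOrder {k : ℕ} {γ γ' : SL(2, ℤ)} {e g : ℕ} {f : ℤ}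
    (H : IsHermiteFactor k γ γ' e g f) :
    HasCuspOrder (fun τ => w (k * ((γ • τ : ℍ) : ℂ))) (wOrder (γ' 1 0) * (e / g)) :=
  ((hasCuspOrder_w_smul γ').comp_affinePt H.e_pos H.g_pos).congr fun τ => by rw [H.smul_eq]

end CuspOrder

section CosetCounting

variable {Γ G S C : Type*} [Group Γ] [Group G] [MulAction G S]

/-- `p` generates the stabilizer of `s` in `Γ` up to elements of `Γ'`, and `e` is the least
positive exponent with `p ^ e ∈ Γ'`. -/
def IsRamificationIndex (ρ : Γ →* G) (Γ' : Subgroup Γ) (s : S) (e : ℕ) : Prop :=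
  0 < e ∧ ∃ p : Γ, ρ p • s = s ∧ (∀ t, ρ t • s = s → ∃ i : ℤ, ∃ γ' ∈ Γ', t = p ^ i * γ') ∧
    ∀ i : ℤ, p ^ i ∈ Γ' ↔ (e : ℤ) ∣ i

open Classical in
/-- Summation over the cosets of `Γ'` in `Γ`, grouped by the `Γ'`-orbits in the orbit of `s₀`. -/
theorem finsum_orbits_eq_sum_cosets (ρ : Γ →* G) (Γ' : Subgroup Γ) [Fintype (Γ ⧸ Γ')]
    {cl : S → C} {out : C → S} (hout : ∀ c, cl (out c) = c)
    (hcl : ∀ s s', cl s = cl s' ↔ ∃ γ ∈ Γ', ρ γ • s = s') (s₀ : S) {φ : S → ℝ}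
    (hφ : ∀ γ ∈ Γ', ∀ s, φ (ρ γ • s) = φ s) {e : C → ℕ}
    (he : ∀ c, (∃ γ, ρ γ • s₀ = out c) → IsRamificationIndex ρ Γ' (out c) (e c)) :
    ∑ᶠ c, (if ∃ γ, ρ γ • s₀ = out c then (e c : ℝ) * φ (out c) else 0) =
      ∑ x : Γ ⧸ Γ', φ ((ρ x.out)⁻¹ • s₀) := by
  set π : Γ ⧸ Γ' → C := fun x => cl ((ρ x.out)⁻¹ • s₀) with hπ
  have hπ_mk : ∀ g : Γ, π (QuotientGroup.mk g) = cl ((ρ g)⁻¹ • s₀) := by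
    intro g
    obtain ⟨h, hh⟩ := QuotientGroup.mk_out_eq_mul Γ' g
    rw [hπ]
    dsimp only
    rw [hh, hcl]
    exact ⟨h, h.2, by rw [map_mul, mul_inv_rev, mul_smul, smul_inv_smul]⟩
  have hφ_cl : ∀ s, φ s = φ (out (cl s)) := by
    intro s
    obtain ⟨γ, hγ, h⟩ := (hcl s (out (cl s))).mp (hout _).symm
    rw [← h, hφ γ hγ]
  have hcard : ∀ c, (∃ γ, ρ γ • s₀ = out c) → (Finset.univ.filter fun x => π x = c).card = e c := by
    rintro c ⟨γ, hγ⟩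
    obtain ⟨he0, p, hp, hgen, hpe⟩ := he c ⟨γ, hγ⟩
    have hγ' : (ρ γ)⁻¹ • out c = s₀ := by rw [← hγ, inv_smul_smul]
    have hpz : ∀ i : ℤ, ρ (p ^ i) • out c = out c := by
      intro i
      have : p ^ i ∈ (MulAction.stabilizer G (out c)).comap ρ := zpow_mem (by simpa using hp) i
      simpa using this
    rw [← Finset.card_range (e c)]
    symm
    refine Finset.card_bij (fun i _ => QuotientGroup.mk (γ⁻¹ * p ^ (i : ℤ))) ?_ ?_ ?_
    · intro i _
      simp only [Finset.mem_filter, Finset.mem_univ, true_and]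
      rw [hπ_mk, map_mul, mul_inv_rev, mul_smul, map_inv, inv_inv, hγ, ← map_inv, ← zpow_neg, hpz,
        hout]
    · intro i hi j hj h
      rw [QuotientGroup.eq, mul_inv_rev, inv_inv, mul_assoc, mul_inv_cancel_left, ← zpow_neg,
        ← zpow_add, hpe] at h
      have hi := Finset.mem_range.mp hi
      have hj := Finset.mem_range.mp hj
      obtain ⟨m, hm⟩ := h
      have : m = 0 := by
        by_contra hm0
        rcases lt_or_gt_of_ne hm0 with h | h <;> nlinarith
      rw [this] at hm
      omega
    · intro x hx
      induction x using QuotientGroup.induction_on with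
      | H g =>
      simp only [Finset.mem_filter, Finset.mem_univ, true_and] at hx
      rw [hπ_mk, ← hout c, hcl] at hx
      obtain ⟨h, hh, hx⟩ := hx
      obtain ⟨i, γ', hγ'm, ht⟩ := hgen (γ * g * h⁻¹) (by
        rw [map_mul, map_mul, mul_smul, mul_smul, ← hx, map_inv, inv_smul_smul, smul_inv_smul, hγ, hx])
      refine ⟨(i % (e c : ℤ)).toNat, ?_, ?_⟩
      · have := Int.emod_lt_of_pos i (by exact_mod_cast he0 : (0 : ℤ) < e c)
        have := Int.emod_nonneg i (by exact_mod_cast he0.ne' : (e c : ℤ) ≠ 0)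
        rw [Finset.mem_range]
        omega
      · have h0 := Int.emod_nonneg i (by exact_mod_cast he0.ne' : (e c : ℤ) ≠ 0)
        rw [Int.toNat_of_nonneg h0, QuotientGroup.eq]
        have hg : g = γ⁻¹ * (p ^ i * γ') * h := by rw [← ht]; group
        rw [hg, show (γ⁻¹ * p ^ (i % (e c : ℤ)))⁻¹ * (γ⁻¹ * (p ^ i * γ') * h) =
          p ^ (-(i % (e c : ℤ)) + i) * γ' * h by rw [zpow_add]; group]
        refine Γ'.mul_mem (Γ'.mul_mem ((hpe _).mpr ?_) hγ'm) hh
        exact ⟨i / e c, by have := Int.emod_add_mul_ediv i (e c); linarith⟩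
  have hmem : ∀ c, (∃ γ, ρ γ • s₀ = out c) → ∃ x, π x = c := by
    rintro c ⟨γ, hγ⟩
    exact ⟨QuotientGroup.mk γ⁻¹, by rw [hπ_mk, map_inv, inv_inv, hγ, hout]⟩
  have hmem' : ∀ x, ∃ γ, ρ γ • s₀ = out (π x) := by
    intro x
    obtain ⟨γ, _, h⟩ := (hcl ((ρ x.out)⁻¹ • s₀) (out (π x))).mp (by rw [hout])
    exact ⟨γ * x.out⁻¹, by rw [map_mul, map_inv, mul_smul, h]⟩
  rw [finsum_eq_sum_of_support_subset (s := Finset.univ.image π)]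
  · have hsum : ∑ x : Γ ⧸ Γ', φ ((ρ x.out)⁻¹ • s₀) = ∑ x : Γ ⧸ Γ', φ (out (π x)) :=
      Finset.sum_congr rfl fun x _ => hφ_cl _
    rw [hsum, ← Finset.sum_fiberwise_of_maps_to (g := π) (t := Finset.univ.image π)
        (fun x _ => Finset.mem_image_of_mem _ (Finset.mem_univ x))]
    refine Finset.sum_congr rfl fun c hc => ?_
    obtain ⟨x, -, rfl⟩ := Finset.mem_image.mp hc
    rw [if_pos (hmem' x), ← hcard _ (hmem' x)]
    rw [Finset.sum_congr rfl (g := fun _ => φ (out (π x)))]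
    · rw [Finset.sum_const, nsmul_eq_mul]
    · intro y hy
      rw [← (Finset.mem_filter.mp hy).2]
  · intro c hc
    rw [Function.mem_support] at hc
    by_cases h : ∃ γ, ρ γ • s₀ = out c
    · obtain ⟨x, hx⟩ := hmem c h
      simpa using ⟨x, hx⟩
    · exact absurd (if_neg h) hc

end CosetCounting

section ModularGroupCusps

open CongruenceSubgroup ModularGroup OnePoint Matrix.SpecialLinearGroup

lemma mem_Gamma0_iff_dvd {N : ℕ} {γ : SL(2, ℤ)} : γ ∈ Gamma0 N ↔ (N : ℤ) ∣ γ 1 0 := by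
  rw [Gamma0_mem]; exact ZMod.intCast_zmod_eq_zero_iff_dvd _ N

lemma mapGL_rat_apply (γ : SL(2, ℤ)) (i j : Fin 2) : (mapGL ℚ γ) i j = (γ i j : ℚ) := by
  simp

lemma SL_mul_apply (γ δ : SL(2, ℤ)) (i j : Fin 2) :
    (γ * δ) i j = γ i 0 * δ 0 j + γ i 1 * δ 1 j := by
  rw [Matrix.SpecialLinearGroup.coe_mul, Matrix.mul_apply, Fin.sum_univ_two]

lemma SL_inv_apply (γ : SL(2, ℤ)) : γ⁻¹ 0 0 = γ 1 1 ∧ γ⁻¹ 0 1 = -γ 0 1 ∧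
    γ⁻¹ 1 0 = -γ 1 0 ∧ γ⁻¹ 1 1 = γ 0 0 := by
  rw [Matrix.SpecialLinearGroup.SL2_inv_expl]
  exact ⟨rfl, rfl, rfl, rfl⟩

lemma T_zpow_apply (i : ℤ) : (T ^ i) 0 0 = 1 ∧ (T ^ i) 0 1 = i ∧
    (T ^ i) 1 0 = 0 ∧ (T ^ i) 1 1 = 1 := by
  rw [coe_T_zpow]
  exact ⟨rfl, rfl, rfl, rfl⟩

lemma mapGL_smul_infty_eq_iff {γ γ' : SL(2, ℤ)} :
    mapGL ℚ γ • (∞ : OnePoint ℚ) = mapGL ℚ γ' • ∞ ↔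
      ∃ i : ℤ, γ' = γ * T ^ i ∨ γ' = -(γ * T ^ i) := by
  rw [eq_comm, ← inv_smul_eq_iff, ← mul_smul, ← map_inv, ← map_mul, smul_infty_eq_self_iff]
  rw [mapGL_rat_apply, Int.cast_eq_zero]
  constructor
  · intro h
    set δ := γ⁻¹ * γ' with hδ
    have hd := SL_det_eq δ
    have hγ' : γ' = γ * δ := by rw [hδ, mul_inv_cancel_left]
    rw [h, mul_zero, sub_zero] at hd
    rcases Int.mul_eq_one_iff_eq_one_or_neg_one.mp hd with ⟨h0, h1⟩ | ⟨h0, h1⟩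
    · refine ⟨δ 0 1, Or.inl ?_⟩
      rw [hγ']
      congr 1
      ext i j
      rw [coe_T_zpow]
      fin_cases i <;> fin_cases j <;> simp [h, h0, h1]
    · refine ⟨-δ 0 1, Or.inr ?_⟩
      rw [hγ', ← mul_neg]
      congr 1
      ext i j
      rw [Matrix.SpecialLinearGroup.coe_neg, coe_T_zpow]
      fin_cases i <;> fin_cases j <;> simp [h, h0, h1]
  · rintro ⟨i, rfl | rfl⟩
    · rw [inv_mul_cancel_left, coe_T_zpow]; simp
    · rw [← mul_neg, inv_mul_cancel_left, Matrix.SpecialLinearGroup.coe_neg, coe_T_zpow]; simp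

lemma conj_T_zpow_apply (γ : SL(2, ℤ)) (i : ℤ) :
    (γ * T ^ i * γ⁻¹) 1 0 = -(γ 1 0) ^ 2 * i ∧ (γ * T ^ i * γ⁻¹) 0 1 = (γ 0 0) ^ 2 * i := by
  obtain ⟨t1, t2, t3, t4⟩ := T_zpow_apply i
  obtain ⟨v1, v2, v3, v4⟩ := SL_inv_apply γ
  simp only [SL_mul_apply, t1, t2, t3, t4, v1, v2, v3, v4]
  exact ⟨by ring, by ring⟩

lemma conj_T_zpow_mem_iff_dvd {N : ℕ} {γ : SL(2, ℤ)} {i : ℤ} :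
    γ * T ^ i * γ⁻¹ ∈ Gamma0 N ↔ (N : ℤ) ∣ (γ 1 0) ^ 2 * i := by
  rw [mem_Gamma0_iff_dvd, (conj_T_zpow_apply γ i).1, neg_mul, Int.dvd_neg]

lemma cuspWidth_spec {N : ℕ} (hN : 0 < N) (γ : SL(2, ℤ)) :
    0 < cuspWidth N γ ∧ ∀ i : ℤ, (N : ℤ) ∣ (γ 1 0) ^ 2 * i ↔ (cuspWidth N γ : ℤ) ∣ i := by
  have hset : {h : ℕ | 0 < h ∧ γ * T ^ h * γ⁻¹ ∈ Gamma0 N} =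
      {h : ℕ | 0 < h ∧ (N : ℤ) ∣ (γ 1 0) ^ 2 * h} := by
    ext h
    simp only [Set.mem_ofPred_eq]
    rw [← conj_T_zpow_mem_iff_dvd, zpow_natCast]
  have hne : {h : ℕ | 0 < h ∧ (N : ℤ) ∣ (γ 1 0) ^ 2 * h}.Nonempty := ⟨N, hN, Dvd.intro_left _ rfl⟩
  have hspec := Nat.sInf_mem hne
  rw [← hset] at hspec
  change 0 < cuspWidth N γ ∧ _ at hspec
  have h2 : (N : ℤ) ∣ (γ 1 0) ^ 2 * cuspWidth N γ := by
    rw [← conj_T_zpow_mem_iff_dvd, zpow_natCast]; exact hspec.2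
  refine ⟨hspec.1, fun i => ⟨fun hi => ?_, fun ⟨m, hm⟩ => ?_⟩⟩
  · set h := cuspWidth N γ with hh
    have hpos : (0 : ℤ) < h := by exact_mod_cast hspec.1
    have hr0 := Int.emod_nonneg i hpos.ne'
    have hrl := Int.emod_lt_of_pos i hpos
    have hr : (N : ℤ) ∣ (γ 1 0) ^ 2 * (i % h) := by
      rw [Int.emod_def, mul_sub]
      exact dvd_sub hi (by rw [← mul_assoc]; exact h2.mul_right _)
    by_contra hnd
    have hrpos : 0 < i % h := lt_of_le_of_ne hr0 fun h0 => hnd (Int.dvd_of_emod_eq_zero h0.symm)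
    have hle : h ≤ (i % h).toNat := by
      have hm : (i % h).toNat ∈ {h : ℕ | 0 < h ∧ (N : ℤ) ∣ (γ 1 0) ^ 2 * h} :=
        ⟨by omega, by rwa [Int.toNat_of_nonneg hr0]⟩
      rw [← hset] at hm
      exact Nat.sInf_le hm
    omega
  · rw [hm, ← mul_assoc]; exact h2.mul_right _

/-- An element of `SL(2, ℤ)` which maps `∞` to `r`. -/
noncomputable def cuspRep (r : OnePoint ℚ) : SL(2, ℤ) := (OnePoint.exists_mem_SL2 ℤ r).choose

lemma cuspRep_smul (r : OnePoint ℚ) : mapGL ℚ (cuspRep r) • ∞ = r :=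
  (OnePoint.exists_mem_SL2 ℤ r).choose_spec

lemma orbitRel_mk_eq_iff {N : ℕ} {s s' : OnePoint ℚ} :
    (Quotient.mk _ s : Gamma0Cusps N) = Quotient.mk _ s' ↔
      ∃ γ ∈ Gamma0 N, mapGL ℚ γ • s = s' := by
  rw [eq_comm, Quotient.eq, MulAction.orbitRel_apply, MulAction.mem_orbit_iff]
  constructor
  · rintro ⟨⟨_, γ, hγ, rfl⟩, h⟩
    exact ⟨γ, hγ, h⟩
  · rintro ⟨γ, hγ, h⟩
    exact ⟨⟨_, γ, hγ, rfl⟩, h⟩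

lemma isRamificationIndex_cuspWidth {N : ℕ} (hN : 0 < N) (γ : SL(2, ℤ)) :
    IsRamificationIndex (mapGL ℚ) (Gamma0 N) (mapGL ℚ γ • (∞ : OnePoint ℚ)) (cuspWidth N γ) := by
  obtain ⟨h1, h2⟩ := cuspWidth_spec hN γ
  have hpow (i : ℤ) : (γ * T * γ⁻¹) ^ i = γ * T ^ i * γ⁻¹ := conj_zpow
  refine ⟨h1, γ * T * γ⁻¹, ?_, fun t ht => ?_, fun i => ?_⟩
  · rw [← mul_smul, ← map_mul, eq_comm, mapGL_smul_infty_eq_iff]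
    exact ⟨1, Or.inl (by group)⟩
  · rw [← mul_smul, ← map_mul, eq_comm, mapGL_smul_infty_eq_iff] at ht
    obtain ⟨i, h | h⟩ := ht
    · exact ⟨i, 1, one_mem _, by rw [hpow, mul_one, ← h, mul_inv_cancel_right]⟩
    · refine ⟨i, -1, by simp, ?_⟩
      rw [hpow, mul_neg, mul_one, ← neg_mul, ← h, mul_inv_cancel_right]
  · rw [hpow, conj_T_zpow_mem_iff_dvd, h2]

end ModularGroupCusps

section LevelSubgroup

open CongruenceSubgroup ModularGroup OnePoint Matrix.SpecialLinearGroup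

/-- The subgroup of those `γ ∈ Γ₀(18)` with `diag(k, 1)⁻¹ γ diag(k, 1) ∈ Γ₀(18n)`. -/
def levelSubgroup (n k : ℕ) : Subgroup (Gamma0 18) where
  carrier := {γ | (k : ℤ) ∣ (γ : SL(2, ℤ)) 0 1 ∧ (18 * n : ℤ) ∣ k * (γ : SL(2, ℤ)) 1 0}
  one_mem' := by simp
  mul_mem' {γ δ} hγ hδ := by
    simp only [Set.mem_ofPred_eq, Subgroup.coe_mul, SL_mul_apply] at *
    refine ⟨dvd_add (hδ.1.mul_left _) (hγ.1.mul_right _), ?_⟩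
    rw [mul_add]
    refine dvd_add ?_ ?_
    · rw [← mul_assoc]; exact hγ.2.mul_right _
    · rw [mul_left_comm]; exact hδ.2.mul_left _
  inv_mem' {γ} hγ := by
    obtain ⟨v1, v2, v3, v4⟩ := SL_inv_apply (γ : SL(2, ℤ))
    simp only [Set.mem_ofPred_eq, Subgroup.coe_inv, v2, v3, mul_neg, Int.dvd_neg] at *
    exact hγ

lemma mem_levelSubgroup {n k : ℕ} {γ : Gamma0 18} : γ ∈ levelSubgroup n k ↔
    (k : ℤ) ∣ (γ : SL(2, ℤ)) 0 1 ∧ (18 * n : ℤ) ∣ k * (γ : SL(2, ℤ)) 1 0 := Iff.rfl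

/-- The matrix `diag(k, 1)`. -/
noncomputable def diagGL (k : ℕ) (hk : 0 < k) : GL (Fin 2) ℚ :=
  Matrix.GeneralLinearGroup.mkOfDetNeZero !![(k : ℚ), 0; 0, 1] (by simpa using Nat.pos_iff_ne_zero.mp hk)

/-- The homomorphism `γ ↦ diag(k, 1)⁻¹ γ diag(k, 1)` on `Γ₀(18)`. -/
noncomputable def conjDiag (k : ℕ) (hk : 0 < k) : Gamma0 18 →* GL (Fin 2) ℚ :=
  (MulAut.conj (diagGL k hk)⁻¹).toMonoidHom.comp ((mapGL ℚ).comp (Gamma0 18).subtype)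

lemma conjDiag_apply {k : ℕ} (hk : 0 < k) (γ : Gamma0 18) :
    conjDiag k hk γ = (diagGL k hk)⁻¹ * mapGL ℚ (γ : SL(2, ℤ)) * diagGL k hk := by
  simp [conjDiag]

lemma diagGL_coe {k : ℕ} (hk : 0 < k) :
    (diagGL k hk : Matrix (Fin 2) (Fin 2) ℚ) = !![(k : ℚ), 0; 0, 1] := rfl

lemma mapGL_rat_coe (γ : SL(2, ℤ)) : (mapGL ℚ γ : Matrix (Fin 2) (Fin 2) ℚ) =
    !![(γ 0 0 : ℚ), γ 0 1; γ 1 0, γ 1 1] := by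
  ext i j
  fin_cases i <;> fin_cases j <;> simp

lemma conjDiag_eq_iff {k : ℕ} (hk : 0 < k) (γ₀ : Gamma0 18) (γ : SL(2, ℤ)) :
    conjDiag k hk γ₀ = mapGL ℚ γ ↔ (γ₀ : SL(2, ℤ)) 0 0 = γ 0 0 ∧ (γ₀ : SL(2, ℤ)) 0 1 = k * γ 0 1 ∧
      k * (γ₀ : SL(2, ℤ)) 1 0 = γ 1 0 ∧ (γ₀ : SL(2, ℤ)) 1 1 = γ 1 1 := by
  rw [conjDiag_apply, mul_assoc, inv_mul_eq_iff_eq_mul, ← Units.val_inj, Units.val_mul,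
    Units.val_mul, diagGL_coe, mapGL_rat_coe, mapGL_rat_coe, Matrix.mul_fin_two, Matrix.mul_fin_two]
  have hk' : (k : ℚ) ≠ 0 := by exact_mod_cast hk.ne'
  simp only [mul_zero, add_zero, zero_add, mul_one, zero_mul, one_mul,
    EmbeddingLike.apply_eq_iff_eq, Matrix.vecCons_inj, and_true]
  constructor
  · rintro ⟨⟨h1, h2⟩, h3, h4⟩
    rw [mul_comm] at h1
    refine ⟨by exact_mod_cast mul_left_cancel₀ hk' h1, by exact_mod_cast h2, ?_, by exact_mod_cast h4⟩
    rw [mul_comm] at h3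
    exact_mod_cast h3
  · rintro ⟨h1, h2, h3, h4⟩
    rw [h1, h2, h4, ← h3]
    push_cast
    exact ⟨⟨by ring, rfl⟩, by ring, rfl⟩

lemma exists_levelSubgroup_iff {n k : ℕ} (hk : 0 < k) (hkn : k ∣ n) {s s' : OnePoint ℚ} :
    (∃ γ ∈ levelSubgroup n k, conjDiag k hk γ • s = s') ↔
      ∃ γ ∈ Gamma0 (18 * n), mapGL ℚ γ • s = s' := by
  have hk' : (k : ℤ) ≠ 0 := by exact_mod_cast hk.ne'
  constructor
  · rintro ⟨γ, ⟨⟨b, hb⟩, hγ⟩, h⟩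
    have hd := SL_det_eq (γ : SL(2, ℤ))
    set δ : SL(2, ℤ) := ⟨!![(γ : SL(2, ℤ)) 0 0, b; k * (γ : SL(2, ℤ)) 1 0, (γ : SL(2, ℤ)) 1 1], by
      rw [Matrix.det_fin_two_of]; rw [hb] at hd; linear_combination hd⟩ with hδ
    refine ⟨δ, mem_Gamma0_iff_dvd.mpr (by push_cast; exact hγ), ?_⟩
    rw [← h, (conjDiag_eq_iff hk γ δ).mpr ⟨rfl, hb, rfl, rfl⟩]
  · rintro ⟨γ, hγ, h⟩
    rw [mem_Gamma0_iff_dvd] at hγ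
    push_cast at hγ
    obtain ⟨m, rfl⟩ := hkn
    obtain ⟨c, hc⟩ := hγ
    have hd := SL_det_eq γ
    push_cast at hc
    set δ : SL(2, ℤ) := ⟨!![γ 0 0, k * γ 0 1; 18 * (m * c), γ 1 1], by
      rw [Matrix.det_fin_two_of]; rw [hc] at hd; linear_combination hd⟩ with hδ
    have hδ0 : δ ∈ Gamma0 18 := mem_Gamma0_iff_dvd.mpr ⟨m * c, rfl⟩
    have hkc : (k : ℤ) * (18 * (m * c)) = γ 1 0 := by rw [hc]; ring
    refine ⟨⟨δ, hδ0⟩, ⟨⟨_, rfl⟩, ?_⟩, ?_⟩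
    · change _ ∣ (k : ℤ) * (18 * (m * c))
      rw [hkc, hc]; push_cast; exact Dvd.intro _ rfl
    · rw [← h, (conjDiag_eq_iff hk ⟨δ, hδ0⟩ γ).mpr ⟨rfl, rfl, hkc, rfl⟩]

lemma IsHermiteFactor.diagGL_smul {k : ℕ} (hk : 0 < k) {γ γ' : SL(2, ℤ)} {e g : ℕ} {f : ℤ}
    (H : IsHermiteFactor k γ γ' e g f) :
    diagGL k hk • mapGL ℚ γ • (∞ : OnePoint ℚ) = mapGL ℚ γ' • ∞ := by
  have he : (e : ℚ) ≠ 0 := by exact_mod_cast H.e_pos.ne'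
  have hg : (g : ℚ) ≠ 0 := by exact_mod_cast H.g_pos.ne'
  set β : GL (Fin 2) ℚ := Matrix.GeneralLinearGroup.mkOfDetNeZero !![(e : ℚ), f; 0, g]
    (by simp [he, hg]) with hβ
  have hm : diagGL k hk * mapGL ℚ γ = mapGL ℚ γ' * β := by
    have h00 : (k : ℚ) * γ 0 0 = γ' 0 0 * e := by exact_mod_cast H.h00
    have h01 : (k : ℚ) * γ 0 1 = γ' 0 0 * f + γ' 0 1 * g := by exact_mod_cast H.h01
    have h10 : (γ 1 0 : ℚ) = γ' 1 0 * e := by exact_mod_cast H.h10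
    have h11 : (γ 1 1 : ℚ) = γ' 1 0 * f + γ' 1 1 * g := by exact_mod_cast H.h11
    have hβc : (β : Matrix (Fin 2) (Fin 2) ℚ) = !![(e : ℚ), f; 0, g] := rfl
    rw [← Units.val_inj, Units.val_mul, Units.val_mul, diagGL_coe, mapGL_rat_coe, mapGL_rat_coe,
      hβc, Matrix.mul_fin_two, Matrix.mul_fin_two]
    simp only [mul_zero, add_zero, zero_add, zero_mul, one_mul, h00, h01, h10, h11]
  have hfix : β • (∞ : OnePoint ℚ) = ∞ := by
    rw [smul_infty_eq_self_iff]; rfl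
  rw [← mul_smul, hm, mul_smul, hfix]

/-- The matrix `(1, 0; 2, 1)`, which maps `∞` to the cusp `1/2`. -/
def halfSL : SL(2, ℤ) := ⟨!![1, 0; 2, 1], by simp⟩

lemma conjDiag_smul_eq_iff {k : ℕ} (hk : 0 < k) {γ γ' : SL(2, ℤ)} {e g : ℕ} {f : ℤ}
    (H : IsHermiteFactor k γ γ' e g f) (γ₀ : Gamma0 18) (δ : SL(2, ℤ)) :
    conjDiag k hk γ₀ • (diagGL k hk)⁻¹ • mapGL ℚ δ • (∞ : OnePoint ℚ) = mapGL ℚ γ • ∞ ↔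
      mapGL ℚ ((γ₀ : SL(2, ℤ)) * δ) • (∞ : OnePoint ℚ) = mapGL ℚ γ' • ∞ := by
  rw [← H.diagGL_smul hk, conjDiag_apply, map_mul, mul_smul, mul_smul, mul_smul, smul_inv_smul,
    inv_smul_eq_iff]

lemma mem_orbit_half_iff {k : ℕ} (hk : 0 < k) {γ γ' : SL(2, ℤ)} {e g : ℕ} {f : ℤ}
    (H : IsHermiteFactor k γ γ' e g f) :
    (∃ γ₀, conjDiag k hk γ₀ • (diagGL k hk)⁻¹ • mapGL ℚ halfSL • (∞ : OnePoint ℚ) =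
      mapGL ℚ γ • ∞) ↔ 2 ∣ γ' 1 0 ∧ ¬ 3 ∣ γ' 1 0 := by
  simp only [conjDiag_smul_eq_iff hk H, mapGL_smul_infty_eq_iff]
  have hhalf (γ₀ : SL(2, ℤ)) (i : ℤ) : (γ₀ * halfSL * T ^ i) 1 0 = γ₀ 1 0 + 2 * γ₀ 1 1 := by
    obtain ⟨t1, t2, t3, t4⟩ := T_zpow_apply i
    simp only [SL_mul_apply, t1, t3]
    simp [halfSL]
    ring
  constructor
  · rintro ⟨⟨γ₀, hγ₀⟩, i, h⟩
    have h18 := mem_Gamma0_iff_dvd.mp hγ₀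
    push_cast at h18
    have hd := SL_det_eq γ₀
    have h3 : ¬ 3 ∣ γ₀ 1 1 := by
      rintro ⟨x, hx⟩
      obtain ⟨y, hy⟩ := h18
      rw [hx, hy] at hd
      have : 3 * (γ₀ 0 0 * x - γ₀ 0 1 * (6 * y)) = 1 := by linear_combination hd
      omega
    have hc : γ' 1 0 = γ₀ 1 0 + 2 * γ₀ 1 1 ∨ γ' 1 0 = -(γ₀ 1 0 + 2 * γ₀ 1 1) := by
      rcases h with h | h
      · left; rw [h]; exact hhalf γ₀ i
      · right; rw [h, Matrix.SpecialLinearGroup.coe_neg, Matrix.neg_apply]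
        congr 1; exact hhalf γ₀ i
    omega
  · rintro ⟨⟨m, hm⟩, h3⟩
    have hm3 : ¬ 3 ∣ m := fun h => h3 (hm ▸ h.mul_left 2)
    have hco : IsCoprime m 9 := by
      have : IsCoprime m (3 ^ 2) := by
        refine IsCoprime.pow_right ?_
        rw [isCoprime_comm]
        exact (Int.prime_three.coprime_iff_not_dvd).mpr hm3
      simpa using this
    obtain ⟨x, y, hxy⟩ := hco
    set j : ℤ := 5 * (γ' 1 1 * x - 1) with hj
    have hmem : γ' * T ^ (-j) * halfSL⁻¹ ∈ Gamma0 18 := by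
      obtain ⟨t1, t2, t3, t4⟩ := T_zpow_apply (-j)
      obtain ⟨v1, -, v3, -⟩ := SL_inv_apply halfSL
      rw [mem_Gamma0_iff_dvd]
      simp only [SL_mul_apply, t1, t2, t3, t4, v1, v3]
      simp [halfSL]
      rw [hm, hj]
      exact ⟨γ' 1 1 * (1 - 10 * y) - m, by linear_combination (20 * γ' 1 1) * hxy⟩
    refine ⟨⟨_, hmem⟩, j, Or.inl ?_⟩
    simp only [inv_mul_cancel_right]
    rw [mul_assoc, ← zpow_add]
    simp

end LevelSubgroup

section LevelIndex

open CongruenceSubgroup ModularGroup OnePoint Matrix.SpecialLinearGroup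

lemma neg_one_mem_Gamma0 (N : ℕ) : (-1 : SL(2, ℤ)) ∈ Gamma0 N := by
  rw [mem_Gamma0_iff_dvd, Matrix.SpecialLinearGroup.coe_neg]
  simp

lemma conjDiag_smul_eq_self_iff {k : ℕ} (hk : 0 < k) {γ γ' : SL(2, ℤ)} {e g : ℕ} {f : ℤ}
    (H : IsHermiteFactor k γ γ' e g f) (t : Gamma0 18) :
    conjDiag k hk t • mapGL ℚ γ • (∞ : OnePoint ℚ) = mapGL ℚ γ • ∞ ↔
      ∃ i : ℤ, (t : SL(2, ℤ)) = γ' * T ^ i * γ'⁻¹ ∨ (t : SL(2, ℤ)) = -(γ' * T ^ i * γ'⁻¹) := by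
  have h1 : mapGL ℚ γ • (∞ : OnePoint ℚ) = (diagGL k hk)⁻¹ • mapGL ℚ γ' • ∞ := by
    rw [← H.diagGL_smul hk, inv_smul_smul]
  nth_rewrite 1 [h1]
  rw [conjDiag_smul_eq_iff hk H, eq_comm, mapGL_smul_infty_eq_iff]
  refine exists_congr fun i => or_congr ?_ ?_
  · rw [eq_mul_inv_iff_mul_eq]
  · rw [← neg_mul (γ' * T ^ i), eq_mul_inv_iff_mul_eq]

/-- The ramification index of `levelSubgroup n k` at a cusp where `w(kτ)` has a pole. -/
theorem exists_isRamificationIndex {n k : ℕ} (hn : 0 < n) (hk : 0 < k) (hkn : k ∣ n)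
    {γ γ' : SL(2, ℤ)} {g : ℕ} {f : ℤ} (H : IsHermiteFactor k γ γ' (Int.gcd (γ 1 0) k) g f)
    (h2 : 2 ∣ γ' 1 0) (h3 : ¬ 3 ∣ γ' 1 0) :
    ∃ E : ℕ, IsRamificationIndex (conjDiag k hk) (levelSubgroup n k) (mapGL ℚ γ • (∞ : OnePoint ℚ)) E ∧
      9 * g * E = cuspWidth (18 * n) γ * Int.gcd (γ 1 0) k := by
  set e := Int.gcd (γ 1 0) k with he
  set h := cuspWidth (18 * n) γ with hh
  obtain ⟨hpos, hspec⟩ := cuspWidth_spec (N := 18 * n) (by omega) γ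
  rw [← hh] at hpos hspec
  have he0 : (e : ℤ) ≠ 0 := by exact_mod_cast H.e_pos.ne'
  have hg0 : (g : ℤ) ≠ 0 := by exact_mod_cast H.g_pos.ne'
  have heg : (k : ℤ) = e * g := by exact_mod_cast H.mul_eq.symm
  have hc : γ 1 0 = γ' 1 0 * e := H.h10
  have ha : γ' 0 0 = g * γ 0 0 := by
    have := H.h00
    rw [heg] at this
    apply mul_right_cancel₀ he0
    linear_combination -this
  have hdet := SL_det_eq γ
  have hcop_a : IsCoprime (e : ℤ) (γ 0 0) :=
    ⟨-γ 0 1 * γ' 1 0, γ 1 1, by linear_combination hdet + γ 0 1 * hc⟩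
  have hcop_c3 : IsCoprime (3 : ℤ) (γ' 1 0) := (Int.prime_three.coprime_iff_not_dvd).mpr h3
  have hcop_g : IsCoprime (g : ℤ) (γ' 1 0) := by
    have hbez := Int.gcd_eq_gcd_ab (γ 1 0) k
    rw [← he] at hbez
    refine ⟨Int.gcdB (γ 1 0) k, Int.gcdA (γ 1 0) k, mul_left_cancel₀ he0 ?_⟩
    rw [hc] at *
    rw [heg] at *
    linear_combination -hbez
  have hdvd : (9 * g : ℤ) ∣ e * h := by
    have h18 : ((18 * n : ℕ) : ℤ) ∣ (γ 1 0) ^ 2 * h := (hspec h).mpr dvd_rfl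
    obtain ⟨n', rfl⟩ := hkn
    have : (9 * g : ℤ) ∣ (γ' 1 0) ^ 2 * (e * h) := by
      obtain ⟨x, hx⟩ := h18
      push_cast at hx
      rw [hc, heg] at hx
      refine ⟨2 * n' * x, mul_left_cancel₀ he0 ?_⟩
      linear_combination hx
    refine IsCoprime.dvd_of_dvd_mul_left ?_ this
    refine IsCoprime.pow_right (IsCoprime.mul_left ?_ hcop_g)
    have := hcop_c3.pow_left (m := 2)
    norm_num at this
    exact this
  obtain ⟨E', hE'⟩ := hdvd
  have hE'pos : 0 < E' := by
    have h1 : (0 : ℤ) < e * h := by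
      have := H.e_pos
      positivity
    rw [hE'] at h1
    have h2 : (0 : ℤ) < 9 * g := by
      have := H.g_pos
      positivity
    exact pos_of_mul_pos_right h1 h2.le
  lift E' to ℕ using hE'pos.le with E
  have hconj_mem (i : ℤ) : γ' * T ^ i * γ'⁻¹ ∈ Gamma0 18 ↔ 9 ∣ i := by
    rw [conj_T_zpow_mem_iff_dvd]
    obtain ⟨m, hm⟩ := h2
    constructor
    · intro hd
      have : (9 : ℤ) ∣ (γ' 1 0) ^ 2 * i := dvd_trans ⟨2, by norm_num⟩ hd
      refine IsCoprime.dvd_of_dvd_mul_left ?_ this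
      have := hcop_c3.pow_left (m := 2) |>.pow_right (n := 2)
      norm_num at this
      exact this
    · rintro ⟨j, rfl⟩
      exact ⟨2 * m ^ 2 * j, by rw [hm]; push_cast; ring⟩
  set p : Gamma0 18 := ⟨γ' * T ^ (9 : ℤ) * γ'⁻¹, (hconj_mem 9).mpr dvd_rfl⟩ with hp
  refine ⟨E, ⟨by exact_mod_cast hE'pos, p, ?_, ?_, ?_⟩, ?_⟩
  · rw [conjDiag_smul_eq_self_iff hk H]
    exact ⟨9, Or.inl rfl⟩
  · intro t ht
    rw [conjDiag_smul_eq_self_iff hk H] at ht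
    obtain ⟨i, hi⟩ := ht
    have h9 : 9 ∣ i := by
      rw [← hconj_mem]
      rcases hi with hi | hi
      · rw [← hi]; exact t.2
      · rw [← neg_eq_iff_eq_neg] at hi
        rw [← hi, ← neg_one_mul]
        exact mul_mem (neg_one_mem_Gamma0 18) t.2
    obtain ⟨j, rfl⟩ := h9
    rcases hi with hi | hi
    · exact ⟨j, 1, one_mem _, Subtype.ext (by simp [hp, hi, zpow_mul])⟩
    · refine ⟨j, ⟨-1, neg_one_mem_Gamma0 18⟩, ?_, Subtype.ext (by simp [hp, hi, zpow_mul])⟩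
      rw [mem_levelSubgroup]
      simp
  · intro i
    rw [mem_levelSubgroup]
    have hpi : ((p ^ i : Gamma0 18) : SL(2, ℤ)) = γ' * T ^ (9 * i) * γ'⁻¹ := by
      simp [hp, zpow_mul]
    rw [hpi, (conj_T_zpow_apply γ' _).1, (conj_T_zpow_apply γ' _).2, heg, ha]
    constructor
    · rintro ⟨hd1, hd2⟩
      have hd1' : (e : ℤ) ∣ 9 * g * i := by
        have : (e : ℤ) ∣ (γ 0 0) ^ 2 * (9 * g * i) := by
          refine (mul_dvd_mul_iff_left hg0).mp ?_
          rw [mul_comm (g : ℤ) e]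
          rwa [show (g : ℤ) * ((γ 0 0) ^ 2 * (9 * g * i)) = (g * γ 0 0) ^ 2 * (9 * i) by ring]
        exact IsCoprime.dvd_of_dvd_mul_left (hcop_a.pow_right) this
      obtain ⟨m, hm⟩ := hd1'
      have : (h : ℤ) ∣ m := by
        rw [← hspec m, hc, ← Int.dvd_neg]
        push_cast
        rwa [show -((γ' 1 0 * e) ^ 2 * m) = e * g * (-(γ' 1 0) ^ 2 * (9 * i)) by
          linear_combination ((γ' 1 0) ^ 2 * e) * hm]
      obtain ⟨m', rfl⟩ := this
      refine ⟨m', mul_left_cancel₀ (mul_ne_zero (by norm_num : (9 : ℤ) ≠ 0) hg0) ?_⟩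
      linear_combination hm + m' * hE'
    · rintro ⟨j, rfl⟩
      constructor
      · refine ⟨(γ 0 0) ^ 2 * h * j, ?_⟩
        linear_combination -(g * (γ 0 0) ^ 2 * j : ℤ) * hE'
      · have := ((hspec (h * j)).mpr (Dvd.intro _ rfl)).neg_right
        rw [hc] at this
        push_cast at this
        rwa [show (e : ℤ) * g * (-(γ' 1 0) ^ 2 * (9 * (E * j))) = -((γ' 1 0 * e) ^ 2 * (h * j)) by
          linear_combination ((γ' 1 0) ^ 2 * e * j : ℤ) * hE']
  · zify
    linear_combination hE' * (-1 : ℤ)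

/-- Conjugation by the Fricke involution `(0, -1; 18, 0)`. -/
def frickeHom : Gamma0 18 →* Gamma0 18 where
  toFun γ := ⟨⟨!![(γ : SL(2, ℤ)) 1 1, -((γ : SL(2, ℤ)) 1 0 / 18); -(18 * (γ : SL(2, ℤ)) 0 1),
      (γ : SL(2, ℤ)) 0 0], by
    have hd := SL_det_eq (γ : SL(2, ℤ))
    obtain ⟨m, hm⟩ := mem_Gamma0_iff_dvd.mp γ.2
    push_cast at hm
    rw [Matrix.det_fin_two_of, hm, Int.mul_ediv_cancel_left _ (by norm_num)]
    rw [hm] at hd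
    linear_combination hd⟩, mem_Gamma0_iff_dvd.mpr ⟨-(γ : SL(2, ℤ)) 0 1, by
      change -(18 * (γ : SL(2, ℤ)) 0 1) = _
      push_cast; ring⟩⟩
  map_one' := by
    ext i j
    fin_cases i <;> fin_cases j <;> simp
  map_mul' γ δ := by
    obtain ⟨m, hm⟩ := mem_Gamma0_iff_dvd.mp γ.2
    obtain ⟨m', hm'⟩ := mem_Gamma0_iff_dvd.mp δ.2
    push_cast at hm hm'
    have h1 : (γ : SL(2, ℤ)) 1 0 / 18 = m := by rw [hm, Int.mul_ediv_cancel_left _ (by norm_num)]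
    have h2 : (δ : SL(2, ℤ)) 1 0 / 18 = m' := by rw [hm', Int.mul_ediv_cancel_left _ (by norm_num)]
    have h3 : ((γ : SL(2, ℤ)) 1 0 * (δ : SL(2, ℤ)) 0 0 + (γ : SL(2, ℤ)) 1 1 * (δ : SL(2, ℤ)) 1 0) / 18 =
        m * (δ : SL(2, ℤ)) 0 0 + (γ : SL(2, ℤ)) 1 1 * m' := by
      rw [hm, hm', show 18 * m * (δ : SL(2, ℤ)) 0 0 + (γ : SL(2, ℤ)) 1 1 * (18 * m') =
        18 * (m * (δ : SL(2, ℤ)) 0 0 + (γ : SL(2, ℤ)) 1 1 * m') by ring,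
        Int.mul_ediv_cancel_left _ (by norm_num)]
    apply Subtype.ext
    apply Subtype.ext
    simp only [Subgroup.coe_mul, Matrix.SpecialLinearGroup.coe_mul (⟨_, _⟩ : SL(2, ℤ)) (⟨_, _⟩ : SL(2, ℤ)), SL_mul_apply, h1, h2, h3,
      Matrix.mul_fin_two]
    rw [hm, hm']
    ext i j
    fin_cases i <;> fin_cases j <;> simp <;> ring

lemma frickeHom_apply (γ : Gamma0 18) :
    (frickeHom γ : SL(2, ℤ)) 0 1 = -((γ : SL(2, ℤ)) 1 0 / 18) ∧
    (frickeHom γ : SL(2, ℤ)) 1 0 = -(18 * (γ : SL(2, ℤ)) 0 1) := ⟨rfl, rfl⟩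

lemma frickeHom_frickeHom (γ : Gamma0 18) : frickeHom (frickeHom γ) = γ := by
  obtain ⟨m, hm⟩ := mem_Gamma0_iff_dvd.mp γ.2
  push_cast at hm
  apply Subtype.ext
  apply Subtype.ext
  ext i j
  fin_cases i <;> fin_cases j <;> simp [frickeHom, hm]
  omega

lemma comap_frickeHom_levelSubgroup (n : ℕ) :
    (levelSubgroup n n).comap frickeHom = levelSubgroup n 1 := by
  ext γ
  obtain ⟨m, hm⟩ := mem_Gamma0_iff_dvd.mp γ.2
  push_cast at hm
  obtain ⟨h1, h2⟩ := frickeHom_apply γ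
  rw [Subgroup.mem_comap, mem_levelSubgroup, mem_levelSubgroup, h1, h2, hm,
    Int.mul_ediv_cancel_left _ (by norm_num : (18 : ℤ) ≠ 0)]
  constructor
  · rintro ⟨⟨x, hx⟩, -⟩
    exact ⟨by simp, ⟨-x, by push_cast; linear_combination -18 * hx⟩⟩
  · rintro ⟨-, ⟨x, hx⟩⟩
    refine ⟨⟨-x, ?_⟩, ⟨-(γ : SL(2, ℤ)) 0 1, by ring⟩⟩
    push_cast at hx
    have : (18 : ℤ) * (-m) = 18 * (n * -x) := by linear_combination -hx
    omega

lemma index_levelSubgroup_one (n : ℕ) :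
    (levelSubgroup n 1).index = (levelSubgroup n n).index := by
  rw [← comap_frickeHom_levelSubgroup]
  exact Subgroup.index_comap_of_surjective _ fun γ => ⟨frickeHom γ, frickeHom_frickeHom γ⟩

lemma mk_eq_mk_levelSubgroup_iff {n : ℕ} (γ δ : Gamma0 18) :
    (QuotientGroup.mk γ : Gamma0 18 ⧸ levelSubgroup n n) = QuotientGroup.mk δ ↔
      (n : ℤ) ∣ (γ : SL(2, ℤ)) 1 1 * (δ : SL(2, ℤ)) 0 1 - (γ : SL(2, ℤ)) 0 1 * (δ : SL(2, ℤ)) 1 1 := by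
  rw [QuotientGroup.eq, mem_levelSubgroup]
  obtain ⟨v1, v2, v3, v4⟩ := SL_inv_apply (γ : SL(2, ℤ))
  have h1 : (18 * n : ℤ) ∣ n * ((γ⁻¹ * δ : Gamma0 18) : SL(2, ℤ)) 1 0 := by
    obtain ⟨m, hm⟩ := mem_Gamma0_iff_dvd.mp (γ⁻¹ * δ).2
    rw [hm]
    exact ⟨m, by push_cast; ring⟩
  rw [and_iff_left h1]
  simp only [Subgroup.coe_mul, Subgroup.coe_inv, SL_mul_apply, v1, v2]
  rw [neg_mul, ← sub_eq_add_neg]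

lemma exists_injective_levelSubgroup_quotient (n : ℕ) :
    ∃ φ : Gamma0 18 ⧸ levelSubgroup n n → ZMod n × ZMod n, Function.Injective φ := by
  refine ⟨fun x => (((x.out : SL(2, ℤ)) 0 1 : ℤ), ((x.out : SL(2, ℤ)) 1 1 : ℤ)), fun x y hxy => ?_⟩
  rw [Prod.mk.injEq] at hxy
  rw [← QuotientGroup.out_eq' x, ← QuotientGroup.out_eq' y, mk_eq_mk_levelSubgroup_iff,
    ← ZMod.intCast_zmod_eq_zero_iff_dvd]
  push_cast
  rw [hxy.1, hxy.2]
  ring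

lemma index_levelSubgroup_le {n : ℕ} (hn : 0 < n) : (levelSubgroup n n).index ≤ n ^ 2 := by
  have : NeZero n := ⟨hn.ne'⟩
  obtain ⟨φ, hφ⟩ := exists_injective_levelSubgroup_quotient n
  refine (Nat.card_le_card_of_injective φ hφ).trans ?_
  rw [Nat.card_prod, Nat.card_zmod, sq]

lemma index_levelSubgroup_ne_zero {n : ℕ} (hn : 0 < n) : (levelSubgroup n n).index ≠ 0 := by
  have : NeZero n := ⟨hn.ne'⟩
  obtain ⟨φ, hφ⟩ := exists_injective_levelSubgroup_quotient n
  have := Finite.of_injective φ hφ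
  exact Subgroup.index_ne_zero_of_finite

lemma finite_quotient_levelSubgroup {n : ℕ} (hn : 0 < n) {k : ℕ} (hk : k = 1 ∨ k = n) :
    Finite (Gamma0 18 ⧸ levelSubgroup n k) := by
  suffices h : (levelSubgroup n k).index ≠ 0 from
    have : (levelSubgroup n k).FiniteIndex := ⟨h⟩
    Subgroup.finite_quotient_of_finiteIndex
  rcases hk with rfl | rfl
  · rw [index_levelSubgroup_one]; exact index_levelSubgroup_ne_zero hn
  · exact index_levelSubgroup_ne_zero hn

end LevelIndex

section CuspExpansion

open Filter Topology Function CongruenceSubgroup ModularGroup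

lemma tendsto_qParam_atImInfty_ne {h : ℕ} (hh : 0 < h) :
    Tendsto (fun τ : ℍ => Periodic.qParam h τ) atImInfty (𝓝[≠] 0) :=
  (Periodic.qParam_tendsto (by exact_mod_cast hh)).comp tendsto_coe_atImInfty

lemma periodic_comp_ofComplex_of_T_smul {F : ℍ → ℂ} {h : ℕ} (hF : ∀ τ : ℍ, F (T ^ h • τ) = F τ) :
    Periodic (F ∘ ofComplex) (h : ℝ) := by
  intro z
  by_cases! hz : 0 < z.im
  · have hz' : 0 < (z + ((h : ℝ) : ℂ)).im := by simpa using hz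
    simp only [comp_apply, ofComplex_apply_of_im_pos hz', ofComplex_apply_of_im_pos hz]
    rw [← hF ⟨z, hz⟩]
    congr 1
    ext
    rw [← zpow_natCast, coe_SL_smul]
    obtain ⟨t1, t2, t3, t4⟩ := T_zpow_apply (h : ℤ)
    rw [t1, t2, t3, t4]
    simp
  · have hz' : (z + ((h : ℝ) : ℂ)).im ≤ 0 := by simpa using hz
    rw [comp_apply, comp_apply, ofComplex_apply_of_im_nonpos hz, ofComplex_apply_of_im_nonpos hz']

theorem HasCuspOrder.exists_meromorphicOrderAt {G : ℍ → ℂ} {ω : ℝ} {h : ℕ} (hG : HasCuspOrder G ω)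
    (hh : 0 < h) (hper : Periodic (G ∘ ofComplex) (h : ℝ))
    (hol : DifferentiableOn ℂ (G ∘ ofComplex) {z | 0 < z.im}) :
    MeromorphicAt (cuspFunction h G) 0 ∧
      ∃ m : ℤ, meromorphicOrderAt (cuspFunction h G) 0 = m ∧ (m : ℝ) = h * ω := by
  have hh' : (0 : ℝ) < h := by exact_mod_cast hh
  obtain ⟨C, hC, hlim⟩ := id hG
  obtain ⟨M, hM⟩ := exists_nat_ge (-(h * ω))
  set G' : ℍ → ℂ := fun τ => Periodic.qParam h τ ^ M * G τ with hG'
  have hnorm (τ : ℍ) : ‖Periodic.qParam h τ‖ = Real.exp (-(2 * Real.pi * τ.im / h)) := by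
    rw [Periodic.norm_qParam]; congr 1; simp; ring
  have hbdd : IsBoundedAtImInfty G' := by
    rw [isBoundedAtImInfty_iff]
    have h1 := hlim.eventually (gt_mem_nhds (lt_add_one C))
    rw [atImInfty, Filter.eventually_comap] at h1
    obtain ⟨A, hA⟩ := (h1.and (eventually_ge_atTop 0)).exists_forall_of_atTop
    refine ⟨C + 1, A, fun τ hτ => ?_⟩
    obtain ⟨h2, h3⟩ := hA τ.im hτ
    refine le_trans ?_ (h2 τ rfl).le
    rw [hG']
    dsimp only
    rw [norm_mul, norm_pow, hnorm, mul_comm, ← Real.exp_nat_mul]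
    refine mul_le_mul_of_nonneg_left (Real.exp_le_exp.mpr ?_) (norm_nonneg _)
    have : (0 : ℝ) ≤ M / h + ω := by
      rw [show (M / h + ω : ℝ) = (M + h * ω) / h by field_simp]
      apply div_nonneg _ hh'.le
      linarith
    have h4 : 2 * Real.pi * ω * τ.im - M * -(2 * Real.pi * τ.im / h) =
        2 * Real.pi * (M / h + ω) * τ.im := by ring
    have h5 : 0 ≤ 2 * Real.pi * (M / h + ω) * τ.im := by positivity
    linarith
  have hper' : Periodic (G' ∘ ofComplex) (h : ℝ) := by
    have hqper : ∀ z : ℂ, Periodic.qParam h (z + ((h : ℝ) : ℂ)) = Periodic.qParam h z := by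
      intro z
      rw [Periodic.qParam, Periodic.qParam, mul_add, add_div, Complex.exp_add]
      have : (2 * Real.pi * Complex.I * ((h : ℝ) : ℂ) / ((h : ℝ) : ℂ) : ℂ) = 2 * Real.pi * Complex.I :=
        mul_div_cancel_right₀ _ (by exact_mod_cast hh'.ne')
      rw [this, Complex.exp_two_pi_mul_I, mul_one]
    intro z
    have hz1 := hper z
    simp only [comp_apply, hG'] at hz1 ⊢
    rw [hz1]
    by_cases! hz : 0 < z.im
    · have hz' : 0 < (z + ((h : ℝ) : ℂ)).im := by simpa using hz
      rw [ofComplex_apply_of_im_pos hz', ofComplex_apply_of_im_pos hz]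
      rw [hqper]
    · have hz' : (z + ((h : ℝ) : ℂ)).im ≤ 0 := by simpa using hz
      rw [ofComplex_apply_of_im_nonpos hz, ofComplex_apply_of_im_nonpos hz']
  have hol' : DifferentiableOn ℂ (G' ∘ ofComplex) {z | 0 < z.im} := by
    have : DifferentiableOn ℂ (fun z => Periodic.qParam h z ^ M * (G ∘ ofComplex) z) {z | 0 < z.im} :=
      (Periodic.differentiable_qParam.pow M).differentiableOn.mul hol
    refine this.congr fun z hz => ?_
    simp only [comp_apply, hG', ofComplex_apply_of_im_pos hz]
  have hana : AnalyticAt ℂ (cuspFunction h G') 0 :=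
    analyticAt_cuspFunction_zero hh' hper' (mdifferentiable_iff.mpr hol') hbdd
  have heq : ∀ᶠ q in 𝓝[≠] (0 : ℂ), q ^ (-(M : ℤ)) * cuspFunction h G' q = cuspFunction h G q := by
    filter_upwards [self_mem_nhdsWithin, mem_nhdsWithin_of_mem_nhds (Metric.ball_mem_nhds (0 : ℂ) one_pos)]
      with q hq0 hq1
    have hq0 : q ≠ 0 := hq0
    have him : 0 < (Periodic.invQParam h q).im :=
      Periodic.im_invQParam_pos_of_norm_lt_one hh' (by simpa using hq1) hq0
    rw [cuspFunction, cuspFunction, Periodic.cuspFunction_eq_of_nonzero _ _ hq0,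
      Periodic.cuspFunction_eq_of_nonzero _ _ hq0]
    simp only [comp_apply, hG']
    have hcoe : ((ofComplex (Periodic.invQParam h q) : ℍ) : ℂ) = Periodic.invQParam h q := by
      rw [ofComplex_apply_of_im_pos him]
    rw [hcoe, Periodic.qParam_right_inv hh'.ne' hq0, ← mul_assoc, zpow_neg, zpow_natCast,
      inv_mul_cancel₀ (pow_ne_zero _ hq0), one_mul]
  have hmer : MeromorphicAt (cuspFunction h G) 0 := by
    refine MeromorphicAt.congr ?_ heq
    exact ((MeromorphicAt.id 0).zpow _).mul hana.meromorphicAt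
  have hG_eq (τ : ℍ) : cuspFunction h G (Periodic.qParam h τ) = G τ :=
    eq_cuspFunction τ hh'.ne' hper
  have htend := tendsto_qParam_atImInfty_ne hh
  refine ⟨hmer, ?_⟩
  cases hm : meromorphicOrderAt (cuspFunction h G) 0 with
  | top =>
    exfalso
    rw [meromorphicOrderAt_eq_top_iff] at hm
    have h0 : ∀ᶠ τ in atImInfty, G τ = 0 := by
      filter_upwards [htend.eventually hm] with τ hτ
      rw [← hG_eq, hτ]
    have h1 : Tendsto (fun τ : ℍ => ‖G τ‖ * Real.exp (2 * Real.pi * ω * τ.im)) atImInfty (𝓝 0) := by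
      refine tendsto_const_nhds.congr' ?_
      filter_upwards [h0] with τ hτ
      simp [hτ]
    exact hC.ne' (tendsto_nhds_unique hlim h1)
  | coe m =>
    refine ⟨m, rfl, ?_⟩
    obtain ⟨u, hu, hu0, hum⟩ := (meromorphicOrderAt_eq_int_iff hmer).mp hm
    have hord : HasCuspOrder G (m / h) := by
      refine ⟨‖u 0‖, norm_pos_iff.mpr hu0, ?_⟩
      have h1 : Tendsto (fun τ : ℍ => ‖u (Periodic.qParam h τ)‖) atImInfty (𝓝 ‖u 0‖) :=
        (hu.continuousAt.tendsto.comp (htend.mono_right nhdsWithin_le_nhds)).norm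
      refine h1.congr' ?_
      filter_upwards [htend.eventually hum] with τ hτ
      rw [← hG_eq, hτ, sub_zero, norm_smul, norm_zpow, hnorm, ← Real.rpow_intCast, ← Real.exp_mul, mul_right_comm,
        ← Real.exp_add]
      rw [show (-(2 * Real.pi * τ.im / h) * m + 2 * Real.pi * (m / h) * τ.im : ℝ) = 0 by ring]
      simp
    have := hord.unique hG
    rw [← this]
    field_simp

end CuspExpansion

section WLevel

open Filter Topology Function CongruenceSubgroup ModularGroup OnePoint Matrix.SpecialLinearGroup

lemma wLevel_smul {n k : ℕ} (hk : 0 < k) (hkn : k ∣ n) {γ : SL(2, ℤ)} (hγ : γ ∈ Gamma0 (18 * n))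
    (τ : ℍ) : wLevel k (γ • τ) = wLevel k τ := by
  rw [mem_Gamma0_iff_dvd] at hγ
  obtain ⟨m, rfl⟩ := hkn
  obtain ⟨c, hc⟩ := hγ
  push_cast at hc
  have hd := SL_det_eq γ
  set δ : SL(2, ℤ) := ⟨!![γ 0 0, k * γ 0 1; 18 * (m * c), γ 1 1], by
    rw [Matrix.det_fin_two_of]; rw [hc] at hd; linear_combination hd⟩ with hδ
  have hδ0 : δ ∈ Gamma0 18 := mem_Gamma0_iff_dvd.mpr ⟨m * c, rfl⟩
  have hp : 0 < ((k : ℂ) * τ).im := natCast_mul_im_pos hk τ.2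
  have h := w_smul hδ0 ⟨(k : ℂ) * τ, hp⟩
  rw [wLevel, wLevel]
  change _ = w ((k : ℂ) * τ) at h
  rw [← h]
  congr 1
  rw [coe_SL_smul, coe_SL_smul]
  have h00 : δ 0 0 = γ 0 0 := rfl
  have h01 : δ 0 1 = k * γ 0 1 := rfl
  have h10 : δ 1 0 = 18 * (m * c) := rfl
  have h11 : δ 1 1 = γ 1 1 := rfl
  rw [h00, h01, h10, h11, hc, mul_div_assoc']
  push_cast
  congr 1 <;> ring

lemma differentiableOn_wLevel_smul {k : ℕ} (hk : 0 < k) (γ : SL(2, ℤ)) :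
    DifferentiableOn ℂ ((fun τ : ℍ => wLevel k (γ • τ)) ∘ ofComplex) {z | 0 < z.im} := by
  have hden (z : ℂ) (hz : 0 < z.im) : (γ 1 0 : ℂ) * z + γ 1 1 ≠ 0 := SL_denom_ne_zero γ ⟨z, hz⟩
  have h1 : DifferentiableOn ℂ
      (fun z : ℂ => (k : ℂ) * (((γ 0 0 : ℂ) * z + γ 0 1) / ((γ 1 0 : ℂ) * z + γ 1 1))) {z | 0 < z.im} := by
    intro z hz
    have := hden z hz
    exact DifferentiableAt.differentiableWithinAt (by fun_prop (disch := assumption))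
  refine (differentiableOn_w.comp h1 fun z hz => ?_).congr fun z hz => ?_
  · change 0 < Complex.im _
    rw [← coe_SL_smul γ ⟨z, hz⟩]
    exact natCast_mul_im_pos hk (γ • (⟨z, hz⟩ : ℍ)).2
  · simp only [comp_apply, ofComplex_apply_of_im_pos hz]
    rw [wLevel, coe_SL_smul]

lemma T_pow_cuspWidth_smul {n k : ℕ} (hn : 0 < n) (hk : 0 < k) (hkn : k ∣ n) (γ : SL(2, ℤ)) (τ : ℍ) :
    wLevel k (γ • (T ^ cuspWidth (18 * n) γ • τ)) = wLevel k (γ • τ) := by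
  have hmem : γ * T ^ (cuspWidth (18 * n) γ : ℤ) * γ⁻¹ ∈ Gamma0 (18 * n) := by
    rw [conj_T_zpow_mem_iff_dvd, (cuspWidth_spec (by omega) γ).2]
  rw [← wLevel_smul hk hkn hmem (γ • τ), ← mul_smul, ← mul_smul, inv_mul_cancel_right, zpow_natCast]

lemma exists_hasCuspOrder_wLevel_smul {k : ℕ} (hk : 0 < k) (γ : SL(2, ℤ)) :
    ∃ ω, HasCuspOrder (fun τ : ℍ => wLevel k (γ • τ)) ω := by
  obtain ⟨γ', g, f, H⟩ := exists_isHermiteFactor hk γ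
  exact ⟨_, H.hasCuspOrder⟩

theorem meromorphicAt_expansionAt_wLevel {n k : ℕ} (hn : 0 < n) (hk : 0 < k) (hkn : k ∣ n)
    {γ : SL(2, ℤ)} {ω : ℝ} (hω : HasCuspOrder (fun τ : ℍ => wLevel k (γ • τ)) ω) :
    MeromorphicAt (expansionAt (18 * n) (wLevel k) γ) 0 ∧
      ∃ m : ℤ, meromorphicOrderAt (expansionAt (18 * n) (wLevel k) γ) 0 = m ∧
        (m : ℝ) = cuspWidth (18 * n) γ * ω :=
  hω.exists_meromorphicOrderAt (cuspWidth_spec (by omega) γ).1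
    (periodic_comp_ofComplex_of_T_smul (T_pow_cuspWidth_smul hn hk hkn γ))
    (differentiableOn_wLevel_smul hk γ)

theorem isModularFunctionHolo_wLevel {n k : ℕ} (hn : 0 < n) (hk : 0 < k) (hkn : k ∣ n) :
    IsModularFunctionHolo (18 * n) (wLevel k) where
  holo := by
    have := differentiableOn_wLevel_smul hk 1
    simpa [comp_def] using this
  invariant γ hγ τ := wLevel_smul hk hkn hγ τ
  meromorphic_cusps γ := by
    obtain ⟨ω, hω⟩ := exists_hasCuspOrder_wLevel_smul hk γ
    exact (meromorphicAt_expansionAt_wLevel hn hk hkn hω).1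

/-- The order of the pole at `∞` of `w(kγτ)`, measured in powers of `exp (2πiτ)`. -/
noncomputable def poleOrder (k : ℕ) (γ : SL(2, ℤ)) : ℝ :=
  open Classical in
  if h : ∃ ω, HasCuspOrder (fun τ : ℍ => wLevel k (γ • τ)) ω then max 0 (-h.choose) else 0

lemma HasCuspOrder.poleOrder_eq {k : ℕ} {γ : SL(2, ℤ)} {ω : ℝ}
    (h : HasCuspOrder (fun τ : ℍ => wLevel k (γ • τ)) ω) : poleOrder k γ = max 0 (-ω) := by
  have h' : ∃ ω, HasCuspOrder (fun τ : ℍ => wLevel k (γ • τ)) ω := ⟨ω, h⟩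
  rw [poleOrder, dif_pos h', h'.choose_spec.unique h]

lemma poleOrder_nonneg (k : ℕ) (γ : SL(2, ℤ)) : 0 ≤ poleOrder k γ := by
  rw [poleOrder]; split_ifs
  · exact le_max_left _ _
  · exact le_rfl

lemma HasCuspOrder.comp_T_zpow_smul {F : ℍ → ℂ} {ω : ℝ} (h : HasCuspOrder F ω) (i : ℤ) :
    HasCuspOrder (fun τ => F (T ^ i • τ)) ω := by
  have h1 := h.comp_affinePt (e := 1) (g := 1) (f := i) one_pos one_pos
  rw [Nat.cast_one, div_one, mul_one] at h1
  refine h1.congr fun τ => congrArg F ?_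
  ext
  obtain ⟨t1, t2, t3, t4⟩ := T_zpow_apply i
  rw [coe_SL_smul, coe_affinePt, t1, t2, t3, t4]
  simp

lemma poleOrder_eq_of_smul_infty_eq {k : ℕ} (hk : 0 < k) {γ γ' : SL(2, ℤ)}
    (h : mapGL ℚ γ • (∞ : OnePoint ℚ) = mapGL ℚ γ' • ∞) : poleOrder k γ = poleOrder k γ' := by
  obtain ⟨ω, hω⟩ := exists_hasCuspOrder_wLevel_smul hk γ
  obtain ⟨i, hi⟩ := mapGL_smul_infty_eq_iff.mp h
  have h1 : HasCuspOrder (fun τ : ℍ => wLevel k (γ' • τ)) ω := by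
    refine (hω.comp_T_zpow_smul i).congr fun τ => ?_
    rcases hi with rfl | rfl
    · rw [mul_smul]
    · rw [SL_neg_smul, mul_smul]
  rw [hω.poleOrder_eq, h1.poleOrder_eq]

lemma poleOrder_mul {n k : ℕ} (hk : 0 < k) (hkn : k ∣ n) {δ : SL(2, ℤ)} (hδ : δ ∈ Gamma0 (18 * n))
    (γ : SL(2, ℤ)) : poleOrder k (δ * γ) = poleOrder k γ := by
  have : (fun τ : ℍ => wLevel k ((δ * γ) • τ)) = fun τ : ℍ => wLevel k (γ • τ) := by
    funext τ
    rw [mul_smul, wLevel_smul hk hkn hδ]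
  rw [poleOrder, poleOrder, this]

lemma toNat_orderAtCusp_wLevel {n k : ℕ} (hn : 0 < n) (hk : 0 < k) (hkn : k ∣ n) (r : OnePoint ℚ) :
    (((-(orderAtCusp (18 * n) (wLevel k) r).untop₀).toNat : ℕ) : ℝ) =
      cuspWidth (18 * n) (cuspRep r) * poleOrder k (cuspRep r) := by
  obtain ⟨ω, hω⟩ := exists_hasCuspOrder_wLevel_smul hk (cuspRep r)
  obtain ⟨-, m, hm, hmω⟩ := meromorphicAt_expansionAt_wLevel hn hk hkn hω
  have h1 : orderAtCusp (18 * n) (wLevel k) r = m := hm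
  have h2 : ((-m).toNat : ℝ) = ((max (-m) 0 : ℤ) : ℝ) := by
    rw [← Int.toNat_eq_max, Int.cast_natCast]
  rw [h1, WithTop.untop₀_coe, hω.poleOrder_eq, h2]
  push_cast
  rw [hmω, mul_max_of_nonneg _ _ (by positivity), mul_zero, mul_neg, max_comm]

theorem exists_ramificationIndex_eq_poleOrder {n k : ℕ} (hn : 0 < n) (hk : 0 < k) (hkn : k ∣ n)
    (γ : SL(2, ℤ)) :
    ∃ E : ℕ, ((∃ γ₀, conjDiag k hk γ₀ • (diagGL k hk)⁻¹ • mapGL ℚ halfSL • (∞ : OnePoint ℚ) =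
        mapGL ℚ γ • ∞) → IsRamificationIndex (conjDiag k hk) (levelSubgroup n k)
          (mapGL ℚ γ • (∞ : OnePoint ℚ)) E ∧ cuspWidth (18 * n) γ * poleOrder k γ = E) ∧
      ((¬ ∃ γ₀, conjDiag k hk γ₀ • (diagGL k hk)⁻¹ • mapGL ℚ halfSL • (∞ : OnePoint ℚ) =
        mapGL ℚ γ • ∞) → poleOrder k γ = 0) := by
  obtain ⟨γ', g, f, H⟩ := exists_isHermiteFactor hk γ
  have hω : HasCuspOrder (fun τ : ℍ => wLevel k (γ • τ)) _ := H.hasCuspOrder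
  rw [mem_orbit_half_iff hk H, hω.poleOrder_eq]
  have hg : (0 : ℝ) < g := by exact_mod_cast H.g_pos
  by_cases h : 2 ∣ γ' 1 0 ∧ ¬ 3 ∣ γ' 1 0
  · obtain ⟨E, hE, hE'⟩ := exists_isRamificationIndex hn hk hkn H h.1 h.2
    refine ⟨E, fun _ => ⟨hE, ?_⟩, fun h' => absurd h h'⟩
    have hE'' : (9 * g * E : ℝ) = cuspWidth (18 * n) γ * Int.gcd (γ 1 0) k := by exact_mod_cast hE'
    rw [wOrder_of_pole h.1 h.2, max_eq_right]
    · field_simp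
      linarith
    · have : (0 : ℝ) ≤ Int.gcd (γ 1 0) k / g := by positivity
      linarith
  · refine ⟨0, fun h' => absurd h' h, fun _ => max_eq_left ?_⟩
    have := wOrder_nonneg h
    have : 0 ≤ wOrder (γ' 1 0) * (Int.gcd (γ 1 0) k / g) := by positivity
    linarith

lemma card_quotient_levelSubgroup {n : ℕ} {k : ℕ} (hkn' : k = 1 ∨ k = n) :
    Nat.card (Gamma0 18 ⧸ levelSubgroup n k) = (levelSubgroup n n).index := by
  rcases hkn' with rfl | rfl
  · exact index_levelSubgroup_one n
  · rfl

theorem totalPoleDegree_wLevel {n k : ℕ} (hn : 0 < n) (hkn' : k = 1 ∨ k = n) :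
    totalPoleDegree (18 * n) (wLevel k) = (levelSubgroup n n).index := by
  have hk : 0 < k := by rcases hkn' with rfl | rfl <;> omega
  have hkn : k ∣ n := by rcases hkn' with rfl | rfl <;> simp
  have := finite_quotient_levelSubgroup hn hkn'
  let _ : Fintype (Gamma0 18 ⧸ levelSubgroup n k) := Fintype.ofFinite _
  choose E hE hE' using fun c : Gamma0Cusps (18 * n) =>
    exists_ramificationIndex_eq_poleOrder hn hk hkn (cuspRep c.out)
  simp only [cuspRep_smul] at hE hE'
  have h := finsum_orbits_eq_sum_cosets (conjDiag k hk) (levelSubgroup n k)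
    (cl := fun s => (Quotient.mk _ s : Gamma0Cusps (18 * n))) (out := Quotient.out)
    (fun c => Quotient.out_eq c)
    (fun s s' => orbitRel_mk_eq_iff.trans (exists_levelSubgroup_iff hk hkn).symm)
    ((diagGL k hk)⁻¹ • mapGL ℚ halfSL • (∞ : OnePoint ℚ)) (φ := fun _ => 1) (fun _ _ _ => rfl)
    (e := E) (fun c hc => (hE c hc).1)
  have h2 : ((totalPoleDegree (18 * n) (wLevel k) : ℕ) : ℝ) = (levelSubgroup n n).index := by
    rw [totalPoleDegree, ← Nat.coe_castAddMonoidHom,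
      (Nat.castAddMonoidHom ℝ).map_finsum_of_injective Nat.cast_injective]
    rw [Finset.sum_const, Finset.card_univ, nsmul_eq_mul, mul_one, ← Nat.card_eq_fintype_card,
      card_quotient_levelSubgroup hkn'] at h
    rw [Nat.coe_castAddMonoidHom, ← h]
    refine finsum_congr fun c => ?_
    rw [toNat_orderAtCusp_wLevel hn hk hkn]
    split_ifs with hc
    · rw [(hE c hc).2, mul_one]
    · rw [hE' c hc, mul_zero]
  exact_mod_cast h2

theorem sum_poleOrder {n k : ℕ} (hn : 0 < n) (hkn' : k = 1 ∨ k = n)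
    [Fintype (SL(2, ℤ) ⧸ Gamma0 (18 * n))] :
    ∑ x : SL(2, ℤ) ⧸ Gamma0 (18 * n), poleOrder k (x.out)⁻¹ = (levelSubgroup n n).index := by
  have hk : 0 < k := by rcases hkn' with rfl | rfl <;> omega
  have hkn : k ∣ n := by rcases hkn' with rfl | rfl <;> simp
  have hφ (γ : SL(2, ℤ)) : poleOrder k (cuspRep (mapGL ℚ γ • ∞)) = poleOrder k γ :=
    poleOrder_eq_of_smul_infty_eq hk (cuspRep_smul _)
  have h := finsum_orbits_eq_sum_cosets (mapGL ℚ) (Gamma0 (18 * n))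
    (cl := fun s => (Quotient.mk _ s : Gamma0Cusps (18 * n))) (out := Quotient.out)
    (fun c => Quotient.out_eq c) (fun s s' => orbitRel_mk_eq_iff) (∞ : OnePoint ℚ)
    (φ := fun s => poleOrder k (cuspRep s))
    (fun γ hγ s => by
      nth_rewrite 1 [← cuspRep_smul s]
      rw [← mul_smul, ← map_mul, hφ, poleOrder_mul hk hkn hγ])
    (e := fun c => cuspWidth (18 * n) (cuspRep c.out))
    (fun c _ => by
      have := isRamificationIndex_cuspWidth (N := 18 * n) (by omega) (cuspRep c.out)
      rwa [cuspRep_smul] at this)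
  have h1 : ∑ x : SL(2, ℤ) ⧸ Gamma0 (18 * n), poleOrder k (x.out)⁻¹ =
      ∑ x : SL(2, ℤ) ⧸ Gamma0 (18 * n), poleOrder k (cuspRep ((mapGL ℚ x.out)⁻¹ • ∞)) :=
    Finset.sum_congr rfl fun x _ => by rw [← map_inv, hφ]
  rw [h1, ← h, ← totalPoleDegree_wLevel hn hkn', totalPoleDegree, ← Nat.coe_castAddMonoidHom,
      (Nat.castAddMonoidHom ℝ).map_finsum_of_injective Nat.cast_injective]
  refine finsum_congr fun c => ?_
  rw [Nat.coe_castAddMonoidHom, toNat_orderAtCusp_wLevel hn hk hkn,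
    if_pos ⟨cuspRep c.out, cuspRep_smul _⟩]

end WLevel

section PlaneCurve

open MvPolynomial

/-- Pseudo-division by an element of minimal degree of an ideal. -/
lemma Polynomial.exists_dvd_C_pow_mul {R : Type*} [CommRing R] [IsDomain R] {J : Ideal (Polynomial R)}
    {F : Polynomial R} (hF : F ∈ J) (hF0 : F ≠ 0)
    (hmin : ∀ G ∈ J, G ≠ 0 → F.natDegree ≤ G.natDegree) {G : Polynomial R} (hG : G ∈ J) :
    ∃ k : ℕ, F ∣ Polynomial.C F.leadingCoeff ^ k * G := by
  induction hd : G.natDegree using Nat.strong_induction_on generalizing G with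
  | _ d ih =>
  by_cases hG0 : G = 0
  · exact ⟨0, by simp [hG0]⟩
  have hle := hmin G hG hG0
  set A := Polynomial.C F.leadingCoeff * G with hA
  set B := Polynomial.C G.leadingCoeff * Polynomial.X ^ (G.natDegree - F.natDegree) * F with hB
  have hlF : F.leadingCoeff ≠ 0 := Polynomial.leadingCoeff_ne_zero.mpr hF0
  have hlG : G.leadingCoeff ≠ 0 := Polynomial.leadingCoeff_ne_zero.mpr hG0
  have hmem : A - B ∈ J := J.sub_mem (J.mul_mem_left _ hG) (J.mul_mem_left _ hF)
  by_cases hAB : A - B = 0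
  · refine ⟨1, ?_⟩
    rw [pow_one, ← hA, sub_eq_zero.mp hAB]
    exact Dvd.intro_left _ rfl
  have hA0 : A ≠ 0 := mul_ne_zero (by simpa using hF0) hG0
  have hdegA : A.degree = G.degree := by rw [hA, Polynomial.degree_C_mul hlF]
  have hdeg : A.degree = B.degree := by
    rw [hdegA, hB, mul_assoc, Polynomial.degree_C_mul hlG, Polynomial.degree_mul,
      Polynomial.degree_X_pow, Polynomial.degree_eq_natDegree hG0, Polynomial.degree_eq_natDegree hF0]
    norm_cast
    omega
  have hlead : A.leadingCoeff = B.leadingCoeff := by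
    rw [hA, hB]
    rw [Polynomial.leadingCoeff_mul, Polynomial.leadingCoeff_mul, Polynomial.leadingCoeff_mul,
      Polynomial.leadingCoeff_C, Polynomial.leadingCoeff_C, Polynomial.leadingCoeff_X_pow, mul_one,
      mul_comm]
  have hlt : (A - B).natDegree < d := by
    rw [← hd, Polynomial.natDegree_lt_natDegree_iff hAB, ← hdegA]
    exact Polynomial.degree_sub_lt_left hdeg hA0 hlead
  obtain ⟨k, hk⟩ := ih _ hlt hmem rfl
  refine ⟨k + 1, ?_⟩
  have : Polynomial.C F.leadingCoeff ^ (k + 1) * G =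
      Polynomial.C F.leadingCoeff ^ k * (A - B) + Polynomial.C F.leadingCoeff ^ k * B := by
    rw [hA]; ring
  rw [this]
  refine dvd_add hk (Dvd.dvd.mul_left (Dvd.intro_left _ rfl) _)

lemma Ideal.IsPrime.exists_prime_dvd {R : Type*} [CommRing R] [IsDomain R] [UniqueFactorizationMonoid R]
    {I : Ideal R} (hI : I.IsPrime) {x : R} (hx0 : x ≠ 0) (hx : x ∈ I) :
    ∃ p ∈ I, Prime p ∧ p ∣ x := by
  induction x using UniqueFactorizationMonoid.induction_on_prime with
  | h₁ => exact absurd rfl hx0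
  | h₂ x hu => exact absurd (I.eq_top_of_isUnit_mem hx hu) hI.ne_top
  | h₃ a p ha hp ih =>
    rcases hI.mem_or_mem hx with h | h
    · exact ⟨p, h, hp, Dvd.intro _ rfl⟩
    · obtain ⟨q, hq, hq1, hq2⟩ := ih ha h
      exact ⟨q, hq, hq1, hq2.mul_left _⟩

variable {K : Type*} [Field K]

lemma isUnit_of_degreeOf_eq_zero {G : MvPolynomial (Fin 2) K} (hG : G ≠ 0) (h0 : G.degreeOf 0 = 0)
    (h1 : G.degreeOf 1 = 0) : IsUnit G := by
  have h : G.totalDegree = 0 := by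
    rw [totalDegree_eq_zero_iff]
    intro m hm i
    have := le_degreeOf_of_mem_support i hm
    fin_cases i
    · simpa [h0] using this
    · simpa [h1] using this
  rw [isUnit_iff_eq_C_of_isReduced]
  refine ⟨G.coeff 0, ?_, totalDegree_eq_zero_iff_eq_C.mp h⟩
  rw [isUnit_iff_ne_zero]
  intro h0
  rw [totalDegree_eq_zero_iff_eq_C.mp h, h0, C_0] at hG
  exact hG rfl

theorem irreducible_of_degreeOf_le {I : Ideal (MvPolynomial (Fin 2) K)} (hI : I.IsPrime) {D : ℕ}
    (h0 : ∀ G ∈ I, G ≠ 0 → D ≤ G.degreeOf 0) (h1 : ∀ G ∈ I, G ≠ 0 → D ≤ G.degreeOf 1)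
    {F : MvPolynomial (Fin 2) K} (hF : F ∈ I) (hF0 : F ≠ 0) (hd0 : F.degreeOf 0 ≤ D)
    (hd1 : F.degreeOf 1 ≤ D) : Irreducible F := by
  have key : ∀ A B, F = A * B → A ∈ I → IsUnit B := by
    rintro A B rfl hA
    have hA0 : A ≠ 0 := left_ne_zero_of_mul hF0
    have hB0 : B ≠ 0 := right_ne_zero_of_mul hF0
    rw [degreeOf_mul_eq hA0 hB0] at hd0 hd1
    have := h0 A hA hA0
    have := h1 A hA hA0
    exact isUnit_of_degreeOf_eq_zero hB0 (by omega) (by omega)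
  refine ⟨fun hu => hI.ne_top (I.eq_top_of_isUnit_mem hF hu), fun A B hAB => ?_⟩
  rcases hI.mem_or_mem (hAB ▸ hF) with h | h
  · exact Or.inr (key A B hAB h)
  · exact Or.inl (key B A (by rw [hAB, mul_comm]) h)

theorem exists_degreeOf_le {I : Ideal (MvPolynomial (Fin 2) K)} (hI : I.IsPrime) {D : ℕ} (hD : 0 < D)
    (h0 : ∀ G ∈ I, G ≠ 0 → D ≤ G.degreeOf 0)
    {A B : MvPolynomial (Fin 2) K} (hA : A ∈ I) (hA0 : A ≠ 0) (hAd : A.degreeOf 0 ≤ D)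
    (hB : B ∈ I) (hB0 : B ≠ 0) (hBd : B.degreeOf 1 ≤ D) :
    ∃ F ∈ I, F ≠ 0 ∧ F.degreeOf 0 ≤ D ∧ F.degreeOf 1 ≤ D := by
  obtain ⟨F, hFI, hFp, c, rfl⟩ := hI.exists_prime_dvd hA0 hA
  obtain ⟨F', hFI', hFp', c', rfl⟩ := hI.exists_prime_dvd hB0 hB
  have hc0 := right_ne_zero_of_mul hA0
  have hc0' := right_ne_zero_of_mul hB0
  rw [degreeOf_mul_eq hFp.ne_zero hc0] at hAd
  rw [degreeOf_mul_eq hFp'.ne_zero hc0'] at hBd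
  set φ := finSuccEquiv K 1 with hφ
  have hmem : ∀ G, G ∈ I ↔ φ G ∈ I.map (φ : _ →+* Polynomial (MvPolynomial (Fin 1) K)) := by
    intro G
    constructor
    · exact fun h => Ideal.mem_map_of_mem _ h
    · intro h
      obtain ⟨x, hx, hxG⟩ := (Ideal.mem_map_iff_of_surjective _ φ.surjective).mp h
      rwa [← φ.injective hxG]
  have hφ0 : φ F ≠ 0 := by simpa using hFp.ne_zero
  obtain ⟨k, hk⟩ := Polynomial.exists_dvd_C_pow_mul ((hmem F).mp hFI) hφ0 (fun G hG hG0 => by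
    have hG' : G = φ (φ.symm G) := (φ.apply_symm_apply G).symm
    rw [hG'] at hG hG0 ⊢
    rw [natDegree_finSuccEquiv, natDegree_finSuccEquiv]
    have := h0 _ ((hmem _).mpr hG) (by rintro h; rw [h, map_zero] at hG0; exact hG0 rfl)
    omega) ((hmem F').mp hFI')
  have hprime : Prime (φ F) := (MulEquiv.prime_iff φ).mpr hFp
  have hdvd : F ∣ F' := by
    rcases hprime.dvd_or_dvd hk with h | h
    · exfalso
      have h := hprime.dvd_of_dvd_pow h
      have h1 := Polynomial.natDegree_le_of_dvd h (by simpa using hφ0)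
      rw [Polynomial.natDegree_C, natDegree_finSuccEquiv] at h1
      have := h0 F hFI hFp.ne_zero
      omega
    · exact (map_dvd_iff φ).mp h
  obtain ⟨d, hd⟩ := hdvd
  have hd0 : d ≠ 0 := by rintro rfl; rw [mul_zero] at hd; exact hFp'.ne_zero hd
  refine ⟨F, hFI, hFp.ne_zero, by omega, ?_⟩
  rw [hd, degreeOf_mul_eq hFp.ne_zero hd0] at hBd
  omega

variable {A : Type*} [CommRing A] [Algebra K A]

lemma aeval_cons_eq_eval_finSuccEquiv (x y : A) (G : MvPolynomial (Fin 2) K) :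
    aeval ![x, y] G = Polynomial.eval x
      (Polynomial.map (aeval ![y] : MvPolynomial (Fin 1) K →ₐ[K] A).toRingHom (finSuccEquiv K 1 G)) := by
  induction G using MvPolynomial.induction_on with
  | C a => simp [finSuccEquiv_apply]
  | add p q hp hq => simp [hp, hq]
  | mul_X p i hp =>
    simp only [map_mul, hp, Polynomial.map_mul, Polynomial.eval_mul]
    congr 1
    fin_cases i
    · have := finSuccEquiv_X_zero (R := K) (n := 1)
      simp [this]
    · have := finSuccEquiv_X_succ (R := K) (n := 1) (j := 0)
      simp only [Fin.succ_zero_eq_one] at this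
      simp [this]

lemma aeval_injective_of_transcendental {y : A} (hy : Transcendental K y) :
    Function.Injective (aeval ![y] : MvPolynomial (Fin 1) K →ₐ[K] A) := by
  have : AlgebraicIndependent K ![y] := by
    rw [algebraicIndependent_unique_type_iff]
    simpa using hy
  exact this

theorem card_le_degreeOf_zero [IsDomain A] {y : A} (hy : Transcendental K y) {G : MvPolynomial (Fin 2) K}
    (hG : G ≠ 0) {S : Finset A} (hS : ∀ x ∈ S, aeval ![x, y] G = 0) : S.card ≤ G.degreeOf 0 := by
  classical
  set P := Polynomial.map (aeval ![y] : MvPolynomial (Fin 1) K →ₐ[K] A).toRingHom (finSuccEquiv K 1 G)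
    with hP
  have hinj : Function.Injective (aeval ![y] : MvPolynomial (Fin 1) K →ₐ[K] A).toRingHom :=
    aeval_injective_of_transcendental hy
  have hP0 : P ≠ 0 := by
    rw [hP, Polynomial.map_ne_zero_iff hinj]
    simpa using hG
  have hsub : S ⊆ P.roots.toFinset := by
    intro x hx
    rw [Multiset.mem_toFinset, Polynomial.mem_roots hP0, Polynomial.IsRoot,
      ← aeval_cons_eq_eval_finSuccEquiv, hS x hx]
  calc S.card ≤ P.roots.toFinset.card := Finset.card_le_card hsub
    _ ≤ P.roots.card := Multiset.toFinset_card_le _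
    _ ≤ P.natDegree := Polynomial.card_roots' _
    _ = G.degreeOf 0 := by rw [hP, Polynomial.natDegree_map_eq_of_injective hinj, natDegree_finSuccEquiv]

theorem card_le_degreeOf_one [IsDomain A] {x : A} (hx : Transcendental K x) {G : MvPolynomial (Fin 2) K}
    (hG : G ≠ 0) {S : Finset A} (hS : ∀ y ∈ S, aeval ![x, y] G = 0) : S.card ≤ G.degreeOf 1 := by
  have hinj : Function.Injective (Equiv.swap (0 : Fin 2) 1) := (Equiv.swap 0 1).injective
  have h := degreeOf_rename_of_injective (p := G) hinj 1
  rw [Equiv.swap_apply_right] at h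
  rw [← h]
  refine card_le_degreeOf_zero hx ?_ fun y hy => ?_
  · rwa [Ne, rename_eq_zero_iff_of_injective G hinj]
  · rw [aeval_rename, ← hS y hy]
    congr 2
    funext i
    fin_cases i <;> simp

lemma transcendental_of_forall_ne [IsDomain A] [IsAlgClosed K] {y : A} (hy : ∀ c : K, y ≠ algebraMap K A c) :
    Transcendental K y := by
  rintro ⟨p, hp0, hp⟩
  rw [(IsAlgClosed.splits p).eq_prod_roots, map_mul, Polynomial.aeval_C, mul_eq_zero] at hp
  rcases hp with h | h
  · rw [FaithfulSMul.algebraMap_eq_zero_iff, Polynomial.leadingCoeff_eq_zero] at h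
    exact hp0 h
  · rw [map_multiset_prod, Multiset.prod_eq_zero_iff, Multiset.map_map, Multiset.mem_map] at h
    obtain ⟨c, -, hc⟩ := h
    simp only [Function.comp_apply, map_sub, Polynomial.aeval_X, Polynomial.aeval_C, sub_eq_zero] at hc
    exact hy c hc

end PlaneCurve

section Stabilizer

open Filter Topology CongruenceSubgroup ModularGroup

lemma dvd_of_wLevel_smul_eq {n : ℕ} (hn : 0 < n) {γ : SL(2, ℤ)}
    (h : ∀ τ : ℍ, wLevel n (γ • τ) = wLevel n τ) : (18 * n : ℤ) ∣ γ 1 0 := by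
  obtain ⟨γ', g, f, H⟩ := exists_isHermiteFactor hn γ
  have h1 : HasCuspOrder (wLevel n) _ := H.hasCuspOrder.congr fun τ => (h τ).symm
  have h2 : HasCuspOrder (wLevel n) (1 * ((n : ℕ) / (1 : ℕ))) :=
    (hasCuspOrder_w.comp_affinePt (f := 0) hn one_pos).congr fun τ => by
      rw [wLevel, coe_affinePt]; simp
  have h3 := h1.unique h2
  have hn' : (0 : ℝ) < n := by exact_mod_cast hn
  have hg : (0 : ℝ) < g := by exact_mod_cast H.g_pos
  have he : (0 : ℝ) < Int.gcd (γ 1 0) n := by exact_mod_cast H.e_pos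
  have hpos : 0 < wOrder (γ' 1 0) := by
    have : 0 < wOrder (γ' 1 0) * (Int.gcd (γ 1 0) n / g) := by rw [h3]; positivity
    exact (pos_iff_pos_of_mul_pos this).mpr (by positivity)
  have h18 := dvd_of_wOrder_pos hpos
  rw [wOrder_of_dvd h18] at h3
  have hmul : (Int.gcd (γ 1 0) n * g : ℝ) = n := by exact_mod_cast H.mul_eq
  have hg1 : (g : ℝ) = 1 := by
    rw [← hmul] at h3
    field_simp at h3
    have h4 : (g : ℝ) ^ 2 = 1 := by push_cast at h3; linarith
    nlinarith
  have hg1' : g = 1 := by exact_mod_cast hg1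
  have hen : Int.gcd (γ 1 0) n = n := by simpa [hg1'] using H.mul_eq
  have h10 := H.h10
  rw [hen] at h10
  rw [h10]
  exact mul_dvd_mul h18 dvd_rfl

lemma dvd_of_w_div_eq {n : ℕ} (hn : 0 < n) {γ : SL(2, ℤ)}
    (h : ∀ τ : ℍ, w (((γ • τ : ℍ) : ℂ) / n) = w ((τ : ℂ) / n)) : (n : ℤ) ∣ γ 0 1 := by
  obtain ⟨γ', g, f, H⟩ := exists_isHermiteFactor hn (S * γ)
  set e := Int.gcd ((S * γ) 1 0) n with he_def
  have hn' : (0 : ℝ) < n := by exact_mod_cast hn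
  have hnC : (n : ℂ) ≠ 0 := by exact_mod_cast hn.ne'
  have hg : (0 : ℝ) < g := by exact_mod_cast H.g_pos
  have he : (0 : ℝ) < e := by exact_mod_cast H.e_pos
  have hcoe (τ : ℍ) : (((S⁻¹ * γ') • affinePt e g f H.e_pos H.g_pos τ : ℍ) : ℂ) =
      ((γ • τ : ℍ) : ℂ) / n := by
    have h1 := H.smul_eq τ
    rw [mul_smul] at h1
    set z : ℍ := γ' • affinePt e g f H.e_pos H.g_pos τ with hz
    rw [mul_smul, ← hz]
    have hz0 : (z : ℂ) ≠ 0 := ne_zero z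
    have ht0 : ((γ • τ : ℍ) : ℂ) ≠ 0 := ne_zero _
    have hS : ((S⁻¹ • z : ℍ) : ℂ) = -1 / z := by
      rw [coe_SL_smul]
      obtain ⟨v1, v2, v3, v4⟩ := SL_inv_apply S
      rw [v1, v2, v3, v4]
      simp [S, neg_div]
    have hS' : ((S • (γ • τ) : ℍ) : ℂ) = -1 / ((γ • τ : ℍ) : ℂ) := by
      rw [coe_SL_smul]
      simp [S]
    rw [hS, ← h1, hS']
    field_simp
  have h1 := (hasCuspOrder_w_smul (S⁻¹ * γ')).comp_affinePt (f := f) H.e_pos H.g_pos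
  have h2 : HasCuspOrder (fun τ : ℍ => w ((τ : ℂ) / n)) (1 * ((1 : ℕ) / n)) :=
    (hasCuspOrder_w.comp_affinePt (f := 0) one_pos hn).congr fun τ => by
      rw [coe_affinePt]; simp
  have h1' := h1.congr (G := fun τ : ℍ => w ((τ : ℂ) / n)) fun τ => by rw [hcoe, h]
  have h3 := h1'.unique h2
  have hpos : 0 < wOrder ((S⁻¹ * γ') 1 0) := by
    have : 0 < wOrder ((S⁻¹ * γ') 1 0) * (e / g : ℝ) := by rw [h3]; positivity
    exact (pos_iff_pos_of_mul_pos this).mpr (by positivity)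
  have h18 := dvd_of_wOrder_pos hpos
  rw [wOrder_of_dvd h18] at h3
  have hmul : (e * g : ℝ) = n := by exact_mod_cast H.mul_eq
  have he1 : e = 1 := by
    rw [← hmul] at h3
    field_simp at h3
    have h4 : (e : ℝ) ^ 2 = 1 := by push_cast at h3; linarith
    have : (e : ℝ) = 1 := by nlinarith
    exact_mod_cast this
  have hgn : g = n := by simpa [he1] using H.mul_eq
  have hf : (n : ℤ) ∣ f := by
    have hw (τ : ℍ) : w (affinePt 1 n f one_pos hn τ) = w (affinePt 1 n 0 one_pos hn τ) := by
      have h5 := w_smul (mem_Gamma0_iff_dvd.mpr h18) (affinePt e g f H.e_pos H.g_pos τ)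
      rw [hcoe, h] at h5
      rw [coe_affinePt, coe_affinePt]
      rw [coe_affinePt, he1, hgn] at h5
      rw [← h5]
      simp
    have t1 := tendsto_w_div_expTwoPi.comp (tendsto_affinePt (e := 1) (g := n) (f := f) one_pos hn)
    have t2 := tendsto_w_div_expTwoPi.comp (tendsto_affinePt (e := 1) (g := n) (f := 0) one_pos hn)
    have t3 := t2.div t1 one_ne_zero
    have hconst : ∀ τ : ℍ, ((fun τ : ℍ => w τ / expTwoPi τ) ∘ affinePt 1 n 0 one_pos hn) τ /
        ((fun τ : ℍ => w τ / expTwoPi τ) ∘ affinePt 1 n f one_pos hn) τ =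
        Complex.exp (2 * Real.pi * Complex.I * (f / n)) := by
      intro τ
      simp only [Function.comp_apply, hw]
      rw [div_div_div_cancel_left' _ _ (w_ne_zero (affinePt 1 n 0 one_pos hn τ).2), expTwoPi, expTwoPi,
        ← Complex.exp_sub, coe_affinePt, coe_affinePt]
      congr 1
      push_cast
      field_simp
      ring
    have t4 : Tendsto (fun _ : ℍ => Complex.exp (2 * Real.pi * Complex.I * (f / n))) atImInfty (𝓝 (1 / 1)) :=
      t3.congr hconst
    have h6 := tendsto_nhds_unique t4 tendsto_const_nhds
    rw [div_one, eq_comm, Complex.exp_eq_one_iff] at h6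
    obtain ⟨m, hm⟩ := h6
    have hpi : (2 * Real.pi * Complex.I : ℂ) ≠ 0 := Complex.two_pi_I_ne_zero
    rw [mul_comm (m : ℂ)] at hm
    have h7 := mul_left_cancel₀ hpi hm
    rw [div_eq_iff hnC] at h7
    exact ⟨m, by rw [mul_comm]; exact_mod_cast h7⟩
  have h11 := H.h11
  have hS11 : (S * γ) 1 1 = γ 0 1 := by
    rw [SL_mul_apply]; simp [S]
  rw [hS11, hgn] at h11
  rw [h11]
  exact dvd_add (hf.mul_left _) (Dvd.intro_left _ rfl)

end Stabilizer

section HolomorphicFunctions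

open Filter Topology CongruenceSubgroup ModularGroup MvPolynomial

/-- The algebra of holomorphic functions on the upper half-plane. -/
noncomputable def holSubalgebra : Subalgebra ℂ (ℍ → ℂ) where
  carrier := {f | DifferentiableOn ℂ (f ∘ ofComplex) {z | 0 < z.im}}
  mul_mem' hf hg := DifferentiableOn.mul hf hg
  add_mem' hf hg := DifferentiableOn.add hf hg
  algebraMap_mem' c := differentiableOn_const c

lemma isOpen_im_pos : IsOpen {z : ℂ | 0 < z.im} := isOpen_lt continuous_const Complex.continuous_im

instance : IsDomain holSubalgebra := by
  have : NoZeroDivisors holSubalgebra := by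
    refine ⟨fun {f g} hfg => ?_⟩
    by_contra! hne
    obtain ⟨τ, hτ⟩ : ∃ τ, (f : ℍ → ℂ) τ ≠ 0 := by
      by_contra! h
      exact hne.1 (Subtype.ext (funext h))
    have hg0 : ((g : ℍ → ℂ) ∘ ofComplex) =ᶠ[𝓝 (τ : ℂ)] 0 := by
      have hc : ContinuousAt ((f : ℍ → ℂ) ∘ ofComplex) τ :=
        (DifferentiableOn.differentiableAt f.2 (isOpen_im_pos.mem_nhds τ.2)).continuousAt
      filter_upwards [hc.eventually_ne (y := 0) (by simpa using hτ)] with z hz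
      have := congrFun (congrArg Subtype.val hfg) (ofComplex z)
      exact (mul_eq_zero.mp this).resolve_left hz
    have han : AnalyticOnNhd ℂ ((g : ℍ → ℂ) ∘ ofComplex) {z | 0 < z.im} :=
      DifferentiableOn.analyticOnNhd g.2 isOpen_im_pos
    have h0 := han.eqOn_zero_of_preconnected_of_eventuallyEq_zero
      (convex_halfSpace_im_gt 0).isPreconnected τ.2 hg0
    refine hne.2 (Subtype.ext (funext fun σ => ?_))
    have := h0 σ.2
    simpa using this
  exact NoZeroDivisors.to_isDomain _

/-- Evaluation at a point of the upper half-plane. -/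
noncomputable def holEval (τ : ℍ) : holSubalgebra →ₐ[ℂ] ℂ :=
  (Pi.evalAlgHom ℂ (fun _ => ℂ) τ).comp holSubalgebra.val

lemma holEval_apply (τ : ℍ) (f : holSubalgebra) : holEval τ f = (f : ℍ → ℂ) τ := rfl

lemma aeval_hol_eq_zero_iff {f g : holSubalgebra} {G : MvPolynomial (Fin 2) ℂ} :
    aeval ![f, g] G = 0 ↔ ∀ τ, aeval ![(f : ℍ → ℂ) τ, (g : ℍ → ℂ) τ] G = 0 := by
  have h (τ : ℍ) : holEval τ (aeval ![f, g] G) = aeval ![(f : ℍ → ℂ) τ, (g : ℍ → ℂ) τ] G := by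
    rw [comp_aeval_apply]
    congr 2
    funext i
    fin_cases i <;> rfl
  constructor
  · intro h0 τ
    rw [← h, h0, map_zero]
  · intro h0
    refine Subtype.ext (funext fun τ => ?_)
    exact (h τ).trans (h0 τ)

lemma transcendental_hol {f : holSubalgebra} (hf : ∃ τ τ', (f : ℍ → ℂ) τ ≠ (f : ℍ → ℂ) τ') :
    Transcendental ℂ f := by
  refine transcendental_of_forall_ne fun c hc => ?_
  obtain ⟨τ, τ', h⟩ := hf
  rw [hc] at h
  exact h rfl

/-- The function `w(kγτ)`. -/
noncomputable def wHol (k : ℕ) (hk : 0 < k) (γ : SL(2, ℤ)) : holSubalgebra :=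
  ⟨fun τ => wLevel k (γ • τ), differentiableOn_wLevel_smul hk γ⟩

lemma wHol_apply {k : ℕ} (hk : 0 < k) (γ : SL(2, ℤ)) (τ : ℍ) :
    (wHol k hk γ : ℍ → ℂ) τ = wLevel k (γ • τ) := rfl

lemma coe_divPt {n : ℕ} (hn : 0 < n) (τ : ℍ) : (affinePt 1 n 0 one_pos hn τ : ℂ) = τ / n := by
  rw [coe_affinePt]; simp

lemma coe_mulPt {n : ℕ} (hn : 0 < n) (τ : ℍ) : (affinePt n 1 0 hn one_pos τ : ℂ) = n * τ := by
  rw [coe_affinePt]; simp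

lemma mulPt_divPt {n : ℕ} (hn : 0 < n) (τ : ℍ) :
    affinePt n 1 0 hn one_pos (affinePt 1 n 0 one_pos hn τ) = τ := by
  have : (n : ℂ) ≠ 0 := by exact_mod_cast hn.ne'
  ext
  rw [coe_mulPt, coe_divPt]
  field_simp

lemma exists_wLevel_ne {k : ℕ} (hk : 0 < k) : ∃ τ τ', wLevel k τ ≠ wLevel k τ' := by
  by_contra! h
  obtain ⟨ω, hω⟩ := exists_hasCuspOrder_wLevel_smul hk 1
  have h0 : wLevel k I ≠ 0 := w_ne_zero (natCast_mul_im_pos hk I.2)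
  have h1 : HasCuspOrder (wLevel k) 0 := (hasCuspOrder_const h0).congr fun τ => h τ I
  have h2 : HasCuspOrder (wLevel k) (1 * ((k : ℕ) / (1 : ℕ))) :=
    (hasCuspOrder_w.comp_affinePt (f := 0) hk one_pos).congr fun τ => by
      rw [wLevel, coe_mulPt]
  have h3 := h1.unique h2
  have : (0 : ℝ) < k := by exact_mod_cast hk
  simp at h3
  exact this.ne h3

/-- The function `w(γ(nτ)/n)`. -/
noncomputable def wConjHol (n : ℕ) (hn : 0 < n) (γ : SL(2, ℤ)) : holSubalgebra :=
  ⟨fun τ => w (affinePt 1 n 0 one_pos hn (γ • affinePt n 1 0 hn one_pos τ)), by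
    have hden (z : ℂ) (hz : 0 < z.im) : (γ 1 0 : ℂ) * (n * z) + γ 1 1 ≠ 0 :=
      SL_denom_ne_zero γ ⟨n * z, natCast_mul_im_pos hn hz⟩
    have h1 : DifferentiableOn ℂ
        (fun z : ℂ => (((γ 0 0 : ℂ) * (n * z) + γ 0 1) / ((γ 1 0 : ℂ) * (n * z) + γ 1 1)) / n)
        {z | 0 < z.im} := by
      intro z hz
      have := hden z hz
      exact DifferentiableAt.differentiableWithinAt (by fun_prop (disch := assumption))
    have h2 (z : ℂ) (hz : 0 < z.im) :
        (affinePt 1 n 0 one_pos hn (γ • affinePt n 1 0 hn one_pos ⟨z, hz⟩) : ℂ) =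
        (((γ 0 0 : ℂ) * (n * z) + γ 0 1) / ((γ 1 0 : ℂ) * (n * z) + γ 1 1)) / n := by
      rw [coe_divPt, coe_SL_smul, coe_mulPt]
    refine (differentiableOn_w.comp h1 fun z hz => ?_).congr fun z hz => ?_
    · change 0 < Complex.im _
      rw [← h2 z hz]
      exact (affinePt 1 n 0 one_pos hn (γ • affinePt n 1 0 hn one_pos ⟨z, hz⟩)).2
    · simp only [Function.comp_apply, ofComplex_apply_of_im_pos hz]
      rw [h2 z hz]⟩

lemma wConjHol_apply {n : ℕ} (hn : 0 < n) (γ : SL(2, ℤ)) (τ : ℍ) : (wConjHol n hn γ : ℍ → ℂ) τ =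
    w (affinePt 1 n 0 one_pos hn (γ • affinePt n 1 0 hn one_pos τ)) := rfl

/-- The ideal of the relations between `w(τ)` and `w(nτ)`. -/
noncomputable def modularIdeal (n : ℕ) (hn : 0 < n) : Ideal (MvPolynomial (Fin 2) ℂ) :=
  RingHom.ker (aeval ![wHol 1 one_pos 1, wHol n hn 1] : MvPolynomial (Fin 2) ℂ →ₐ[ℂ] holSubalgebra)

instance (n : ℕ) (hn : 0 < n) : (modularIdeal n hn).IsPrime := RingHom.ker_isPrime _

lemma mem_modularIdeal {n : ℕ} (hn : 0 < n) {G : MvPolynomial (Fin 2) ℂ} :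
    G ∈ modularIdeal n hn ↔ ∀ τ : ℍ, aeval ![w τ, w (n * τ)] G = 0 := by
  rw [modularIdeal, RingHom.mem_ker, aeval_hol_eq_zero_iff]
  simp [wHol_apply, wLevel]

theorem index_le_degreeOf_one {n : ℕ} (hn : 0 < n) {G : MvPolynomial (Fin 2) ℂ}
    (hG : G ∈ modularIdeal n hn) (hG0 : G ≠ 0) : (levelSubgroup n n).index ≤ G.degreeOf 1 := by
  classical
  have := finite_quotient_levelSubgroup hn (k := 1) (Or.inl rfl)
  let _ : Fintype (Gamma0 18 ⧸ levelSubgroup n 1) := Fintype.ofFinite _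
  set ρ : Gamma0 18 ⧸ levelSubgroup n 1 → holSubalgebra :=
    fun x => wHol n hn ((x.out⁻¹ : Gamma0 18) : SL(2, ℤ)) with hρ
  have hinj : Function.Injective ρ := by
    intro x y hxy
    rw [← QuotientGroup.out_eq' x, ← QuotientGroup.out_eq' y, eq_comm, QuotientGroup.eq, mem_levelSubgroup]
    refine ⟨by simp, ?_⟩
    rw [Nat.cast_one, one_mul]
    refine dvd_of_wLevel_smul_eq hn fun τ => ?_
    have h := congrFun (congrArg Subtype.val hxy) ((x.out : SL(2, ℤ)) • τ)
    simp only [hρ, wHol_apply] at h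
    rw [← mul_smul, ← mul_smul, Subgroup.coe_inv, inv_mul_cancel, one_smul] at h
    rw [h, Subgroup.coe_mul]
  rw [← card_quotient_levelSubgroup (Or.inl rfl : 1 = 1 ∨ 1 = n), Nat.card_eq_fintype_card,
    ← Finset.card_univ, ← Finset.card_image_of_injective _ hinj]
  refine card_le_degreeOf_one (x := wHol 1 one_pos 1) (transcendental_hol ?_) hG0 fun y hy => ?_
  · simpa [wHol_apply] using exists_wLevel_ne one_pos
  · obtain ⟨x, -, rfl⟩ := Finset.mem_image.mp hy
    rw [aeval_hol_eq_zero_iff]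
    intro τ
    have h := (mem_modularIdeal hn).mp hG (((x.out⁻¹ : Gamma0 18) : SL(2, ℤ)) • τ)
    rw [w_smul (x.out⁻¹).2] at h
    simpa [hρ, wHol_apply, wLevel] using h

theorem index_le_degreeOf_zero {n : ℕ} (hn : 0 < n) {G : MvPolynomial (Fin 2) ℂ}
    (hG : G ∈ modularIdeal n hn) (hG0 : G ≠ 0) : (levelSubgroup n n).index ≤ G.degreeOf 0 := by
  classical
  have := finite_quotient_levelSubgroup hn (k := n) (Or.inr rfl)
  let _ : Fintype (Gamma0 18 ⧸ levelSubgroup n n) := Fintype.ofFinite _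
  set ρ : Gamma0 18 ⧸ levelSubgroup n n → holSubalgebra :=
    fun x => wConjHol n hn ((x.out⁻¹ : Gamma0 18) : SL(2, ℤ)) with hρ
  have hinj : Function.Injective ρ := by
    intro x y hxy
    rw [← QuotientGroup.out_eq' x, ← QuotientGroup.out_eq' y, eq_comm, QuotientGroup.eq, mem_levelSubgroup]
    refine ⟨?_, ?_⟩
    · refine dvd_of_w_div_eq hn fun τ => ?_
      have h := congrFun (congrArg Subtype.val hxy) (affinePt 1 n 0 one_pos hn ((x.out : SL(2, ℤ)) • τ))
      simp only [hρ, wConjHol_apply, mulPt_divPt] at h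
      rw [← mul_smul, ← mul_smul, Subgroup.coe_inv, inv_mul_cancel, one_smul, coe_divPt, coe_divPt] at h
      rw [h, Subgroup.coe_mul]
    · obtain ⟨m, hm⟩ := mem_Gamma0_iff_dvd.mp (y.out⁻¹ * x.out).2
      rw [hm]
      exact ⟨m, by push_cast; ring⟩
  rw [Subgroup.index, Nat.card_eq_fintype_card, ← Finset.card_univ, ← Finset.card_image_of_injective _ hinj]
  refine card_le_degreeOf_zero (y := wHol n hn 1) (transcendental_hol ?_) hG0 fun y hy => ?_
  · simpa [wHol_apply] using exists_wLevel_ne hn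
  · obtain ⟨x, -, rfl⟩ := Finset.mem_image.mp hy
    rw [aeval_hol_eq_zero_iff]
    intro τ
    have h := (mem_modularIdeal hn).mp hG
      (affinePt 1 n 0 one_pos hn (((x.out⁻¹ : Gamma0 18) : SL(2, ℤ)) • affinePt n 1 0 hn one_pos τ))
    have h2 : w (n * (affinePt 1 n 0 one_pos hn (((x.out⁻¹ : Gamma0 18) : SL(2, ℤ)) •
        affinePt n 1 0 hn one_pos τ) : ℂ)) = w (n * τ) := by
      rw [← coe_mulPt hn, mulPt_divPt, w_smul (x.out⁻¹).2, coe_mulPt]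
    rw [h2] at h
    simpa [hρ, wHol_apply, wConjHol_apply, wLevel] using h

end HolomorphicFunctions

section Valence

open Filter Topology Asymptotics CongruenceSubgroup ModularGroup MvPolynomial
open scoped ModularForm

/-- A holomorphic function on the upper half-plane which is invariant under `SL(2, ℤ)` and tends to
`0` at the cusp vanishes. -/
theorem eq_zero_of_forall_SL_smul_eq {N : ℍ → ℂ} (hN : N ∈ holSubalgebra)
    (hinv : ∀ (γ : SL(2, ℤ)) (τ : ℍ), N (γ • τ) = N τ) (h0 : Tendsto N atImInfty (𝓝 0)) : N = 0 := by
  have hslash (γ : SL(2, ℤ)) : N ∣[(0 : ℤ)] γ = N := by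
    funext τ
    rw [ModularForm.SL_slash_apply, neg_zero, zpow_zero, mul_one, hinv]
  have hb : IsBoundedAtImInfty N := h0.isBigO_one ℝ
  let F : ModularForm 𝒮ℒ 0 :=
    { toFun := N
      slash_action_eq' := by
        rintro _ ⟨γ, rfl⟩
        exact hslash γ
      holo' := mdifferentiable_iff.mpr hN
      bdd_at_cusps' := fun {c} hc => by
        rw [OnePoint.isBoundedAt_iff_forall_SL2Z hc]
        intro γ _
        rwa [hslash] }
  obtain ⟨c, hc⟩ := ModularFormClass.levelOne_weight_zero_const F
  have hc' (τ : ℍ) : N τ = c := congrFun hc τ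
  have h1 : Tendsto N atImInfty (𝓝 c) := tendsto_const_nhds.congr fun τ => (hc' τ).symm
  have := tendsto_nhds_unique h1 h0
  funext τ
  rw [hc', this, Pi.zero_apply]

/-- The comparison function `|exp (-2πirτ)|`. -/
noncomputable def growth (r : ℝ) (τ : ℍ) : ℝ := Real.exp (2 * Real.pi * r * τ.im)

lemma growth_pos (r : ℝ) (τ : ℍ) : 0 < growth r τ := Real.exp_pos _

lemma growth_add (r s : ℝ) : growth (r + s) = fun τ => growth r τ * growth s τ := by
  funext τ
  rw [growth, growth, growth, ← Real.exp_add]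
  ring_nf

lemma growth_nat_mul (m : ℕ) (r : ℝ) : growth (m * r) = fun τ => growth r τ ^ m := by
  funext τ
  rw [growth, growth, ← Real.exp_nat_mul]
  ring_nf

lemma growth_sum {ι : Type*} (s : Finset ι) (r : ι → ℝ) :
    growth (∑ i ∈ s, r i) = fun τ => ∏ i ∈ s, growth (r i) τ := by
  funext τ
  simp only [growth]
  rw [← Real.exp_sum, Finset.mul_sum, Finset.sum_mul]

lemma growth_mono {r s : ℝ} (h : r ≤ s) : growth r =O[atImInfty] growth s := by
  refine IsBigO.of_bound 1 (Eventually.of_forall fun τ => ?_)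
  rw [one_mul, Real.norm_of_nonneg (growth_pos r τ).le, Real.norm_of_nonneg (growth_pos s τ).le]
  have := τ.im_pos
  exact Real.exp_le_exp.mpr (by gcongr)

lemma tendsto_growth_of_neg {r : ℝ} (hr : r < 0) : Tendsto (growth r) atImInfty (𝓝 0) := by
  refine Real.tendsto_exp_atBot.comp ?_
  have : 2 * Real.pi * r < 0 := mul_neg_of_pos_of_neg Real.two_pi_pos hr
  exact tendsto_comap.const_mul_atTop_of_neg this

lemma HasCuspOrder.isBigO {F : ℍ → ℂ} {ω : ℝ} (h : HasCuspOrder F ω) :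
    F =O[atImInfty] growth (-ω) := by
  obtain ⟨C, hC, hlim⟩ := h
  have h1 := (hlim.isBigO_one ℝ).mul (isBigO_refl (growth (-ω)) atImInfty)
  have h2 : (fun τ : ℍ => ‖F τ‖) =O[atImInfty] growth (-ω) := by
    refine (h1.congr_left fun τ => ?_).congr_right fun τ => one_mul _
    rw [growth, mul_assoc, ← Real.exp_add]
    ring_nf
    simp
  exact h2.of_norm_left

lemma isBigO_wLevel_smul {k : ℕ} (hk : 0 < k) (γ : SL(2, ℤ)) :
    (fun τ : ℍ => wLevel k (γ • τ)) =O[atImInfty] growth (poleOrder k γ) := by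
  obtain ⟨ω, hω⟩ := exists_hasCuspOrder_wLevel_smul hk γ
  refine hω.isBigO.trans (growth_mono ?_)
  rw [hω.poleOrder_eq]
  exact le_max_right _ _

lemma isBigO_aeval_smul {n : ℕ} (hn : 0 < n) {G : MvPolynomial (Fin 2) ℂ} {a b : ℕ}
    (ha : G.degreeOf 0 ≤ a) (hb : G.degreeOf 1 ≤ b) (γ : SL(2, ℤ)) :
    (fun τ : ℍ => aeval ![wLevel 1 (γ • τ), wLevel n (γ • τ)] G) =O[atImInfty]
      growth (a * poleOrder 1 γ + b * poleOrder n γ) := by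
  simp only [aeval_def, eval₂_eq', Fin.prod_univ_two]
  refine IsBigO.fun_sum fun m hm => ?_
  have h0 := (degreeOf_le_iff.mp ha) m hm
  have h1 := (degreeOf_le_iff.mp hb) m hm
  have p0 := poleOrder_nonneg 1 γ
  have p1 := poleOrder_nonneg n γ
  refine IsBigO.const_mul_left ?_ _
  rw [growth_add]
  refine IsBigO.mul ?_ ?_
  · refine IsBigO.trans ?_ (growth_mono (r := m 0 * poleOrder 1 γ) (by gcongr))
    rw [growth_nat_mul]
    exact (isBigO_wLevel_smul one_pos γ).pow _
  · refine IsBigO.trans ?_ (growth_mono (r := m 1 * poleOrder n γ) (by gcongr))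
    rw [growth_nat_mul]
    exact (isBigO_wLevel_smul hn γ).pow _

/-- A polynomial in `w(τ)` and `w(nτ)` that vanishes to a high order at `∞` vanishes. -/
theorem mem_modularIdeal_of_isBigO {n : ℕ} (hn : 0 < n) {G : MvPolynomial (Fin 2) ℂ} {a b B : ℕ}
    (ha : G.degreeOf 0 ≤ a) (hb : G.degreeOf 1 ≤ b)
    (hB : (a + b) * (levelSubgroup n n).index < B)
    (h : (fun τ : ℍ => aeval ![w τ, w (n * τ)] G) =O[atImInfty] growth (-B)) :
    G ∈ modularIdeal n hn := by
  classical
  have : NeZero (18 * n) := ⟨by omega⟩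
  let _ : Fintype (SL(2, ℤ) ⧸ Gamma0 (18 * n)) := Fintype.ofFinite _
  have hw1 (τ : ℍ) : w τ = wLevel 1 τ := by simp [wLevel]
  set Φ : SL(2, ℤ) → holSubalgebra := fun γ => aeval ![wHol 1 one_pos γ, wHol n hn γ] G with hΦ
  have hΦ_apply (γ : SL(2, ℤ)) (τ : ℍ) :
      (Φ γ : ℍ → ℂ) τ = aeval ![wLevel 1 (γ • τ), wLevel n (γ • τ)] G := by
    rw [← holEval_apply, hΦ]
    dsimp only
    rw [comp_aeval_apply]
    congr 2
    funext i
    fin_cases i <;> rfl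
  have hΦ_mul (δ γ : SL(2, ℤ)) (hδ : δ ∈ Gamma0 (18 * n)) (τ : ℍ) :
      (Φ (δ * γ) : ℍ → ℂ) τ = (Φ γ : ℍ → ℂ) τ := by
    rw [hΦ_apply, hΦ_apply, mul_smul, wLevel_smul one_pos (one_dvd n) hδ, wLevel_smul hn dvd_rfl hδ]
  set N : holSubalgebra := ∏ x : SL(2, ℤ) ⧸ Gamma0 (18 * n), Φ (x.out)⁻¹ with hN
  have hN_apply (τ : ℍ) : (N : ℍ → ℂ) τ =
      ∏ x : SL(2, ℤ) ⧸ Gamma0 (18 * n), (Φ (x.out)⁻¹ : ℍ → ℂ) τ := by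
    rw [← holEval_apply, hN, map_prod]
    rfl
  have hinv (γ : SL(2, ℤ)) (τ : ℍ) : (N : ℍ → ℂ) (γ • τ) = (N : ℍ → ℂ) τ := by
    rw [hN_apply, hN_apply]
    refine Fintype.prod_equiv (MulAction.toPerm γ⁻¹) _ _ fun x => ?_
    rw [MulAction.toPerm_apply]
    obtain ⟨δ, hδ⟩ := QuotientGroup.mk_out_eq_mul (Gamma0 (18 * n)) (γ⁻¹ * x.out)
    have hx : γ⁻¹ • x = QuotientGroup.mk (γ⁻¹ * x.out) := by
      conv_lhs => rw [← QuotientGroup.out_eq' x]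
      rfl
    rw [hx, hδ, mul_inv_rev, hΦ_mul _ _ (inv_mem δ.2), hΦ_apply, hΦ_apply, mul_inv_rev, inv_inv,
      mul_smul]
  set x₀ : SL(2, ℤ) ⧸ Gamma0 (18 * n) := QuotientGroup.mk 1 with hx₀
  have hmem : (x₀.out)⁻¹ ∈ Gamma0 (18 * n) := by
    have : (QuotientGroup.mk (1 : SL(2, ℤ)) : SL(2, ℤ) ⧸ Gamma0 (18 * n)) = QuotientGroup.mk x₀.out := by
      rw [QuotientGroup.out_eq']
    rw [QuotientGroup.eq, inv_one, one_mul] at this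
    exact inv_mem this
  have hone : (Φ (x₀.out)⁻¹ : ℍ → ℂ) =O[atImInfty] growth (-B) := by
    refine h.congr_left fun τ => ?_
    have := hΦ_mul _ 1 hmem τ
    rw [mul_one] at this
    rw [this, hΦ_apply, one_smul, hw1]
    rfl
  set r : SL(2, ℤ) ⧸ Gamma0 (18 * n) → ℝ := fun x =>
    a * poleOrder 1 (x.out)⁻¹ + b * poleOrder n (x.out)⁻¹ with hr
  set s : SL(2, ℤ) ⧸ Gamma0 (18 * n) → ℝ := Function.update r x₀ (-B) with hs
  have hbound : (N : ℍ → ℂ) =O[atImInfty] growth (∑ x, s x) := by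
    rw [growth_sum, show (N : ℍ → ℂ) = fun τ => ∏ x : SL(2, ℤ) ⧸ Gamma0 (18 * n),
      (Φ (x.out)⁻¹ : ℍ → ℂ) τ from funext hN_apply]
    refine IsBigO.finsetProd fun x _ => ?_
    by_cases hx : x = x₀
    · rw [hx, hs, Function.update_self]
      exact hone
    · rw [hs, Function.update_of_ne hx]
      refine (isBigO_aeval_smul hn ha hb (x.out)⁻¹).congr_left fun τ => ?_
      rw [hΦ_apply]
  have hneg : ∑ x, s x < 0 := by
    have h1 : ∑ x, s x ≤ -B + ∑ x, r x := by
      rw [hs, Finset.sum_update_of_mem (Finset.mem_univ _)]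
      gcongr
      · intro x _ _
        have := poleOrder_nonneg 1 (x.out)⁻¹
        have := poleOrder_nonneg n (x.out)⁻¹
        simp only [hr]
        positivity
      · exact Finset.sdiff_subset
    have h2 : ∑ x, r x = (a + b) * (levelSubgroup n n).index := by
      rw [hr, Finset.sum_add_distrib, ← Finset.mul_sum, ← Finset.mul_sum,
        sum_poleOrder hn (Or.inl rfl), sum_poleOrder hn (Or.inr rfl)]
      ring
    have h3 : ((a + b) * (levelSubgroup n n).index : ℝ) < B := by exact_mod_cast hB
    linarith
  have hN0 : (N : ℍ → ℂ) = 0 :=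
    eq_zero_of_forall_SL_smul_eq N.2 hinv (hbound.trans_tendsto (tendsto_growth_of_neg hneg))
  have hN0' : N = 0 := Subtype.ext hN0
  rw [hN, Finset.prod_eq_zero_iff] at hN0'
  obtain ⟨x, -, hx⟩ := hN0'
  rw [mem_modularIdeal]
  intro τ
  have h1 := congrFun (congrArg Subtype.val hx) (x.out • τ)
  rw [hΦ_apply, inv_smul_smul, ← hw1] at h1
  exact h1

end Valence

section TruncatedExpansion

open Filter Topology Asymptotics MvPolynomial

variable {R S : Type*} [CommSemiring R] [CommSemiring S]

/-- A partial sum of `psiSeries`. -/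
def psiSum (B : ℕ) (x : R) : R := ∑ k ∈ Finset.range B, x ^ (k * (k + 1) / 2)

/-- The polynomial which agrees up to order `B` with the expansion of `w(τ)^i w(nτ)^j`, multiplied
by the `m`-th power of the denominators of `w(τ)` and `w(nτ)`. -/
def truncTerm (n m B i j : ℕ) (x : R) : R :=
  (x * psiSum B (x ^ 9)) ^ i * psiSum B x ^ (m - i) *
    ((x ^ n * psiSum B ((x ^ n) ^ 9)) ^ j * psiSum B (x ^ n) ^ (m - j))

lemma map_psiSum (f : R →+* S) (B : ℕ) (x : R) : f (psiSum B x) = psiSum B (f x) := by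
  simp [psiSum]

lemma map_truncTerm (f : R →+* S) (n m B i j : ℕ) (x : R) :
    f (truncTerm n m B i j x) = truncTerm n m B i j (f x) := by
  simp [truncTerm, map_psiSum]

/-- The truncated expansion of a polynomial in `w(τ)` and `w(nτ)`. -/
noncomputable def truncPoly (n m B : ℕ) : MvPolynomial (Fin 2) ℚ →ₗ[ℚ] Polynomial ℚ :=
  (basisMonomials (Fin 2) ℚ).constr ℚ fun d => truncTerm n m B (d 0) (d 1) Polynomial.X

lemma truncPoly_monomial (n m B : ℕ) (d : Fin 2 →₀ ℕ) (c : ℚ) :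
    truncPoly n m B (monomial d c) = c • truncTerm n m B (d 0) (d 1) Polynomial.X := by
  have h : monomial d c = c • basisMonomials (Fin 2) ℚ d := by
    rw [coe_basisMonomials, smul_monomial, smul_eq_mul, mul_one]
  rw [h, map_smul, truncPoly, Module.Basis.constr_basis]

/-- `u` and `v` are bounded at `i∞` and agree there up to order `B`. -/
def AgreeTo (B : ℕ) (u v : ℍ → ℂ) : Prop :=
  u =O[atImInfty] (fun _ => (1 : ℝ)) ∧ v =O[atImInfty] (fun _ => (1 : ℝ)) ∧
    (fun τ => u τ - v τ) =O[atImInfty] growth (-B)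

lemma AgreeTo.mul {B : ℕ} {u v u' v' : ℍ → ℂ} (h : AgreeTo B u v) (h' : AgreeTo B u' v') :
    AgreeTo B (fun τ => u τ * u' τ) (fun τ => v τ * v' τ) := by
  refine ⟨(h.1.mul h'.1).congr_right fun _ => one_mul _, (h.2.1.mul h'.2.1).congr_right fun _ => one_mul _, ?_⟩
  have h1 := (h.2.2.mul h'.1).congr_right fun τ => mul_one (growth (-B) τ)
  have h2 := (h.2.1.mul h'.2.2).congr_right fun τ => one_mul (growth (-B) τ)
  refine (h1.add h2).congr_left fun τ => ?_
  ring

lemma AgreeTo.pow {B : ℕ} {u v : ℍ → ℂ} (h : AgreeTo B u v) (k : ℕ) :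
    AgreeTo B (fun τ => u τ ^ k) (fun τ => v τ ^ k) := by
  induction k with
  | zero =>
    simp only [pow_zero]
    refine ⟨isBigO_const_const _ one_ne_zero _, isBigO_const_const _ one_ne_zero _, ?_⟩
    simpa using isBigO_zero _ _
  | succ k ih =>
    simp only [pow_succ]
    exact ih.mul h

lemma growth_neg_natCast (B : ℕ) : growth (-B) = fun τ : ℍ => ‖expTwoPi τ‖ ^ B := by
  funext τ
  rw [norm_expTwoPi, growth, ← Real.exp_nat_mul, coe_im]
  ring_nf

lemma tendsto_expTwoPi_pow {k : ℕ} (hk : 0 < k) :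
    Tendsto (fun τ : ℍ => expTwoPi τ ^ k) atImInfty (𝓝 0) := by
  have := tendsto_expTwoPi_atImInfty.pow k
  rwa [zero_pow hk.ne'] at this

lemma agreeTo_expTwoPi_pow {B k : ℕ} (hk : 0 < k) :
    AgreeTo B (fun τ => expTwoPi τ ^ k) (fun τ => expTwoPi τ ^ k) := by
  have := (tendsto_expTwoPi_pow hk).isBigO_one ℝ
  exact ⟨this, this, by simpa using isBigO_zero _ _⟩

lemma tendsto_psiSeries_expTwoPi_pow {k : ℕ} (hk : 0 < k) :
    Tendsto (fun τ : ℍ => psiSeries (expTwoPi τ ^ k)) atImInfty (𝓝 1) :=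
  tendsto_psiSeries.comp (tendsto_expTwoPi_pow hk)

lemma agreeTo_psiSeries {B k : ℕ} (hk : 0 < k) :
    AgreeTo B (fun τ => psiSeries (expTwoPi τ ^ k)) (fun τ => psiSum B (expTwoPi τ ^ k)) := by
  have h1 := (tendsto_psiSeries_expTwoPi_pow hk).isBigO_one ℝ
  have h3 : (fun τ : ℍ => psiSeries (expTwoPi τ ^ k) - psiSum B (expTwoPi τ ^ k)) =O[atImInfty]
      growth (-B) := by
    rw [growth_neg_natCast]
    refine IsBigO.of_bound 2 ?_
    have hsmall : ∀ᶠ τ : ℍ in atImInfty, ‖expTwoPi τ ^ k‖ < 1 / 2 :=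
      (tendsto_expTwoPi_pow hk).norm.eventually_lt_const (by simp)
    filter_upwards [hsmall] with τ hτ
    refine (norm_psiSeries_sub_le B hτ.le).trans ?_
    rw [norm_pow, norm_pow, norm_norm, ← pow_mul]
    have hq : ‖expTwoPi τ‖ ≤ 1 := (norm_expTwoPi_lt_one τ.im_pos).le
    have := pow_le_pow_of_le_one (norm_nonneg (expTwoPi τ)) hq (Nat.le_mul_of_pos_left B hk)
    linarith
  have hg : growth (-B) =O[atImInfty] (fun _ => (1 : ℝ)) := by
    have := growth_mono (r := -B) (s := 0) (by simp)
    refine this.congr_right fun τ => ?_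
    simp [growth]
  refine ⟨h1, ((h1.sub (h3.trans hg)).congr_left fun τ => ?_), h3⟩
  ring

lemma w_pow_mul_psiSeries_pow {τ : ℂ} (hτ : 0 < τ.im) {i m : ℕ} (hi : i ≤ m) :
    w τ ^ i * psiSeries (expTwoPi τ) ^ m =
      (expTwoPi τ * psiSeries (expTwoPi τ ^ 9)) ^ i * psiSeries (expTwoPi τ) ^ (m - i) := by
  rw [← w_mul_psiSeries hτ, mul_pow, mul_assoc, ← pow_add, Nat.add_sub_cancel' hi]

lemma agreeTo_monomial {n m B i j : ℕ} (hn : 0 < n) (hi : i ≤ m) (hj : j ≤ m) :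
    AgreeTo B
      (fun τ => w τ ^ i * w (n * τ) ^ j * (psiSeries (expTwoPi τ) ^ m * psiSeries (expTwoPi τ ^ n) ^ m))
      (fun τ => truncTerm n m B i j (expTwoPi τ)) := by
  have h1 : AgreeTo B (fun τ => expTwoPi τ) (fun τ => expTwoPi τ) := by
    simpa using agreeTo_expTwoPi_pow (B := B) one_pos
  have h2 : AgreeTo B (fun τ => psiSeries (expTwoPi τ)) (fun τ => psiSum B (expTwoPi τ)) := by
    simpa using agreeTo_psiSeries (B := B) one_pos
  have h3 := agreeTo_psiSeries (B := B) (k := 9) (by norm_num)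
  have h4 := agreeTo_expTwoPi_pow (B := B) hn
  have h5 := agreeTo_psiSeries (B := B) hn
  have h6 := agreeTo_psiSeries (B := B) (k := n * 9) (by omega)
  simp only [pow_mul] at h6
  have h := (((h1.mul h3).pow i).mul (h2.pow (m - i))).mul (((h4.mul h6).pow j).mul (h5.pow (m - j)))
  have heq (τ : ℍ) : w τ ^ i * w (n * τ) ^ j *
      (psiSeries (expTwoPi τ) ^ m * psiSeries (expTwoPi τ ^ n) ^ m) =
      (expTwoPi τ * psiSeries (expTwoPi τ ^ 9)) ^ i * psiSeries (expTwoPi τ) ^ (m - i) *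
      ((expTwoPi τ ^ n * psiSeries ((expTwoPi τ ^ n) ^ 9)) ^ j * psiSeries (expTwoPi τ ^ n) ^ (m - j)) := by
    have e1 := w_pow_mul_psiSeries_pow τ.im_pos hi
    have e2 := w_pow_mul_psiSeries_pow (natCast_mul_im_pos hn τ.im_pos) hj
    rw [expTwoPi_natCast_mul] at e2
    rw [← e1, ← e2]
    ring
  simp only [heq]
  exact h

theorem isBigO_aeval_sub_truncPoly {n m B : ℕ} (hn : 0 < n) {G : MvPolynomial (Fin 2) ℚ}
    (h0 : G.degreeOf 0 ≤ m) (h1 : G.degreeOf 1 ≤ m) :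
    (fun τ : ℍ => aeval ![w τ, w (n * τ)] G *
        (psiSeries (expTwoPi τ) ^ m * psiSeries (expTwoPi τ ^ n) ^ m) -
      Polynomial.aeval (expTwoPi τ) (truncPoly n m B G)) =O[atImInfty] growth (-B) := by
  have heq (τ : ℍ) : aeval ![w τ, w (n * τ)] G *
        (psiSeries (expTwoPi τ) ^ m * psiSeries (expTwoPi τ ^ n) ^ m) -
      Polynomial.aeval (expTwoPi τ) (truncPoly n m B G) =
      ∑ d ∈ G.support, ((G.coeff d : ℚ) : ℂ) * (w τ ^ d 0 * w (n * τ) ^ d 1 *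
        (psiSeries (expTwoPi τ) ^ m * psiSeries (expTwoPi τ ^ n) ^ m) -
        truncTerm n m B (d 0) (d 1) (expTwoPi τ)) := by
    have e1 : truncPoly n m B G = ∑ d ∈ G.support, G.coeff d •
        truncTerm n m B (d 0) (d 1) Polynomial.X := by
      conv_lhs => rw [← support_sum_monomial_coeff G]
      rw [map_sum]
      exact Finset.sum_congr rfl fun d _ => truncPoly_monomial n m B d _
    have e2 (d : Fin 2 →₀ ℕ) : Polynomial.aeval (expTwoPi τ)
        (truncTerm n m B (d 0) (d 1) (Polynomial.X : Polynomial ℚ)) =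
        truncTerm n m B (d 0) (d 1) (expTwoPi τ) := by
      have := map_truncTerm (Polynomial.aeval (R := ℚ) (expTwoPi (τ : ℂ))).toRingHom n m B (d 0) (d 1)
        Polynomial.X
      simpa using this
    rw [e1, map_sum, aeval_def, eval₂_eq', Finset.sum_mul, ← Finset.sum_sub_distrib]
    refine Finset.sum_congr rfl fun d _ => ?_
    rw [map_smul, e2, Fin.prod_univ_two, Algebra.smul_def]
    simp only [eq_ratCast, Matrix.cons_val_zero, Matrix.cons_val_one]
    ring
  simp only [heq]
  refine IsBigO.fun_sum fun d hd => IsBigO.const_mul_left ?_ _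
  exact (agreeTo_monomial hn ((degreeOf_le_iff.mp h0) d hd) ((degreeOf_le_iff.mp h1) d hd)).2.2

lemma tendsto_aeval_expTwoPi (p : Polynomial ℚ) :
    Tendsto (fun τ : ℍ => Polynomial.aeval (expTwoPi τ) p) atImInfty (𝓝 (p.coeff 0)) := by
  have h := (Polynomial.continuous_aeval (R := ℚ) (A := ℂ) p).tendsto 0
  have h2 : Polynomial.aeval (0 : ℂ) p = (p.coeff 0 : ℂ) := by
    rw [← Polynomial.coeff_zero_eq_aeval_zero', eq_ratCast]
  rw [h2] at h
  exact h.comp tendsto_expTwoPi_atImInfty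

lemma X_pow_dvd_iff_isBigO {p : Polynomial ℚ} {B : ℕ} : Polynomial.X ^ B ∣ p ↔
    (fun τ : ℍ => Polynomial.aeval (expTwoPi τ) p) =O[atImInfty] growth (-B) := by
  rw [growth_neg_natCast]
  constructor
  · rintro ⟨r, rfl⟩
    simp only [map_mul, map_pow, Polynomial.aeval_X]
    have h1 : (fun τ : ℍ => expTwoPi τ ^ B) =O[atImInfty] fun τ : ℍ => ‖expTwoPi τ‖ ^ B :=
      IsBigO.of_bound 1 (Eventually.of_forall fun τ => by simp)
    exact (h1.mul ((tendsto_aeval_expTwoPi r).isBigO_one ℝ)).congr_right fun τ => mul_one _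
  · intro h
    rw [Polynomial.X_pow_dvd_iff]
    intro d
    induction d using Nat.strong_induction_on with
    | _ d ih =>
    intro hd
    obtain ⟨r, rfl⟩ := Polynomial.X_pow_dvd_iff.mpr fun k hk => ih k hk (hk.trans hd)
    rw [Polynomial.coeff_X_pow_mul' , if_pos le_rfl, Nat.sub_self]
    have h1 : (fun τ : ℍ => Polynomial.aeval (expTwoPi τ) r) =O[atImInfty]
        fun τ : ℍ => ‖expTwoPi τ‖ ^ (B - d) := by
      have h2 : (fun τ : ℍ => (expTwoPi τ ^ d)⁻¹) =O[atImInfty] fun τ : ℍ => (‖expTwoPi τ‖ ^ d)⁻¹ :=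
        IsBigO.of_bound 1 (Eventually.of_forall fun τ => by simp)
      refine ((h.mul h2).congr_left fun τ => ?_).congr_right fun τ => ?_
      · have := pow_ne_zero d (expTwoPi_ne_zero (τ : ℂ))
        simp only [map_mul, map_pow, Polynomial.aeval_X]
        field_simp
      · have := pow_ne_zero d (norm_ne_zero_iff.mpr (expTwoPi_ne_zero (τ : ℂ)))
        rw [← div_eq_mul_inv, div_eq_iff this, ← pow_add, Nat.sub_add_cancel hd.le]
    have h3 : Tendsto (fun τ : ℍ => ‖expTwoPi τ‖ ^ (B - d)) atImInfty (𝓝 0) := by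
      have := (tendsto_expTwoPi_pow (k := B - d) (by omega)).norm
      simpa using this
    have h4 := tendsto_nhds_unique (tendsto_aeval_expTwoPi r) (h1.trans_tendsto h3)
    exact_mod_cast h4

lemma degreeOf_map_of_injective {f : R →+* S} (hf : Function.Injective f) {σ : Type*}
    (p : MvPolynomial σ R) (i : σ) : (map f p).degreeOf i = p.degreeOf i := by
  classical
  rw [degreeOf_eq_sup, degreeOf_eq_sup, support_map_of_injective _ hf]

/-- The rational relations between `w(τ)` and `w(nτ)`. -/
noncomputable def rationalIdeal (n : ℕ) (hn : 0 < n) : Ideal (MvPolynomial (Fin 2) ℚ) :=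
  (modularIdeal n hn).comap (MvPolynomial.map (algebraMap ℚ ℂ))

instance (n : ℕ) (hn : 0 < n) : (rationalIdeal n hn).IsPrime := Ideal.comap_isPrime _ _

lemma mem_rationalIdeal {n : ℕ} (hn : 0 < n) {G : MvPolynomial (Fin 2) ℚ} :
    G ∈ rationalIdeal n hn ↔ ∀ τ : ℍ, aeval ![w τ, w (n * τ)] G = 0 := by
  rw [rationalIdeal, Ideal.mem_comap, mem_modularIdeal]
  simp only [aeval_map_algebraMap]

lemma tendsto_psiSeries_denominator {n : ℕ} (hn : 0 < n) (m : ℕ) :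
    Tendsto (fun τ : ℍ => psiSeries (expTwoPi τ) ^ m * psiSeries (expTwoPi τ ^ n) ^ m) atImInfty (𝓝 1) := by
  have h1 := tendsto_psiSeries_expTwoPi_pow one_pos
  simp only [pow_one] at h1
  simpa using (h1.pow m).mul ((tendsto_psiSeries_expTwoPi_pow hn).pow m)

theorem mem_rationalIdeal_of_X_pow_dvd {n m B : ℕ} (hn : 0 < n) {G : MvPolynomial (Fin 2) ℚ}
    {a b : ℕ} (h0 : G.degreeOf 0 ≤ a) (h1 : G.degreeOf 1 ≤ b) (ha : a ≤ m) (hb : b ≤ m)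
    (hB : (a + b) * (levelSubgroup n n).index < B)
    (h : Polynomial.X ^ B ∣ truncPoly n m B G) : G ∈ rationalIdeal n hn := by
  have hdeg (i : Fin 2) : (map (algebraMap ℚ ℂ) G).degreeOf i = G.degreeOf i :=
    degreeOf_map_of_injective (algebraMap ℚ ℂ).injective G i
  refine mem_modularIdeal_of_isBigO hn ((hdeg 0).trans_le h0) ((hdeg 1).trans_le h1) hB ?_
  simp only [aeval_map_algebraMap]
  have h2 := (isBigO_aeval_sub_truncPoly (B := B) hn (h0.trans ha) (h1.trans hb)).add
    (X_pow_dvd_iff_isBigO.mp h)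
  simp only [sub_add_cancel] at h2
  have h3 := ((tendsto_psiSeries_denominator hn m).inv₀ one_ne_zero).isBigO_one ℝ
  have hne : ∀ᶠ τ : ℍ in atImInfty,
      psiSeries (expTwoPi τ) ^ m * psiSeries (expTwoPi τ ^ n) ^ m ≠ 0 :=
    (tendsto_psiSeries_denominator hn m).eventually_ne one_ne_zero
  refine ((h2.mul h3).congr_right fun τ => mul_one _).congr' ?_ EventuallyEq.rfl
  filter_upwards [hne] with τ hτ
  rw [mul_assoc, mul_inv_cancel₀ hτ, mul_one]

theorem X_pow_dvd_truncPoly {n m B : ℕ} (hn : 0 < n) {G : MvPolynomial (Fin 2) ℚ}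
    (h0 : G.degreeOf 0 ≤ m) (h1 : G.degreeOf 1 ≤ m) (hG : G ∈ rationalIdeal n hn) :
    Polynomial.X ^ B ∣ truncPoly n m B G := by
  rw [X_pow_dvd_iff_isBigO]
  have h2 := isBigO_aeval_sub_truncPoly (B := B) hn h0 h1
  simp only [(mem_rationalIdeal hn).mp hG, zero_mul, zero_sub] at h2
  simpa using h2.neg_left

/-- Linear algebra: a polynomial of bounded degrees whose expansion vanishes to order `B`. -/
theorem exists_X_pow_dvd_truncPoly (n m : ℕ) {a b B : ℕ} (h : B < (a + 1) * (b + 1)) :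
    ∃ G : MvPolynomial (Fin 2) ℚ, G ≠ 0 ∧ G.degreeOf 0 ≤ a ∧ G.degreeOf 1 ≤ b ∧
      Polynomial.X ^ B ∣ truncPoly n m B G := by
  set δ : Fin (a + 1) × Fin (b + 1) → (Fin 2 →₀ ℕ) := fun t =>
    Finsupp.equivFunOnFinite.symm ![(t.1 : ℕ), (t.2 : ℕ)] with hδ
  have hδ0 (t) : δ t 0 = t.1 := by simp [hδ]
  have hδ1 (t) : δ t 1 = t.2 := by simp [hδ]
  have hδ_inj : Function.Injective δ := by
    intro t t' htt
    have e0 := hδ0 t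
    have e1 := hδ1 t
    rw [htt, hδ0] at e0
    rw [htt, hδ1] at e1
    exact Prod.ext (Fin.ext e0.symm) (Fin.ext e1.symm)
  set P : (Fin (a + 1) × Fin (b + 1) → ℚ) →ₗ[ℚ] MvPolynomial (Fin 2) ℚ :=
    ∑ t, (monomial (δ t)).comp (LinearMap.proj t) with hP
  have hP_apply (c) : P c = ∑ t, monomial (δ t) (c t) := by simp [hP]
  have hP_coeff (c) (t) : coeff (δ t) (P c) = c t := by
    classical
    rw [hP_apply, coeff_sum, Finset.sum_eq_single t]
    · rw [coeff_monomial, if_pos rfl]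
    · intro s _ hst
      rw [coeff_monomial, if_neg fun h => hst (hδ_inj h)]
    · simp
  set Λ : (Fin (a + 1) × Fin (b + 1) → ℚ) →ₗ[ℚ] (Fin B → ℚ) :=
    LinearMap.pi fun k => (Polynomial.lcoeff ℚ k).comp ((truncPoly n m B).comp P) with hΛ
  have hker : LinearMap.ker Λ ≠ ⊥ := by
    apply LinearMap.ker_ne_bot_of_finrank_lt
    simpa using h
  obtain ⟨c, hc, hc0⟩ := Submodule.exists_mem_ne_zero_of_ne_bot hker
  refine ⟨P c, ?_, ?_, ?_, ?_⟩
  · intro h0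
    refine hc0 (funext fun t => ?_)
    rw [← hP_coeff c t, h0, coeff_zero, Pi.zero_apply]
  · rw [hP_apply]
    refine (degreeOf_sum_le _ _ _).trans (Finset.sup_le fun t _ => ?_)
    refine degreeOf_le_iff.mpr fun d hd => ?_
    rw [Finset.mem_singleton.mp (support_monomial_subset hd), hδ0]
    omega
  · rw [hP_apply]
    refine (degreeOf_sum_le _ _ _).trans (Finset.sup_le fun t _ => ?_)
    refine degreeOf_le_iff.mpr fun d hd => ?_
    rw [Finset.mem_singleton.mp (support_monomial_subset hd), hδ1]
    omega
  · rw [Polynomial.X_pow_dvd_iff]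
    intro k hk
    have := congrFun (LinearMap.mem_ker.mp hc) ⟨k, hk⟩
    simpa [hΛ] using this

theorem index_le_degreeOf {n : ℕ} (hn : 0 < n) {G : MvPolynomial (Fin 2) ℚ}
    (hG : G ∈ rationalIdeal n hn) (hG0 : G ≠ 0) :
    (levelSubgroup n n).index ≤ G.degreeOf 0 ∧ (levelSubgroup n n).index ≤ G.degreeOf 1 := by
  have hdeg (i : Fin 2) : (map (algebraMap ℚ ℂ) G).degreeOf i = G.degreeOf i :=
    degreeOf_map_of_injective (algebraMap ℚ ℂ).injective G i
  have hne : map (algebraMap ℚ ℂ) G ≠ 0 := by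
    rwa [Ne, map_eq_zero_iff _ (map_injective _ (algebraMap ℚ ℂ).injective)]
  rw [← hdeg 0, ← hdeg 1]
  exact ⟨index_le_degreeOf_zero hn hG hne, index_le_degreeOf_one hn hG hne⟩

/-- Existence of the modular equation with rational coefficients. -/
theorem exists_mem_rationalIdeal {n : ℕ} (hn : 0 < n) :
    ∃ F ∈ rationalIdeal n hn, F ≠ 0 ∧ F.degreeOf 0 ≤ (levelSubgroup n n).index ∧
      F.degreeOf 1 ≤ (levelSubgroup n n).index := by
  set D := (levelSubgroup n n).index with hD
  have hD0 : 0 < D := Nat.pos_of_ne_zero (index_levelSubgroup_ne_zero hn)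
  have hcount : (D + D ^ 2) * D + 1 < (D + 1) * (D ^ 2 + 1) := by
    have : (D + 1) * (D ^ 2 + 1) = (D + D ^ 2) * D + 1 + D := by ring
    omega
  obtain ⟨A, hA0, hA1, hA2, hA3⟩ := exists_X_pow_dvd_truncPoly n (D + D ^ 2) hcount
  obtain ⟨B, hB0, hB1, hB2, hB3⟩ := exists_X_pow_dvd_truncPoly n (D + D ^ 2)
    (a := D ^ 2) (b := D) (B := (D ^ 2 + D) * D + 1) (by rw [add_comm (D ^ 2) D, mul_comm (D ^ 2 + 1)]; exact hcount)
  refine exists_degreeOf_le inferInstance hD0 (fun G hG hG0 => (index_le_degreeOf hn hG hG0).1)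
    (mem_rationalIdeal_of_X_pow_dvd hn hA1 hA2 (by omega) (by omega) (Nat.lt_succ_self _) hA3) hA0 hA1
    (mem_rationalIdeal_of_X_pow_dvd hn hB1 hB2 (by omega) (by omega) (Nat.lt_succ_self _) hB3) hB0 hB2

/-- A relation of small degree is the modular equation. -/
theorem modularEquation_of_mem {n : ℕ} (hn : 0 < n) {F : MvPolynomial (Fin 2) ℚ}
    (hF : F ∈ rationalIdeal n hn) (hF0 : F ≠ 0) (h0 : F.degreeOf 0 ≤ (levelSubgroup n n).index)
    (h1 : F.degreeOf 1 ≤ (levelSubgroup n n).index) :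
    Irreducible F ∧ IsModularEquation n F ∧ F.degreeOf 0 = (levelSubgroup n n).index ∧
      F.degreeOf 1 = (levelSubgroup n n).index := by
  have hdeg (i : Fin 2) : (map (algebraMap ℚ ℂ) F).degreeOf i = F.degreeOf i :=
    degreeOf_map_of_injective (algebraMap ℚ ℂ).injective F i
  have hne : map (algebraMap ℚ ℂ) F ≠ 0 := by
    rwa [Ne, map_eq_zero_iff _ (map_injective _ (algebraMap ℚ ℂ).injective)]
  have hlow := index_le_degreeOf hn hF hF0
  refine ⟨?_, ⟨?_, (mem_rationalIdeal hn).mp hF⟩, le_antisymm h0 hlow.1, le_antisymm h1 hlow.2⟩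
  · exact irreducible_of_degreeOf_le inferInstance (fun G hG hG0 => (index_le_degreeOf hn hG hG0).1)
      (fun G hG hG0 => (index_le_degreeOf hn hG hG0).2) hF hF0 h0 h1
  · exact irreducible_of_degreeOf_le (I := modularIdeal n hn) inferInstance
      (fun G hG hG0 => index_le_degreeOf_zero hn hG hG0)
      (fun G hG hG0 => index_le_degreeOf_one hn hG hG0) hF hne ((hdeg 0).trans_le h0)
      ((hdeg 1).trans_le h1)

end TruncatedExpansion

section Kronecker

open Polynomial

lemma Polynomial.coeff_le_eval_one (p : ℕ[X]) (k : ℕ) : p.coeff k ≤ p.eval 1 := by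
  rw [eval_eq_sum_range]
  by_cases hk : k ∈ Finset.range (p.natDegree + 1)
  · simpa using Finset.single_le_sum (f := fun i => p.coeff i * 1 ^ i) (fun i _ => Nat.zero_le _) hk
  · rw [coeff_eq_zero_of_natDegree_lt (by simpa using hk)]
    exact Nat.zero_le _

/-- The low coefficients of two polynomials over `ℕ` can be compared by evaluating at a large
integer. -/
theorem Polynomial.eval_modEq_iff (p r : ℕ[X]) (B : ℕ) :
    p.eval (p.eval 1 + r.eval 1 + 1) ≡ r.eval (p.eval 1 + r.eval 1 + 1)
      [MOD (p.eval 1 + r.eval 1 + 1) ^ B] ↔ ∀ k < B, p.coeff k = r.coeff k := by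
  set Q := p.eval 1 + r.eval 1 + 1 with hQ
  set s : ℤ[X] := r.map (Nat.castRingHom ℤ) - p.map (Nat.castRingHom ℤ) with hs
  have hcoeff (k : ℕ) : s.coeff k = r.coeff k - p.coeff k := by simp [hs]
  have heval : s.eval (Q : ℤ) = (r.eval Q : ℕ) - (p.eval Q : ℕ) := by
    rw [hs, eval_sub]
    congr 1
    · exact (eval_natCast_map (Nat.castRingHom ℤ) r Q)
    · exact (eval_natCast_map (Nat.castRingHom ℤ) p Q)
  have hsmall (k : ℕ) (hdvd : (Q : ℤ) ∣ s.coeff k) : s.coeff k = 0 := by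
    refine Int.eq_zero_of_abs_lt_dvd hdvd ?_
    have h1 := p.coeff_le_eval_one k
    have h2 := r.coeff_le_eval_one k
    rw [hcoeff, abs_lt]
    omega
  have hiff : (∀ k < B, p.coeff k = r.coeff k) ↔ X ^ B ∣ s := by
    rw [X_pow_dvd_iff]
    refine forall₂_congr fun k _ => ?_
    rw [hcoeff, sub_eq_zero, eq_comm]
    norm_cast
  rw [hiff, Nat.modEq_iff_dvd, ← heval]
  push_cast
  constructor
  · intro h
    rw [X_pow_dvd_iff]
    intro d
    induction d using Nat.strong_induction_on with
    | _ d ih =>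
    intro hd
    obtain ⟨t, ht⟩ := X_pow_dvd_iff.mpr fun k hk => ih k hk (hk.trans hd)
    apply hsmall
    have hc : s.coeff d = t.coeff 0 := by
      rw [ht, coeff_X_pow_mul', if_pos le_rfl, Nat.sub_self]
    rw [hc]
    have h1 : (Q : ℤ) ∣ t.eval (Q : ℤ) := by
      have h2 : (Q : ℤ) ^ (d + 1) ∣ s.eval (Q : ℤ) := (pow_dvd_pow _ hd).trans h
      rw [ht, eval_mul, eval_pow, eval_X, pow_succ] at h2
      exact (mul_dvd_mul_iff_left (pow_ne_zero _ (by omega))).mp h2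
    have h3 : (Q : ℤ) - 0 ∣ t.eval (Q : ℤ) - t.eval 0 := sub_dvd_eval_sub _ _ t
    rw [sub_zero] at h3
    rw [coeff_zero_eq_eval_zero]
    exact (dvd_sub_right h1).mp h3
  · rintro ⟨t, ht⟩
    rw [ht, eval_mul, eval_pow, eval_X]
    exact Dvd.intro _ rfl

end Kronecker

section TermLists

open MvPolynomial

variable {R S : Type*} [CommSemiring R] [CommSemiring S]

/-- The value at `(a : b), (c : d)` of the bihomogeneous polynomial of degree `m` in each pair of
variables with the list of terms `L`; the entry `(i, j, k)` stands for `k X^i Y^j`. -/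
def termSum (m : ℕ) (a b c d : R) (L : List (ℕ × ℕ × ℕ)) : R :=
  (L.map fun t => (t.2.2 : R) * (a ^ t.1 * b ^ (m - t.1) * (c ^ t.2.1 * d ^ (m - t.2.1)))).sum

/-- The truncated expansion of the polynomial in `w(τ)` and `w(nτ)` with the list of terms `L`. -/
def expansionSum (n m B : ℕ) (x : R) (L : List (ℕ × ℕ × ℕ)) : R :=
  termSum m (x * psiSum B (x ^ 9)) (psiSum B x) (x ^ n * psiSum B ((x ^ n) ^ 9)) (psiSum B (x ^ n)) L

lemma map_termSum (f : R →+* S) (m : ℕ) (a b c d : R) (L : List (ℕ × ℕ × ℕ)) :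
    f (termSum m a b c d L) = termSum m (f a) (f b) (f c) (f d) L := by
  rw [termSum, termSum, map_list_sum, List.map_map]
  congr 1
  refine List.map_congr_left fun t _ => ?_
  simp

lemma map_expansionSum (f : R →+* S) (n m B : ℕ) (x : R) (L : List (ℕ × ℕ × ℕ)) :
    f (expansionSum n m B x L) = expansionSum n m B (f x) L := by
  simp [expansionSum, map_termSum, map_psiSum]

/-- The polynomial with the list of terms `L`. -/
noncomputable def natPoly (L : List (ℕ × ℕ × ℕ)) : MvPolynomial (Fin 2) ℚ :=
  (L.map fun t => C (t.2.2 : ℚ) * X 0 ^ t.1 * X 1 ^ t.2.1).sum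

/-- The list of the terms in `P`, and of those in `N` with a minus sign. -/
def signedTerms (P N : List (ℕ × ℕ × ℕ)) : List (ℕ × ℕ × ℤ × ℕ) :=
  (P.map fun t => (t.1, t.2.1, (t.2.2 : ℤ), 1)) ++ N.map fun t => (t.1, t.2.1, -(t.2.2 : ℤ), 1)

lemma polyOfTerms_signedTerms (P N : List (ℕ × ℕ × ℕ)) :
    polyOfTerms (signedTerms P N) = natPoly P - natPoly N := by
  rw [polyOfTerms, signedTerms, List.map_append, List.sum_append, List.map_map, List.map_map, natPoly,
    natPoly, sub_eq_add_neg]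
  congr 1
  · congr 1
    refine List.map_congr_left fun t _ => ?_
    simp
  · induction N with
    | nil => simp
    | cons t N ih =>
      rw [List.map_cons, List.map_cons, List.sum_cons, List.sum_cons, ih, neg_add]
      simp

lemma term_eq_monomial (i j : ℕ) (c : ℚ) : (C c * X 0 ^ i * X 1 ^ j : MvPolynomial (Fin 2) ℚ) =
    monomial (Finsupp.single 0 i + Finsupp.single 1 j) c := by
  rw [monomial_eq, Finsupp.prod_add_index' (by simp) (by intros; rw [pow_add])]
  simp [mul_assoc]

lemma truncPoly_natPoly (n m B : ℕ) (L : List (ℕ × ℕ × ℕ)) :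
    truncPoly n m B (natPoly L) = expansionSum n m B (Polynomial.X : Polynomial ℚ) L := by
  rw [natPoly, map_list_sum, List.map_map, expansionSum, termSum]
  congr 1
  refine List.map_congr_left fun t _ => ?_
  rw [Function.comp_apply, term_eq_monomial, truncPoly_monomial, Polynomial.smul_eq_C_mul]
  simp [truncTerm]

lemma eval_natPoly (m : ℕ) (x y : ℕ) (L : List (ℕ × ℕ × ℕ)) :
    eval ![(x : ℚ), (y : ℚ)] (natPoly L) = (termSum m x 1 y 1 L : ℕ) := by
  rw [natPoly, map_list_sum, List.map_map, ← Nat.coe_castRingHom, map_termSum, termSum]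
  congr 1
  refine List.map_congr_left fun t _ => ?_
  simp
  ring

lemma degreeOf_natPoly_le {m : ℕ} {L : List (ℕ × ℕ × ℕ)} (hL : ∀ t ∈ L, t.1 ≤ m ∧ t.2.1 ≤ m)
    (i : Fin 2) : (natPoly L).degreeOf i ≤ m := by
  induction L with
  | nil => simp [natPoly]
  | cons t L ih =>
    have h1 : natPoly (t :: L) = C (t.2.2 : ℚ) * X 0 ^ t.1 * X 1 ^ t.2.1 + natPoly L := by
      simp [natPoly]
    rw [h1]
    refine (degreeOf_add_le _ _ _).trans (max_le ?_ (ih fun s hs => hL s (by simp [hs])))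
    rw [term_eq_monomial]
    refine degreeOf_le_iff.mpr fun d hd => ?_
    rw [Finset.mem_singleton.mp (support_monomial_subset hd)]
    have := hL t (by simp)
    fin_cases i
    · simpa using this.1
    · simpa using this.2

/-- The test by which the truncated expansion of `natPoly P - natPoly N` is seen to vanish. -/
theorem expansionSum_modEq_iff (n m B : ℕ) (P N : List (ℕ × ℕ × ℕ)) :
    expansionSum n m B (expansionSum n m B 1 P + expansionSum n m B 1 N + 1) P ≡
      expansionSum n m B (expansionSum n m B 1 P + expansionSum n m B 1 N + 1) N
      [MOD (expansionSum n m B 1 P + expansionSum n m B 1 N + 1) ^ B] ↔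
      Polynomial.X ^ B ∣ truncPoly n m B (natPoly P - natPoly N) := by
  have heval (L : List (ℕ × ℕ × ℕ)) (x : ℕ) :
      (expansionSum n m B (Polynomial.X : Polynomial ℕ) L).eval x = expansionSum n m B x L := by
    rw [← Polynomial.coe_evalRingHom, map_expansionSum, Polynomial.coe_evalRingHom, Polynomial.eval_X]
  have hmap (L : List (ℕ × ℕ × ℕ)) : expansionSum n m B (Polynomial.X : Polynomial ℚ) L =
      (expansionSum n m B (Polynomial.X : Polynomial ℕ) L).map (Nat.castRingHom ℚ) := by
    rw [← Polynomial.coe_mapRingHom, map_expansionSum, Polynomial.coe_mapRingHom, Polynomial.map_X]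
  have h := Polynomial.eval_modEq_iff (expansionSum n m B Polynomial.X P)
    (expansionSum n m B Polynomial.X N) B
  simp only [heval] at h
  rw [h, map_sub, truncPoly_natPoly, truncPoly_natPoly, Polynomial.X_pow_dvd_iff, hmap, hmap]
  refine forall₂_congr fun k _ => ?_
  rw [Polynomial.coeff_sub, Polynomial.coeff_map, Polynomial.coeff_map, sub_eq_zero]
  simp

/-- Every polynomial has a multiple given by lists of terms with coefficients in `ℕ`. -/
theorem exists_natPoly_sub_eq (F : MvPolynomial (Fin 2) ℚ) : ∃ (P N : List (ℕ × ℕ × ℕ)) (c : ℚ), c ≠ 0 ∧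
    natPoly P - natPoly N = C c * F ∧ (∀ t ∈ P ++ N, t.1 ≤ F.degreeOf 0 ∧ t.2.1 ≤ F.degreeOf 1) := by
  obtain ⟨b, hb⟩ := IsLocalization.exist_integer_multiples (nonZeroDivisors ℤ) F.support
    (fun d => F.coeff d)
  have hz (d : Fin 2 →₀ ℕ) : ∃ z : ℤ, d ∈ F.support → (z : ℚ) = (b : ℤ) * F.coeff d := by
    by_cases hd : d ∈ F.support
    · obtain ⟨z, hz⟩ := hb d hd
      exact ⟨z, fun _ => by simpa using hz⟩
    · exact ⟨0, fun h => absurd h hd⟩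
  choose z hz using hz
  have hsum (u : (Fin 2 →₀ ℕ) → ℕ) : natPoly (F.support.toList.map fun d => (d 0, d 1, u d)) =
      ∑ d ∈ F.support, C (u d : ℚ) * X 0 ^ d 0 * X 1 ^ d 1 := by
    rw [natPoly, List.map_map, ← Finset.sum_map_toList]
    rfl
  refine ⟨F.support.toList.map fun d => (d 0, d 1, (z d).toNat),
    F.support.toList.map fun d => (d 0, d 1, (-z d).toNat), (b : ℤ), ?_, ?_, ?_⟩
  · exact_mod_cast nonZeroDivisors.ne_zero b.2
  · rw [hsum, hsum, ← Finset.sum_sub_distrib]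
    conv_rhs => rw [← support_sum_monomial_coeff F, Finset.mul_sum]
    refine Finset.sum_congr rfl fun d hd => ?_
    rw [← sub_mul, ← sub_mul, ← C_sub, term_eq_monomial, C_mul_monomial, ← hz d hd]
    congr 2
    · ext i
      fin_cases i <;> simp
    · have := Int.toNat_sub_toNat_neg (z d)
      exact_mod_cast this
  · intro t ht
    simp only [List.mem_append, List.mem_map, Finset.mem_toList] at ht
    rcases ht with ⟨d, hd, rfl⟩ | ⟨d, hd, rfl⟩ <;>
    exact ⟨degreeOf_le_iff.mp le_rfl d hd, degreeOf_le_iff.mp le_rfl d hd⟩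

lemma exists_eval_natCast_ne_zero {F : MvPolynomial (Fin 2) ℚ} (hF : F ≠ 0) :
    ∃ x y : ℕ, eval ![(x : ℚ), (y : ℚ)] F ≠ 0 := by
  by_contra! h
  refine hF (funext_set (fun _ => Set.range ((↑) : ℕ → ℚ))
    (fun _ => Set.infinite_range_of_injective Nat.cast_injective) fun v hv => ?_)
  obtain ⟨x, hx⟩ := hv 0 (Set.mem_univ _)
  obtain ⟨y, hy⟩ := hv 1 (Set.mem_univ _)
  have : v = ![(x : ℚ), (y : ℚ)] := by
    funext i
    fin_cases i
    · exact hx.symm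
    · exact hy.symm
  rw [this, h, map_zero]

end TermLists

section CosetRows

open CongruenceSubgroup

/-- The entries `(a, b, c, d, u)` with `u = ±1` modulo `n` of the matrix `(a, ub; 18uc, d)` in
`Γ₀(18)`. -/
def IsCosetRow (n : ℕ) (r : ℕ × ℕ × ℕ × ℕ × ℕ) : Prop :=
  r.1 * r.2.2.2.1 = 1 + 18 * r.2.1 * r.2.2.1 ∧ (r.2.2.2.2 = 1 ∨ r.2.2.2.2 + 1 = n)

/-- Two rows give the same coset. -/
def CosetRowEquiv (n : ℕ) (r s : ℕ × ℕ × ℕ × ℕ × ℕ) : Prop :=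
  r.2.2.2.1 * (s.2.1 * s.2.2.2.2) % n = r.2.1 * r.2.2.2.2 * s.2.2.2.1 % n

/-- The matrix `γ` has the lower right entry of `r`, and its upper right entry modulo `n`. -/
def Represents (n : ℕ) (r : ℕ × ℕ × ℕ × ℕ × ℕ) (γ : Gamma0 18) : Prop :=
  (γ : SL(2, ℤ)) 1 1 = r.2.2.2.1 ∧ (n : ℤ) ∣ (γ : SL(2, ℤ)) 0 1 - (r.2.1 * r.2.2.2.2 : ℕ)

lemma IsCosetRow.exists_represents {n : ℕ} {r : ℕ × ℕ × ℕ × ℕ × ℕ} (hr : IsCosetRow n r) :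
    ∃ γ, Represents n r γ := by
  obtain ⟨a, b, c, d, u⟩ := r
  obtain ⟨h1, h2⟩ := hr
  have h1' : (a * d : ℤ) = 1 + 18 * b * c := by exact_mod_cast h1
  rcases h2 with h2 | h2
  · simp only at h2
    have hM : (!![(a : ℤ), b; 18 * c, d]).det = 1 := by
      rw [Matrix.det_fin_two_of, h1']
      ring
    refine ⟨⟨(⟨!![(a : ℤ), b; 18 * c, d], hM⟩ : SL(2, ℤ)), ?_⟩, ?_, ?_⟩
    · refine Gamma0_mem.mpr ((ZMod.intCast_zmod_eq_zero_iff_dvd _ _).mpr ?_)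
      simp
    · simp
    · simp [h2]
  · simp only at h2
    have hM : (!![(a : ℤ), -b; -(18 * c), d]).det = 1 := by
      rw [Matrix.det_fin_two_of, h1']
      ring
    refine ⟨⟨(⟨!![(a : ℤ), -b; -(18 * c), d], hM⟩ : SL(2, ℤ)), ?_⟩, ?_, ?_⟩
    · refine Gamma0_mem.mpr ((ZMod.intCast_zmod_eq_zero_iff_dvd _ _).mpr ?_)
      simp
    · simp
    · refine ⟨-b, ?_⟩
      subst h2
      simp
      ring

lemma cosetRowEquiv_iff {n : ℕ} {r s : ℕ × ℕ × ℕ × ℕ × ℕ} {γ δ : Gamma0 18}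
    (hγ : Represents n r γ) (hδ : Represents n s δ) :
    CosetRowEquiv n r s ↔ (QuotientGroup.mk γ : Gamma0 18 ⧸ levelSubgroup n n) = QuotientGroup.mk δ := by
  rw [mk_eq_mk_levelSubgroup_iff, CosetRowEquiv, eq_comm, ← Nat.ModEq, Nat.modEq_iff_dvd]
  obtain ⟨hγ1, x, hγ2⟩ := hγ
  obtain ⟨hδ1, y, hδ2⟩ := hδ
  rw [hγ1, hδ1]
  refine (dvd_iff_dvd_of_dvd_sub ⟨x * s.2.2.2.1 - r.2.2.2.1 * y, ?_⟩)
  push_cast at hγ2 hδ2 ⊢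
  linear_combination (s.2.2.2.1 : ℤ) * hγ2 - (r.2.2.2.1 : ℤ) * hδ2

lemma exists_isCosetRow {n : ℕ} (hn : 0 < n) (γ : Gamma0 18) : ∃ r, IsCosetRow n r ∧
    ∀ δ, Represents n r δ →
      (QuotientGroup.mk δ : Gamma0 18 ⧸ levelSubgroup n n) = QuotientGroup.mk γ := by
  have hdet := (γ : SL(2, ℤ)).det_coe
  rw [Matrix.det_fin_two] at hdet
  obtain ⟨z, hz⟩ : (18 : ℤ) ∣ (γ : SL(2, ℤ)) 1 0 := by
    have := γ.2
    rw [Gamma0_mem, ZMod.intCast_zmod_eq_zero_iff_dvd] at this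
    exact_mod_cast this
  set b := (γ : SL(2, ℤ)) 0 1 with hb
  set d := (γ : SL(2, ℤ)) 1 1 with hd
  have hcop : IsCoprime d (18 * b) := ⟨(γ : SL(2, ℤ)) 0 0, -z, by
    rw [hz] at hdet
    linear_combination hdet⟩
  have hcop' : d.natAbs.Coprime (18 * b.natAbs) := by
    simpa [Int.natAbs_mul] using Int.isCoprime_iff_nat_coprime.mp hcop
  obtain ⟨a, c, hac⟩ : ∃ a c : ℕ, a * d.natAbs = 1 + 18 * b.natAbs * c := by
    rcases Nat.eq_zero_or_pos b.natAbs with h0 | h0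
    · rw [h0] at hcop' ⊢
      exact ⟨1, 0, by simpa using hcop'⟩
    · obtain ⟨a, -, ha⟩ := Nat.exists_mul_mod_eq_one_of_coprime hcop' (by omega)
      refine ⟨a, d.natAbs * a / (18 * b.natAbs), ?_⟩
      rw [mul_comm a, ← ha, Nat.mod_add_div]
  have hsign : ∃ e : ℤ, (e = 1 ∨ e = -1) ∧ (d.natAbs : ℤ) = e * d := by
    rcases Int.natAbs_eq d with h | h
    · exact ⟨1, Or.inl rfl, by omega⟩
    · exact ⟨-1, Or.inr rfl, by omega⟩
  obtain ⟨e, he, hde⟩ := hsign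
  obtain ⟨u, hu, hbu⟩ : ∃ u : ℕ, (u = 1 ∨ u + 1 = n) ∧ (n : ℤ) ∣ (b.natAbs * u : ℕ) - e * b := by
    have hb' : (b.natAbs : ℤ) = e * b ∨ (b.natAbs : ℤ) = - (e * b) := by
      rcases he with rfl | rfl <;> omega
    rcases hb' with h | h
    · exact ⟨1, Or.inl rfl, by simp [h]⟩
    · refine ⟨n - 1, Or.inr (by omega), -(e * b), ?_⟩
      push_cast [h, Nat.cast_sub hn]
      ring
  refine ⟨(a, b.natAbs, c, d.natAbs, u), ⟨hac, hu⟩, fun δ hδ => ?_⟩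
  obtain ⟨h1, h2⟩ := hδ
  rw [mk_eq_mk_levelSubgroup_iff, h1, ← hb, ← hd]
  obtain ⟨x, hx⟩ := hbu
  obtain ⟨y, hy⟩ := h2
  refine ⟨-d * (x + y), ?_⟩
  simp only at hy ⊢
  rw [hde]
  linear_combination -d * hx - d * hy

end CosetRows

section Certificates

open CongruenceSubgroup MvPolynomial

/-- The data by which `natPoly P - natPoly N` is seen to be a modular equation of level `n`: the
rows `R` give a lower bound for the index of `levelSubgroup n n`, the expansion of
`natPoly P - natPoly N` vanishes to high order, and its value at `(x, y)` is not zero. -/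
structure IsCertificate (n : ℕ) (P N : List (ℕ × ℕ × ℕ)) (R : List (ℕ × ℕ × ℕ × ℕ × ℕ)) (x y : ℕ) :
    Prop where
  exponents_le : ∀ t ∈ P ++ N, t.1 ≤ R.length ∧ t.2.1 ≤ R.length
  eval_ne : termSum R.length x 1 y 1 P ≠ termSum R.length x 1 y 1 N
  modEq : expansionSum n R.length (2 * R.length * n ^ 2 + 1)
      (expansionSum n R.length (2 * R.length * n ^ 2 + 1) 1 P +
        expansionSum n R.length (2 * R.length * n ^ 2 + 1) 1 N + 1) P ≡
    expansionSum n R.length (2 * R.length * n ^ 2 + 1)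
      (expansionSum n R.length (2 * R.length * n ^ 2 + 1) 1 P +
        expansionSum n R.length (2 * R.length * n ^ 2 + 1) 1 N + 1) N
    [MOD (expansionSum n R.length (2 * R.length * n ^ 2 + 1) 1 P +
        expansionSum n R.length (2 * R.length * n ^ 2 + 1) 1 N + 1) ^ (2 * R.length * n ^ 2 + 1)]
  rows : ∀ r ∈ R, IsCosetRow n r
  rows_inequivalent : ∀ i < R.length, ∀ j < R.length,
    CosetRowEquiv n (R.getD i (0, 0, 0, 0, 0)) (R.getD j (0, 0, 0, 0, 0)) → i = j

theorem length_le_index_levelSubgroup {n : ℕ} (hn : 0 < n) {R : List (ℕ × ℕ × ℕ × ℕ × ℕ)}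
    (hR : ∀ r ∈ R, IsCosetRow n r) (hR' : ∀ i < R.length, ∀ j < R.length,
      CosetRowEquiv n (R.getD i (0, 0, 0, 0, 0)) (R.getD j (0, 0, 0, 0, 0)) → i = j) :
    R.length ≤ (levelSubgroup n n).index := by
  have : Finite (Gamma0 18 ⧸ levelSubgroup n n) := finite_quotient_levelSubgroup hn (Or.inr rfl)
  choose γ hγ using fun i : Fin R.length => (hR (R.getD i (0, 0, 0, 0, 0)) (by
    rw [List.getD_eq_getElem _ _ i.2]
    exact List.getElem_mem i.2)).exists_represents
  have hinj : Function.Injective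
      fun i => (QuotientGroup.mk (γ i) : Gamma0 18 ⧸ levelSubgroup n n) := fun i j hij =>
    Fin.ext (hR' i i.2 j j.2 ((cosetRowEquiv_iff (hγ i) (hγ j)).mpr hij))
  simpa [Subgroup.index] using Nat.card_le_card_of_injective _ hinj

theorem IsCertificate.modularEquation {n : ℕ} (hn : 0 < n) {P N : List (ℕ × ℕ × ℕ)}
    {R : List (ℕ × ℕ × ℕ × ℕ × ℕ)} {x y : ℕ} (h : IsCertificate n P N R x y) :
    Irreducible (natPoly P - natPoly N) ∧ IsModularEquation n (natPoly P - natPoly N) ∧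
      (natPoly P - natPoly N).degreeOf 0 = (levelSubgroup n n).index ∧
      (natPoly P - natPoly N).degreeOf 1 = (levelSubgroup n n).index := by
  have hm := length_le_index_levelSubgroup hn h.rows h.rows_inequivalent
  have hdeg (i : Fin 2) : (natPoly P - natPoly N).degreeOf i ≤ R.length := by
    refine (degreeOf_sub_le _ _ _).trans (max_le ?_ ?_)
    · exact degreeOf_natPoly_le (fun t ht => h.exponents_le t (List.mem_append_left _ ht)) i
    · exact degreeOf_natPoly_le (fun t ht => h.exponents_le t (List.mem_append_right _ ht)) i
  refine modularEquation_of_mem hn ?_ ?_ ((hdeg 0).trans hm) ((hdeg 1).trans hm)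
  · refine mem_rationalIdeal_of_X_pow_dvd hn (hdeg 0) (hdeg 1) le_rfl le_rfl ?_
      ((expansionSum_modEq_iff _ _ _ _ _).mp h.modEq)
    rw [Nat.lt_succ_iff, ← two_mul]
    exact Nat.mul_le_mul_left _ (index_levelSubgroup_le hn)
  · intro h0
    have h1 := congrArg (eval ![(x : ℚ), (y : ℚ)]) h0
    rw [map_sub, map_zero, eval_natPoly R.length, eval_natPoly R.length, sub_eq_zero] at h1
    exact h.eval_ne (by exact_mod_cast h1)

theorem exists_isCertificate {n : ℕ} (hn : 0 < n) : ∃ P N R x y, IsCertificate n P N R x y := by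
  have : Finite (Gamma0 18 ⧸ levelSubgroup n n) := finite_quotient_levelSubgroup hn (Or.inr rfl)
  obtain ⟨F, hF, hF0, h0, h1⟩ := exists_mem_rationalIdeal hn
  obtain ⟨P, N, c, hc, hPN, hexp⟩ := exists_natPoly_sub_eq F
  have hne : C c * F ≠ 0 := mul_ne_zero (by simpa using hc) hF0
  obtain ⟨x, y, hxy⟩ := exists_eval_natCast_ne_zero hne
  choose row hrow hrow' using exists_isCosetRow hn
  have : Fintype (Gamma0 18 ⧸ levelSubgroup n n) := Fintype.ofFinite _
  let R := (List.finRange (Fintype.card (Gamma0 18 ⧸ levelSubgroup n n))).map fun i =>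
    row ((Fintype.equivFin _).symm i).out
  have hlen : R.length = (levelSubgroup n n).index := by
    simp [R, Subgroup.index]
  have hget (i : ℕ) (hi : i < R.length) : ∃ q : Gamma0 18 ⧸ levelSubgroup n n,
      R.getD i (0, 0, 0, 0, 0) = row q.out ∧ (Fintype.equivFin _ q : ℕ) = i := by
    refine ⟨(Fintype.equivFin _).symm ⟨i, by simpa [R] using hi⟩, ?_, by simp⟩
    rw [List.getD_eq_getElem _ _ hi]
    simp [R]
  have hle (t : ℕ × ℕ × ℕ) (ht : t ∈ P ++ N) : t.1 ≤ R.length ∧ t.2.1 ≤ R.length := by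
    rw [hlen]
    exact ⟨(hexp t ht).1.trans h0, (hexp t ht).2.trans h1⟩
  refine ⟨P, N, R, x, y, hle, ?_, ?_, ?_, ?_⟩
  · intro h
    rw [← hPN, map_sub, eval_natPoly R.length, eval_natPoly R.length, h, sub_self] at hxy
    exact hxy rfl
  · rw [expansionSum_modEq_iff, hPN]
    have hdeg (i : Fin 2) : (C c * F).degreeOf i ≤ R.length := by
      rw [← hPN]
      refine (degreeOf_sub_le _ _ _).trans (max_le ?_ ?_)
      · exact degreeOf_natPoly_le (fun t ht => hle t (List.mem_append_left _ ht)) i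
      · exact degreeOf_natPoly_le (fun t ht => hle t (List.mem_append_right _ ht)) i
    exact X_pow_dvd_truncPoly hn (hdeg 0) (hdeg 1) (Ideal.mul_mem_left _ _ hF)
  · intro r hr
    simp only [R, List.mem_map] at hr
    obtain ⟨i, -, rfl⟩ := hr
    exact hrow _
  · intro i hi j hj hij
    obtain ⟨q, hq, rfl⟩ := hget i hi
    obtain ⟨q', hq', rfl⟩ := hget j hj
    rw [hq, hq'] at hij
    obtain ⟨γ, hγ⟩ := (hrow q.out).exists_represents
    obtain ⟨δ, hδ⟩ := (hrow q'.out).exists_represents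
    rw [cosetRowEquiv_iff hγ hδ, hrow' _ _ hγ, hrow' _ _ hδ, QuotientGroup.out_eq',
      QuotientGroup.out_eq'] at hij
    rw [hij]

end Certificates

section Search

open Primrec

variable {α β : Type*} [Primcodable α] [Primcodable β]

/-- Unbounded search for a solution of a primitive recursive relation. -/
theorem exists_computable_of_primrecRel {r : α → β → Prop} (hr : PrimrecRel r)
    (h : ∀ a, ∃ b, r a b) : ∃ f : α → β, Computable f ∧ ∀ a, r a (f a) := by
  classical
  let s (a : α) (k : ℕ) : Option β := (Encodable.decode k : Option β).bind fun b =>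
    if r a b then some b else none
  have hs : Computable₂ s := Primrec₂.to_comp <| Primrec.option_bind (Primrec.decode.comp snd)
    (Primrec.ite (hr.comp (fst.comp fst) snd) (Primrec.option_some.comp snd) (Primrec.const none))
  have hmem {a : α} {k : ℕ} {b : β} (hb : b ∈ s a k) : r a b := by
    simp only [s, Option.mem_def, Option.bind_eq_some_iff] at hb
    obtain ⟨b', -, hb⟩ := hb
    split_ifs at hb with h1
    · cases hb
      exact h1
  have hdom (a : α) : (Nat.rfindOpt (s a)).Dom := by
    obtain ⟨b, hb⟩ := h a
    refine Nat.rfindOpt_dom.mpr ⟨Encodable.encode b, b, ?_⟩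
    simp [s, hb]
  refine ⟨fun a => (Nat.rfindOpt (s a)).get (hdom a),
    (Partrec.rfindOpt hs).of_eq_tot fun a => Part.get_mem _, fun a => ?_⟩
  obtain ⟨k, hk⟩ := Nat.rfindOpt_spec (Part.get_mem (hdom a))
  exact hmem hk

lemma Primrec.natPow : Primrec₂ ((· ^ ·) : ℕ → ℕ → ℕ) := Primrec₂.unpaired'.mp Nat.Primrec.pow

lemma Primrec.list_sum_map {f : α → List β} {g : α → β → ℕ} (hf : Primrec f) (hg : Primrec₂ g) :
    Primrec fun a => ((f a).map (g a)).sum :=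
  (list_foldr hf (Primrec.const 0) (Primrec.nat_add.comp (hg.comp fst (fst.comp snd))
    (snd.comp snd)).to₂).of_eq fun a => by
      induction f a with
      | nil => rfl
      | cons b l ih => simp [ih]

lemma Primrec.psiSum {B x : α → ℕ} (hB : Primrec B) (hx : Primrec x) :
    Primrec fun a => psiSum (B a) (x a) :=
  (list_sum_map (g := fun a k => x a ^ (k * (k + 1) / 2)) (list_range.comp hB)
    (natPow.comp (hx.comp fst) (nat_div.comp (nat_mul.comp snd (succ.comp snd))
      (Primrec.const 2))).to₂).of_eq fun _ => rfl

lemma Primrec.termSum {m a b c d : α → ℕ} {L : α → List (ℕ × ℕ × ℕ)} (hm : Primrec m)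
    (ha : Primrec a) (hb : Primrec b) (hc : Primrec c) (hd : Primrec d) (hL : Primrec L) :
    Primrec fun z => termSum (m z) (a z) (b z) (c z) (d z) (L z) := by
  have h1 : Primrec fun p : α × ℕ × ℕ × ℕ => p.2.1 := fst.comp snd
  have h2 : Primrec fun p : α × ℕ × ℕ × ℕ => p.2.2.1 := fst.comp (snd.comp snd)
  have h3 : Primrec fun p : α × ℕ × ℕ × ℕ => p.2.2.2 := snd.comp (snd.comp snd)
  refine list_sum_map (g := fun z t => t.2.2 *
    (a z ^ t.1 * b z ^ (m z - t.1) * (c z ^ t.2.1 * d z ^ (m z - t.2.1)))) hL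
    (nat_mul.comp h3 (nat_mul.comp (nat_mul.comp (natPow.comp (ha.comp fst) h1)
      (natPow.comp (hb.comp fst) (nat_sub.comp (hm.comp fst) h1)))
      (nat_mul.comp (natPow.comp (hc.comp fst) h2)
      (natPow.comp (hd.comp fst) (nat_sub.comp (hm.comp fst) h2))))).to₂

lemma Primrec.expansionSum {n m B x : α → ℕ} {L : α → List (ℕ × ℕ × ℕ)} (hn : Primrec n)
    (hm : Primrec m) (hB : Primrec B) (hx : Primrec x) (hL : Primrec L) :
    Primrec fun z => expansionSum (n z) (m z) (B z) (x z) (L z) := by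
  have hxn := natPow.comp hx hn
  have h9 : Primrec fun _ : α => 9 := Primrec.const 9
  exact Primrec.termSum hm (nat_mul.comp hx (Primrec.psiSum hB (natPow.comp hx h9)))
    (Primrec.psiSum hB hx) (nat_mul.comp hxn (Primrec.psiSum hB (natPow.comp hxn h9)))
    (Primrec.psiSum hB hxn) hL

lemma Primrec.signedTerms {P N : α → List (ℕ × ℕ × ℕ)} (hP : Primrec P) (hN : Primrec N) :
    Primrec fun a => signedTerms (P a) (N a) := by
  have hpos : Primrec fun c : ℕ => (c : ℤ) :=
    encode_iff.mp ((nat_mul.comp (Primrec.const 2) Primrec.id).of_eq fun _ => rfl)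
  have hneg : Primrec fun c : ℕ => -(c : ℤ) :=
    encode_iff.mp ((nat_sub.comp (nat_mul.comp (Primrec.const 2) Primrec.id) (Primrec.const 1)).of_eq
      fun c => by cases c <;> rfl)
  have h1 : Primrec fun p : α × ℕ × ℕ × ℕ => p.2.1 := fst.comp snd
  have h2 : Primrec fun p : α × ℕ × ℕ × ℕ => p.2.2.1 := fst.comp (snd.comp snd)
  have h3 : Primrec fun p : α × ℕ × ℕ × ℕ => p.2.2.2 := snd.comp (snd.comp snd)
  exact list_append.comp
    (list_map hP (h1.pair (h2.pair ((hpos.comp h3).pair (Primrec.const 1)))).to₂)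
    (list_map hN (h1.pair (h2.pair ((hneg.comp h3).pair (Primrec.const 1)))).to₂)

lemma primrecRel_isCosetRow : PrimrecRel IsCosetRow := by
  have hr : Primrec fun p : ℕ × ℕ × ℕ × ℕ × ℕ × ℕ => p.2 := snd
  have ha := fst.comp hr
  have hb := fst.comp (snd.comp hr)
  have hc := fst.comp (snd.comp (snd.comp hr))
  have hd := fst.comp (snd.comp (snd.comp (snd.comp hr)))
  have hu := snd.comp (snd.comp (snd.comp (snd.comp hr)))
  exact (Primrec.eq.comp (nat_mul.comp ha hd) (nat_add.comp (Primrec.const 1)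
    (nat_mul.comp (nat_mul.comp (Primrec.const 18) hb) hc))).and
    ((Primrec.eq.comp hu (Primrec.const 1)).or (Primrec.eq.comp (succ.comp hu) fst))

lemma PrimrecPred.cosetRowEquiv {n : α → ℕ} {r s : α → ℕ × ℕ × ℕ × ℕ × ℕ} (hn : Primrec n)
    (hr : Primrec r) (hs : Primrec s) : PrimrecPred fun a => CosetRowEquiv (n a) (r a) (s a) := by
  have hb : Primrec fun r : ℕ × ℕ × ℕ × ℕ × ℕ => r.2.1 := fst.comp snd
  have hd : Primrec fun r : ℕ × ℕ × ℕ × ℕ × ℕ => r.2.2.2.1 := fst.comp (snd.comp (snd.comp snd))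
  have hu : Primrec fun r : ℕ × ℕ × ℕ × ℕ × ℕ => r.2.2.2.2 := snd.comp (snd.comp (snd.comp snd))
  exact Primrec.eq.comp
    (nat_mod.comp (nat_mul.comp (hd.comp hr) (nat_mul.comp (hb.comp hs) (hu.comp hs))) hn)
    (nat_mod.comp (nat_mul.comp (nat_mul.comp (hb.comp hr) (hu.comp hr)) (hd.comp hs)) hn)

lemma PrimrecRel.forall_mem {r : α → β → Prop} (hr : PrimrecRel r) {f : α → List β}
    (hf : Primrec f) : PrimrecPred fun a => ∀ b ∈ f a, r a b :=
  (PrimrecRel.forall_mem_list (R := fun b a => r a b) (hr.comp snd fst)).comp hf Primrec.id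

lemma PrimrecRel.forall_lt_of {r : α → ℕ → Prop} (hr : PrimrecRel r) {f : α → ℕ}
    (hf : Primrec f) : PrimrecPred fun a => ∀ k < f a, r a k :=
  (hr.forall_mem (list_range.comp hf)).of_eq fun a => by simp

/-- It is decidable by a primitive recursive procedure whether given data are a certificate. -/
theorem primrecRel_isCertificate : PrimrecRel fun (n : ℕ)
    (z : List (ℕ × ℕ × ℕ) × List (ℕ × ℕ × ℕ) × List (ℕ × ℕ × ℕ × ℕ × ℕ) × ℕ × ℕ) =>
      IsCertificate n z.1 z.2.1 z.2.2.1 z.2.2.2.1 z.2.2.2.2 := by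
  let A := ℕ × List (ℕ × ℕ × ℕ) × List (ℕ × ℕ × ℕ) × List (ℕ × ℕ × ℕ × ℕ × ℕ) × ℕ × ℕ
  have hn : Primrec fun z : A => z.1 := fst
  have hP : Primrec fun z : A => z.2.1 := fst.comp snd
  have hN : Primrec fun z : A => z.2.2.1 := fst.comp (snd.comp snd)
  have hR : Primrec fun z : A => z.2.2.2.1 := fst.comp (snd.comp (snd.comp snd))
  have hx : Primrec fun z : A => z.2.2.2.2.1 := fst.comp (snd.comp (snd.comp (snd.comp snd)))
  have hy : Primrec fun z : A => z.2.2.2.2.2 := snd.comp (snd.comp (snd.comp (snd.comp snd)))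
  have hm := list_length.comp hR
  have h1 : Primrec fun _ : A => 1 := Primrec.const 1
  have hB := succ.comp (nat_mul.comp (nat_mul.comp (Primrec.const 2) hm)
    (natPow.comp hn (Primrec.const 2)))
  have hQ := succ.comp (nat_add.comp (Primrec.expansionSum hn hm hB h1 hP)
    (Primrec.expansionSum hn hm hB h1 hN))
  have hexp : PrimrecPred fun z : A => ∀ t ∈ z.2.1 ++ z.2.2.1,
      t.1 ≤ z.2.2.2.1.length ∧ t.2.1 ≤ z.2.2.2.1.length :=
    PrimrecRel.forall_mem (r := fun (z : A) t => t.1 ≤ z.2.2.2.1.length ∧ t.2.1 ≤ z.2.2.2.1.length)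
      (PrimrecPred.and (nat_le.comp (fst.comp snd) (hm.comp fst))
        (nat_le.comp (fst.comp (snd.comp snd)) (hm.comp fst))) (list_append.comp hP hN)
  have heval := (Primrec.eq.comp (Primrec.termSum hm hx h1 hy h1 hP)
    (Primrec.termSum hm hx h1 hy h1 hN)).not
  have hmod := Primrec.eq.comp (nat_mod.comp (Primrec.expansionSum hn hm hB hQ hP) (natPow.comp hQ hB))
    (nat_mod.comp (Primrec.expansionSum hn hm hB hQ hN) (natPow.comp hQ hB))
  have hrow : PrimrecPred fun z : A => ∀ r ∈ z.2.2.2.1, IsCosetRow z.1 r :=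
    PrimrecRel.forall_mem (r := fun (z : A) r => IsCosetRow z.1 r)
      (primrecRel_isCosetRow.comp (hn.comp fst) snd) hR
  have hineq : PrimrecPred fun z : A => ∀ i < z.2.2.2.1.length, ∀ j < z.2.2.2.1.length,
      CosetRowEquiv z.1 (z.2.2.2.1.getD i (0, 0, 0, 0, 0)) (z.2.2.2.1.getD j (0, 0, 0, 0, 0)) →
        i = j := by
    refine PrimrecRel.forall_lt_of (r := fun (z : A) i => ∀ j < z.2.2.2.1.length, _)
      (PrimrecRel.forall_lt_of (α := A × ℕ) (r := fun p j => _) ?_ (hm.comp fst)) hm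
    have hz : Primrec fun p : (A × ℕ) × ℕ => p.1.1 := fst.comp fst
    have hi : Primrec fun p : (A × ℕ) × ℕ => p.1.2 := snd.comp fst
    exact ((PrimrecPred.cosetRowEquiv (hn.comp hz) ((list_getD _).comp (hR.comp hz) hi)
      ((list_getD _).comp (hR.comp hz) snd)).not.or (Primrec.eq.comp hi snd)).of_eq
        fun _ => imp_iff_not_or.symm
  exact (hexp.and (heval.and (hmod.and (hrow.and hineq)))).of_eq fun z =>
    ⟨fun h => ⟨h.1, h.2.1, h.2.2.1, h.2.2.2.1, h.2.2.2.2⟩, fun h =>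
      ⟨h.exponents_le, h.eval_ne, h.modEq, h.rows, h.rows_inequivalent⟩⟩

end Search

theorem theorem2 :
    ∃ L : ℕ → List (ℕ × ℕ × ℤ × ℕ), Computable L ∧
      ∀ n : ℕ, 0 < n →
        Irreducible (polyOfTerms (L n)) ∧
        IsModularEquation n (polyOfTerms (L n)) ∧
        IsModularFunctionHolo (18 * n) (wLevel 1) ∧
        IsModularFunctionHolo (18 * n) (wLevel n) ∧
        (polyOfTerms (L n)).degreeOf 0 = totalPoleDegree (18 * n) (wLevel n) ∧
        (polyOfTerms (L n)).degreeOf 1 = totalPoleDegree (18 * n) (wLevel 1) := by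
  obtain ⟨f, hf, hcert⟩ := exists_computable_of_primrecRel (r := fun (n : ℕ)
    (z : List (ℕ × ℕ × ℕ) × List (ℕ × ℕ × ℕ) × List (ℕ × ℕ × ℕ × ℕ × ℕ) × ℕ × ℕ) =>
      n = 0 ∨ IsCertificate n z.1 z.2.1 z.2.2.1 z.2.2.2.1 z.2.2.2.2)
    (PrimrecPred.or (Primrec.eq.comp Primrec.fst (Primrec.const 0)) primrecRel_isCertificate)
    (fun n => by
      rcases Nat.eq_zero_or_pos n with hn | hn
      · exact ⟨([], [], [], 0, 0), Or.inl hn⟩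
      · obtain ⟨P, N, R, x, y, h⟩ := exists_isCertificate hn
        exact ⟨(P, N, R, x, y), Or.inr h⟩)
  refine ⟨fun n => signedTerms (f n).1 (f n).2.1, ?_, fun n hn => ?_⟩
  · exact (Primrec.signedTerms Primrec.fst (Primrec.fst.comp Primrec.snd)).to_comp.comp hf
  · obtain ⟨h1, h2, h3, h4⟩ := ((hcert n).resolve_left hn.ne').modularEquation hn
    rw [polyOfTerms_signedTerms, totalPoleDegree_wLevel hn (Or.inl rfl),
      totalPoleDegree_wLevel hn (Or.inr rfl)]
    exact ⟨h1, h2, isModularFunctionHolo_wLevel hn one_pos (one_dvd n),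
      isModularFunctionHolo_wLevel hn hn dvd_rfl, h3, h4⟩
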